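/- Let $\mathcal J,\mathcal A,\mathcal I$ be finite index sets and let the phase space $\Gamma$ be an open subset of $\mathbb R^{\mathcal J}\times\mathbb R^{\mathcal J}$ with Darboux coordinates $(q_i,p^j)$ and the Poisson bracket with $\{q_i,p^j\}=\delta_i^j$. *Gauge theories.* A gauge theory $(U,c)$ is an open set $U$ of a phase space with smooth functions $c_a$ on $U$ (constraints; a Hamiltonian is included as $H-E$) whose differentials are linearly independent at each point of the surface $\{c=0\}\subset U$ and whose mutual brackets $\{c_a,c_b\}$ vanish on that surface (regular, irreducible, first class). Two constraint sets are equivalent if they have the same zero set. In a gauge theory $(U,c,d)$, conditions $g=(g_a)$ *gauge-fix* $c$ if inside $S=\{c=d=0\}$ each gauge orbit generated by $c$ (points joined by piecewise $C^1$ curves in $S$ with velocity $\sum_a\lambda^a(t)v_a$, where $v_a f=\{c_a,f\}$ and the $\lambda^a$ are continuous on each piece) contains exactly one point with $g=0$, and $(\{c_a,g_b\})$ is invertible on $S\cap\{g=0\}$. When the family $s=(c,g)$ is second class on $\{c=g=0\}$, meaning that $C_{mn}=\{s_m,s_n\}$ is invertible there, the *reduced theory* is the set $\{c=g=0\}$ with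 the Dirac bracket $\{f,h\}_D=\{f,h\}-\{f,s_m\}(C^{-1})_{mn}\{s_n,h\}$ and the remaining constraints $d$. Two gauge theories on $U$ are *equivalent* if there are gauge fixings of both whose reduced theories coincide: the same reduced phase space (with the same zero set of the remaining constraints) and the same Dirac bracket on it. *Hypotheses.* Let $\chi=(\chi_\alpha)_{\alpha\in\mathcal A}$, $\sigma=(\sigma^\alpha)_{\alpha\in\mathcal A}$ and $\eta=(\eta^i)_{i\in\mathcal I}$ be smooth functions on $\Gamma$ such that $(\Gamma,\chi)$, $(\Gamma,\sigma)$, $(\Gamma,\chi,\eta)$ and $(\Gamma,\sigma,\eta)$ are gauge theories, none of them assumed Abelian, and such that the matrix $(\{\chi_\alpha,\sigma^\beta\})$ is invertible at each point of $\Sigma=\{\chi=0=\sigma\}$. *Conclusion.* The gauge theories $(\Gamma,\chi,\eta)$ and $(\Gamma,\sigma,\eta)$ are equivalent, in the following sense. 1. On all of $\Gamma$: imposing $\sigma=0$ on $(\Gamma,\chi,\eta)$ and imposing $\chi=0$ on $(\Gamma,\sigma,\eta)$ yield the same reduced phase space $\Sigma$, on which $(\chi,\sigma)$ is second class, with the same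 Dirac bracket and the same remaining constraint surface $\Sigma\cap\{\eta=0\}$; on this surface the Dirac brackets $\{\eta^i,\eta^j\}_D$ vanish. 2. Each point of $\Sigma$ has arbitrarily small open neighbourhoods $U\subset\Gamma$ on which the following hold. (a) In $(U,\chi,\eta)$ the conditions $\sigma=0$ gauge-fix $\chi$, in $(U,\sigma,\eta)$ the conditions $\chi=0$ gauge-fix $\sigma$, and the reduced theories coincide. Thus $(U,\chi,\eta)$ and $(U,\sigma,\eta)$ are equivalent. (b) They have a linking theory. There are smooth invertible matrix functions $M,N$ on $U$ such that $\tilde\chi=M\chi$ and $\tilde\sigma=N\sigma$ satisfy $\{\tilde\chi_\alpha,\tilde\chi_\beta\}=0=\{\tilde\sigma^\alpha,\tilde\sigma^\beta\}$ and $\{\tilde\chi_\alpha,\tilde\sigma^\beta\}=\delta_\alpha^\beta$ on all of $U$, and there are smooth functions $\eta'^i$ on $U$ with $\eta'=\eta$ on $\Sigma\cap U$, such that on the extended phase space $U_{ex}=U\times\mathbb R^{\mathcal A}\times\mathbb R^{\mathcal A}$ with additional canonical pairs $(\phi_\alpha,\pi^\alpha)$ the constraints $\bar\chi=M^{-1}\phi-\chi$,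 $\bar\sigma=N^{-1}\pi+\sigma$ and $\eta'$ form a gauge theory with two partial gauge fixings. The conditions $\phi=0$ gauge-fix $\bar\sigma$, and phase space reduction, $(\phi,\pi)\to(0,-N\sigma)$, yields $(U,\chi,\eta)$. The conditions $\pi=0$ gauge-fix $\bar\chi$, and phase space reduction, $(\phi,\pi)\to(M\chi,0)$, yields $(U,\sigma,\eta)$. In both cases the gauge-fixed constraints together with the gauge conditions are second class, $U$ smoothly parametrises the reduced phase space, the Dirac bracket becomes the Poisson bracket of $U$, and the remaining constraints become a set equivalent to $(\chi,\eta)$, respectively $(\sigma,\eta)$. -/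

import Mathlib

open Set Topology
open scoped ContDiff

namespace SymTrading

/-- Darboux coordinates `(q, p)` with degrees of freedom labelled by `ι`. A phase space is an open
subset of `Phase ι`. -/
abbrev Phase (ι : Type*) : Type _ := (ι → ℝ) × (ι → ℝ)

noncomputable section

variable {ι κ μ ν : Type*}

/-- `∂f/∂q_i` -/
def dq [Fintype ι] [DecidableEq ι] (f : Phase ι → ℝ) (i : ι) (x : Phase ι) : ℝ :=
  fderiv ℝ f x (Pi.single i 1, 0)

/-- `∂f/∂p^i` -/
def dp [Fintype ι] [DecidableEq ι] (f : Phase ι → ℝ) (i : ι) (x : Phase ι) : ℝ :=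
  fderiv ℝ f x (0, Pi.single i 1)

/-- The canonical Poisson bracket, normalised by `{q_i, p^j} = δ_i^j`. -/
def poisson [Fintype ι] [DecidableEq ι] (f g : Phase ι → ℝ) (x : Phase ι) : ℝ :=
  ∑ i, (dq f i x * dp g i x - dp f i x * dq g i x)

/-- The vector field `v` generated by `f`, i.e. `dg(v) = {f, g}` for all `g`. -/
def hamVec [Fintype ι] [DecidableEq ι] (f : Phase ι → ℝ) (x : Phase ι) : Phase ι :=
  (fun i => -dp f i x, fun i => dq f i x)

/-- The constraint surface of a set of constraints on the phase space `U`. -/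
def surface (U : Set (Phase ι)) (c : κ → Phase ι → ℝ) : Set (Phase ι) :=
  {x | x ∈ U ∧ ∀ a, c a x = 0}

/-- A gauge theory: an open phase space with smooth constraints that are regular and irreducible
(their differentials are independent on the constraint surface) and first class (their brackets
vanish on the constraint surface). A Hamiltonian `H` is one of the constraints, as `H - E`. -/
structure IsGaugeTheory [Fintype ι] [DecidableEq ι] (U : Set (Phase ι))
    (c : κ → Phase ι → ℝ) : Prop where
  isOpen : IsOpen U
  smooth : ∀ a, ContDiffOn ℝ ∞ (c a) U
  regular : ∀ x ∈ surface U c, LinearIndependent ℝ (fun a => fderiv ℝ (c a) x)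
  firstClass : ∀ x ∈ surface U c, ∀ a b, poisson (c a) (c b) x = 0

/-- The matrix of brackets `{c_a, g_b}` at `x`. -/
def bracketMatrix [Fintype ι] [DecidableEq ι] (c : κ → Phase ι → ℝ) (g : μ → Phase ι → ℝ)
    (x : Phase ι) : Matrix κ μ ℝ :=
  Matrix.of fun a b => poisson (c a) (g b) x

/-- The Dirac bracket of the second class set `s`:
`{f, h} - ∑ {f, s_a} (C⁻¹)_{ab} {s_b, h}` with `C_{ab} = {s_a, s_b}`. -/
def diracBracket [Fintype ι] [DecidableEq ι] [Fintype κ] [DecidableEq κ]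
    (s : κ → Phase ι → ℝ) (f h : Phase ι → ℝ) (x : Phase ι) : ℝ :=
  poisson f h x -
    ∑ a, ∑ b, poisson f (s a) x * (bracketMatrix s s x)⁻¹ a b * poisson (s b) h x

/-- `x` and `y` are joined by a curve in `S` whose velocity is a combination of the generators of
the constraints `c`, with continuous multipliers. -/
def GaugeStep [Fintype ι] [DecidableEq ι] [Fintype κ] (S : Set (Phase ι))
    (c : κ → Phase ι → ℝ) (x y : Phase ι) : Prop :=
  ∃ (γ : ℝ → Phase ι) (l : ℝ → κ → ℝ), ContinuousOn l (Icc 0 1) ∧ γ 0 = x ∧ γ 1 = y ∧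
    ∀ t ∈ Icc (0 : ℝ) 1, γ t ∈ S ∧
      HasDerivWithinAt γ (∑ a, l t a • hamVec (c a) (γ t)) (Icc 0 1) t

/-- The gauge orbit of `x` in `S` under the transformations generated by the constraints `c`. -/
def gaugeOrbit [Fintype ι] [DecidableEq ι] [Fintype κ] (S : Set (Phase ι))
    (c : κ → Phase ι → ℝ) (x : Phase ι) : Set (Phase ι) :=
  {y | Relation.EqvGen (GaugeStep S c) x y}

/-- In the gauge theory with constraints `c` and `d`, the conditions `g = 0` gauge-fix the
constraints `c`: on the constraint surface every gauge orbit generated by `c` contains exactly one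
point with `g = 0`, and the Dirac matrix `{c_a, g_b}` is invertible where `g = 0`. -/
structure IsPartialGaugeFixing [Fintype ι] [DecidableEq ι] [Fintype κ] [DecidableEq κ]
    (U : Set (Phase ι)) (c : κ → Phase ι → ℝ) (d : μ → Phase ι → ℝ)
    (g : κ → Phase ι → ℝ) : Prop where
  orbit : ∀ x ∈ surface U (Sum.elim c d),
    ∃! y, y ∈ gaugeOrbit (surface U (Sum.elim c d)) c x ∧ ∀ a, g a y = 0
  dirac : ∀ x ∈ surface U (Sum.elim c d), (∀ a, g a x = 0) → IsUnit (bracketMatrix c g x)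

/-- Fixing the constraints `c` by `g` (leaving `d`) and fixing the constraints `c'` by `g'`
(leaving `d'`) yields one and the same reduced theory: the same reduced phase space, on which
`(c, g)` and `(c', g')` are second class, with the same Dirac bracket, and the same surface of
remaining constraints, which are first class for the Dirac bracket. -/
structure HaveCommonReduction [Fintype ι] [DecidableEq ι] [Fintype κ] [DecidableEq κ]
    (U : Set (Phase ι)) (c : κ → Phase ι → ℝ) (d : μ → Phase ι → ℝ) (g : κ → Phase ι → ℝ)
    (c' : κ → Phase ι → ℝ) (d' : ν → Phase ι → ℝ) (g' : κ → Phase ι → ℝ) : Prop where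
  phaseSpace : surface U (Sum.elim c g) = surface U (Sum.elim c' g')
  secondClass : ∀ x ∈ surface U (Sum.elim c g),
    IsUnit (bracketMatrix (Sum.elim c g) (Sum.elim c g) x) ∧
    IsUnit (bracketMatrix (Sum.elim c' g') (Sum.elim c' g') x)
  bracket : ∀ f h : Phase ι → ℝ, ContDiffOn ℝ ∞ f U → ContDiffOn ℝ ∞ h U →
    ∀ x ∈ surface U (Sum.elim c g),
      diracBracket (Sum.elim c g) f h x = diracBracket (Sum.elim c' g') f h x
  constraints : surface U (Sum.elim (Sum.elim c g) d) = surface U (Sum.elim (Sum.elim c' g') d')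
  firstClass : ∀ x ∈ surface U (Sum.elim (Sum.elim c g) d),
    (∀ i j, diracBracket (Sum.elim c g) (d i) (d j) x = 0) ∧
    (∀ i j, diracBracket (Sum.elim c' g') (d' i) (d' j) x = 0)

/-- The gauge theories `(U, c, d)` and `(U, c', d')` are equivalent, by means of the gauge fixing
conditions `g` for the first and `g'` for the second: the gauge-fixed theories have the same
initial value problem (reduced phase space) and the same equations of motion (Dirac bracket). -/
structure EquivalentVia [Fintype ι] [DecidableEq ι] [Fintype κ] [DecidableEq κ]
    (U : Set (Phase ι)) (c : κ → Phase ι → ℝ) (d : μ → Phase ι → ℝ) (g : κ → Phase ι → ℝ)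
    (c' : κ → Phase ι → ℝ) (d' : ν → Phase ι → ℝ) (g' : κ → Phase ι → ℝ) : Prop where
  theory : IsGaugeTheory U (Sum.elim c d)
  theory' : IsGaugeTheory U (Sum.elim c' d')
  fixing : IsPartialGaugeFixing U c d g
  fixing' : IsPartialGaugeFixing U c' d' g'
  reduction : HaveCommonReduction U c d g c' d' g'

/-- Phase space reduction: fixing the constraints `c` of the theory `(V, c, d)` by `g` yields the
gauge theory `(U, e)`. The map `j` is a parametrisation of the reduced phase space `c = g = 0` by
`U` that carries the Dirac bracket to the canonical Poisson bracket of `U`, and the remaining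
constraints `d` become a set of constraints on `U` equivalent to `e`. -/
structure ReducesTo {ι' : Type*} [Fintype ι] [DecidableEq ι] [Fintype ι'] [DecidableEq ι']
    [Fintype κ] [DecidableEq κ] (V : Set (Phase ι')) (c : κ → Phase ι' → ℝ)
    (d : μ → Phase ι' → ℝ) (g : κ → Phase ι' → ℝ) (U : Set (Phase ι)) (e : ν → Phase ι → ℝ)
    (j : Phase ι → Phase ι') : Prop where
  fixing : IsPartialGaugeFixing V c d g
  theory : IsGaugeTheory U e
  smooth : ContDiffOn ℝ ∞ j U
  bijOn : BijOn j U (surface V (Sum.elim c g))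
  secondClass : ∀ x ∈ U, IsUnit (bracketMatrix (Sum.elim c g) (Sum.elim c g) (j x))
  bracket : ∀ f h : Phase ι' → ℝ, ContDiffOn ℝ ∞ f V → ContDiffOn ℝ ∞ h V →
    ∀ x ∈ U, diracBracket (Sum.elim c g) f h (j x) = poisson (f ∘ j) (h ∘ j) x
  constraints : surface U (fun m => d m ∘ j) = surface U e

/-- The projection of the extended phase space, with variables `(q, φ; p, π)`, to `(q, p)`. -/
def base {A : Type*} (z : Phase (ι ⊕ A)) : Phase ι := (z.1 ∘ Sum.inl, z.2 ∘ Sum.inl)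

/-- The extra variable `φ_a`. -/
def phiCoord {A : Type*} (a : A) (z : Phase (ι ⊕ A)) : ℝ := z.1 (Sum.inr a)

/-- The momentum `π^a` conjugate to `φ_a`. -/
def piCoord {A : Type*} (a : A) (z : Phase (ι ⊕ A)) : ℝ := z.2 (Sum.inr a)

/-- The point of the extended phase space over `x` with given values of `φ` and `π`. -/
def lift {A : Type*} (x : Phase ι) (φ π : A → ℝ) : Phase (ι ⊕ A) :=
  (Sum.elim x.1 φ, Sum.elim x.2 π)

/-- The recombined constraints `∑_b M_{ab} c_b`. -/
def recombine {A : Type*} [Fintype A] (M : Phase ι → Matrix A A ℝ) (c : A → Phase ι → ℝ) (a : A)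
    (x : Phase ι) : ℝ :=
  ∑ b, M x a b * c b x

/-- The linking constraints `(M⁻¹)_{ab} φ_b - χ_a` on the extended phase space. -/
def linkChi {A : Type*} [Fintype A] [DecidableEq A] (M : Phase ι → Matrix A A ℝ)
    (χ : A → Phase ι → ℝ) (a : A) (z : Phase (ι ⊕ A)) : ℝ :=
  ∑ b, (M (base z))⁻¹ a b * phiCoord b z - χ a (base z)

/-- The linking constraints `(N⁻¹)_{ab} π^b + σ^a` on the extended phase space. -/
def linkSigma {A : Type*} [Fintype A] [DecidableEq A] (N : Phase ι → Matrix A A ℝ)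
    (σ : A → Phase ι → ℝ) (a : A) (z : Phase (ι ⊕ A)) : ℝ :=
  ∑ b, (N (base z))⁻¹ a b * piCoord b z + σ a (base z)

/-- The constraint sets `M χ` and `N σ` are smooth invertible recombinations of `χ` and `σ` on `U`
that are Abelian and canonically conjugate on all of `U`. -/
structure IsConjugateAbelianization {A : Type*} [Fintype ι] [DecidableEq ι] [Fintype A]
    [DecidableEq A] (U : Set (Phase ι)) (χ σ : A → Phase ι → ℝ)
    (M N : Phase ι → Matrix A A ℝ) : Prop where
  smoothM : ∀ a b, ContDiffOn ℝ ∞ (fun x => M x a b) U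
  smoothN : ∀ a b, ContDiffOn ℝ ∞ (fun x => N x a b) U
  unitM : ∀ x ∈ U, IsUnit (M x)
  unitN : ∀ x ∈ U, IsUnit (N x)
  abelianChi : ∀ x ∈ U, ∀ a b, poisson (recombine M χ a) (recombine M χ b) x = 0
  abelianSigma : ∀ x ∈ U, ∀ a b, poisson (recombine N σ a) (recombine N σ b) x = 0
  conjugate : ∀ x ∈ U, ∀ a b,
    poisson (recombine M χ a) (recombine N σ b) x = if a = b then 1 else 0

/-- The linking theory of `(U, χ, η)` and `(U, σ, η)`: on the extended phase space over `U`, the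
constraints `M⁻¹ φ - χ`, `N⁻¹ π + σ` and `η'` form a gauge theory, where `η'` extends the
restriction of `η` to `χ = σ = 0`. The partial gauge fixing `φ = 0` fixes `N⁻¹ π + σ` and reduces
it, with `π = - N σ`, to `(U, χ, η)`; the partial gauge fixing `π = 0` fixes `M⁻¹ φ - χ` and
reduces it, with `φ = M χ`, to `(U, σ, η)`. -/
structure IsLinkingTheory {A I : Type*} [Fintype ι] [DecidableEq ι] [Fintype A]
    [DecidableEq A] (U : Set (Phase ι)) (χ σ : A → Phase ι → ℝ) (η η' : I → Phase ι → ℝ)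
    (M N : Phase ι → Matrix A A ℝ) : Prop where
  extends_eta : ∀ x ∈ surface U (Sum.elim χ σ), ∀ i, η' i x = η i x
  theory : IsGaugeTheory (base ⁻¹' U : Set (Phase (ι ⊕ A)))
    (Sum.elim (Sum.elim (linkChi M χ) (linkSigma N σ)) (fun i => η' i ∘ base))
  reducesToChi : ReducesTo (base ⁻¹' U) (linkSigma N σ)
    (Sum.elim (linkChi M χ) (fun i => η' i ∘ base)) phiCoord
    U (Sum.elim χ η) (fun x => lift x 0 (fun a => -recombine N σ a x))
  reducesToSigma : ReducesTo (base ⁻¹' U) (linkChi M χ)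
    (Sum.elim (linkSigma N σ) (fun i => η' i ∘ base)) piCoord
    U (Sum.elim σ η) (fun x => lift x (fun a => recombine M χ a x) 0)

end

end SymTrading

/-!
On `Γ` the two reductions agree for an algebraic reason: on `Σ = {χ = σ = 0}` the brackets `{χ, χ}`
and `{σ, σ}` vanish, so the Dirac matrix of `(χ, σ)` consists of the off-diagonal blocks `{χ, σ}`
and `-{χ, σ}ᵀ`, and the Dirac bracket is symmetric in the two sets (`haveCommonReduction`).

The local statements rest on canonical coordinates near a point of `Σ`. Both sets are recombinations
`χ = P c`, `σ = Q s` with `{c, c} = 0 = {s, s}` and `{c_a, s_b} = δ_{ab}` on a whole neighbourhood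
(`exists_conjugate_abelianization`). The mechanism is `exists_straightening`: if commuting
Hamiltonian fields are transversal to `{σ = 0}`, the time needed to flow from `{σ = 0}` to a point
is a smooth function conjugate to the Hamiltonians, and `σ` is an invertible recombination of these
times; that the times commute with each other is transported along the flow from `{σ = 0}` by the
Jacobi identity. The flow of commuting fields, as a smooth function of the flow times and of the
initial point, comes from the implicit function theorem in the Banach space of curves
(`exists_commuting_flow`).

The neighbourhood `U` is a flow box of `c` and `s` (`IsDarbouxBox`, `exists_flowBox`): it carries a
projection `z` to `Σ` that is constant along all these flows, separates points together with
`(c, s)`, and the flows lead from any point inside `U` to `s = 0` or to `c = 0`. On `χ = 0` the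
generators of `χ` are recombinations of those of `c`, so a gauge orbit is contained in a level set
of `z` and reaches `σ = 0` exactly once (`existsUnique_mem_gaugeOrbit`). The orbit does not leave
`η = 0`, since a field that is tangent to a regular zero set preserves it (`eq_zero_of_tangent`).

For the linking theory take `M = P⁻¹`, `N = Q⁻¹` and `η' = η ∘ z`. Then `M⁻¹ φ - χ = P (φ - c)` and
`N⁻¹ π + σ = Q (π + s)`, and the functions `φ - c`, `π + s` commute with each other and with `η'`:
the brackets `{φ, π}` and `{c, s}` cancel. The brackets `{η', η'}` and the independence of the
differentials `dη'` are inherited from `Σ`, because brackets of functions that commute with `c` and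
`s` are the same at `x` and at `z x` (`IsDarbouxBox.poisson_z`, `IsDarbouxBox.fderiv_z_eq_zero`).
The flows of `π + s` and of `φ - c` are lifts of those of `s` and of `c`, so that both partial gauge
fixings follow as before, and the Dirac brackets are computed directly.
-/

namespace SymTrading

/-! ### Curves in a Banach space: superposition and integration -/

section Curves

universe u v

variable {K : Type*} [TopologicalSpace K] [CompactSpace K]

/-- Pointwise application of a curve of linear maps to a curve of vectors. -/
noncomputable def curveApply (K : Type*) [TopologicalSpace K] [CompactSpace K]
    (E F : Type*) [NormedAddCommGroup E] [NormedSpace ℝ E] [NormedAddCommGroup F]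
    [NormedSpace ℝ F] : C(K, E →L[ℝ] F) →L[ℝ] C(K, E) →L[ℝ] C(K, F) :=
  LinearMap.mkContinuous₂
    (LinearMap.mk₂ ℝ (fun (L : C(K, E →L[ℝ] F)) (h : C(K, E)) =>
        (⟨fun t => L t (h t), L.continuous.clm_apply h.continuous⟩ : C(K, F)))
      (fun _ _ _ => by ext; simp) (fun _ _ _ => by ext; simp)
      (fun _ _ _ => by ext; simp) (fun _ _ _ => by ext; simp))
    1 (fun L h => by
      rw [ContinuousMap.norm_le _ (by positivity)]
      intro t
      calc ‖L t (h t)‖ ≤ ‖L t‖ * ‖h t‖ := (L t).le_opNorm _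
        _ ≤ 1 * ‖L‖ * ‖h‖ := by
          rw [one_mul]
          gcongr
          exacts [L.norm_coe_le_norm t, h.norm_coe_le_norm t])

@[simp] lemma curveApply_apply {E F : Type*} [NormedAddCommGroup E] [NormedSpace ℝ E]
    [NormedAddCommGroup F] [NormedSpace ℝ F] (L : C(K, E →L[ℝ] F)) (h : C(K, E)) (t : K) :
    curveApply K E F L h t = L t (h t) := rfl

/-- The superposition operator `γ ↦ X ∘ γ` is differentiable, with derivative
`h ↦ (t ↦ DX(γ t) (h t))`. -/
lemma hasFDerivAt_superposition {E F : Type*} [NormedAddCommGroup E] [NormedSpace ℝ E]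
    [NormedAddCommGroup F] [NormedSpace ℝ F] {X : E → F} {X' : E → E →L[ℝ] F}
    (hX : ∀ x, HasFDerivAt X (X' x) x) (hc : Continuous X) (hc' : Continuous X') (γ : C(K, E)) :
    HasFDerivAt (fun γ : C(K, E) => (⟨X, hc⟩ : C(E, F)).comp γ)
      (curveApply K E F ((⟨X', hc'⟩ : C(E, E →L[ℝ] F)).comp γ)) γ := by
  rw [hasFDerivAt_iff_isLittleO_nhds_zero, Asymptotics.isLittleO_iff]
  intro ε hε
  have hcomp : IsCompact (range γ) := isCompact_range γ.continuous
  have hu := hcomp.uniformContinuousAt_of_continuousAt X' (fun a _ => hc'.continuousAt)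
    (Metric.dist_mem_uniformity hε)
  rw [Metric.mem_uniformity_dist] at hu
  obtain ⟨δ, hδ, hu⟩ := hu
  filter_upwards [Metric.ball_mem_nhds (0 : C(K, E)) hδ] with h hh
  rw [mem_ball_zero_iff] at hh
  rw [ContinuousMap.norm_le _ (by positivity)]
  intro t
  have key := (convex_ball (γ t) δ).norm_image_sub_le_of_norm_hasFDerivWithin_le' (C := ε)
    (f := X) (f' := X') (φ := X' (γ t)) (x := γ t) (y := γ t + h t)
    (fun x _ => (hX x).hasFDerivWithinAt)
    (fun x hx => by
      have h1 : (γ t, x) ∈ {x : E × E | x.1 ∈ range γ →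
          (X' x.1, X' x.2) ∈ {p : (E →L[ℝ] F) × (E →L[ℝ] F) | dist p.1 p.2 < ε}} :=
        hu (by rw [dist_comm]; exact hx)
      have := h1 (mem_range_self t)
      rw [← dist_eq_norm, dist_comm]
      exact this.le)
    (Metric.mem_ball_self hδ)
    (by
      rw [Metric.mem_ball, dist_eq_norm, add_sub_cancel_left]
      exact (h.norm_coe_le_norm t).trans_lt hh)
  rw [add_sub_cancel_left] at key
  calc _ = ‖X (γ t + h t) - X (γ t) - X' (γ t) (h t)‖ := rfl
    _ ≤ ε * ‖h t‖ := key
    _ ≤ ε * ‖h‖ := by gcongr; exact h.norm_coe_le_norm t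

lemma contDiff_superposition_aux {E : Type u} [NormedAddCommGroup E] [NormedSpace ℝ E] (n : ℕ) :
    ∀ {F : Type max u v} [NormedAddCommGroup F] [NormedSpace ℝ F] {X : E → F}
      (hX : ContDiff ℝ n X),
      ContDiff ℝ n (fun γ : C(K, E) => (⟨X, hX.continuous⟩ : C(E, F)).comp γ) := by
  induction n with
  | zero =>
    intro F _ _ X hX
    exact contDiff_zero.2 (ContinuousMap.continuous_postcomp _)
  | succ n ih =>
    intro F _ _ X hX
    obtain ⟨X', hX', hd⟩ := contDiff_succ_iff_hasFDerivAt.1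
      (show ContDiff ℝ ((n : ℕ) + 1) X by exact_mod_cast hX)
    have : ContDiff ℝ ((n : ℕ) + 1)
        (fun γ : C(K, E) => (⟨X, hX.continuous⟩ : C(E, F)).comp γ) := by
      rw [contDiff_succ_iff_hasFDerivAt]
      exact ⟨fun γ => curveApply K E F ((⟨X', hX'.continuous⟩ : C(E, E →L[ℝ] F)).comp γ),
        ContDiff.comp (g := fun L => curveApply K E F L) (by fun_prop) (ih hX'), fun γ =>
        hasFDerivAt_superposition hd hX.continuous hX'.continuous γ⟩
    exact_mod_cast this

/-- The superposition operator of a smooth map is smooth on the space of curves. -/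
theorem contDiff_superposition {E : Type u} [NormedAddCommGroup E] [NormedSpace ℝ E]
    {F : Type v} [NormedAddCommGroup F] [NormedSpace ℝ F] {X : E → F} (hX : ContDiff ℝ ∞ X) :
    ContDiff ℝ ∞ (fun γ : C(K, E) => (⟨X, hX.continuous⟩ : C(E, F)).comp γ) := by
  rw [contDiff_infty]
  intro n
  -- Differentiation enlarges the universe of the target, so the target is lifted first.
  let e : ULift.{u, v} F ≃L[ℝ] F := ContinuousLinearEquiv.ulift
  have hX' : ContDiff ℝ n (fun x => e.symm (X x)) :=
    e.symm.contDiff.comp (hX.of_le (by exact_mod_cast le_top))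
  have h := contDiff_superposition_aux.{u, v} (K := K) n hX'
  exact ((e : ULift.{u, v} F →L[ℝ] F).compLeftContinuous ℝ K).contDiff.comp h

variable {E : Type*} [NormedAddCommGroup E]

/-- The indefinite integral of a curve on `[0, 1]`. -/
noncomputable def curveIntegral (E : Type*) [NormedAddCommGroup E] [NormedSpace ℝ E] :
    C(unitInterval, E) →L[ℝ] C(unitInterval, E) :=
  LinearMap.mkContinuous
    { toFun := fun γ => ⟨fun t => ∫ τ in (0 : ℝ)..t, γ (projIcc 0 1 zero_le_one τ),
        (intervalIntegral.continuous_primitive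
          (fun a b => (γ.continuous.comp continuous_projIcc).intervalIntegrable a b) 0).comp
          continuous_subtype_val⟩
      map_add' := fun γ δ => by
        ext t
        exact intervalIntegral.integral_add
          ((γ.continuous.comp continuous_projIcc).intervalIntegrable _ _)
          ((δ.continuous.comp continuous_projIcc).intervalIntegrable _ _)
      map_smul' := fun c γ => by
        ext t
        exact intervalIntegral.integral_smul c _ }
    1 (fun γ => by
      rw [ContinuousMap.norm_le _ (by positivity)]
      intro t
      have h := intervalIntegral.norm_integral_le_of_norm_le_const (a := 0) (b := (t : ℝ))
        (f := fun τ => γ (projIcc 0 1 zero_le_one τ)) (C := ‖γ‖)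
        (fun x _ => γ.norm_coe_le_norm _)
      refine h.trans ?_
      rw [sub_zero, abs_of_nonneg t.2.1, one_mul]
      exact mul_le_of_le_one_right (norm_nonneg _) t.2.2)

lemma curveIntegral_apply [NormedSpace ℝ E] (γ : C(unitInterval, E)) (t : unitInterval) :
    curveIntegral E γ t = ∫ τ in (0 : ℝ)..t, γ (projIcc 0 1 zero_le_one τ) := rfl

lemma curveIntegral_zero [NormedSpace ℝ E] (γ : C(unitInterval, E)) : curveIntegral E γ 0 = 0 := by
  simp [curveIntegral_apply]

/-- The curve extended constantly beyond the endpoints of `[0, 1]`. -/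
noncomputable def extend (γ : C(unitInterval, E)) (t : ℝ) : E := γ (projIcc 0 1 zero_le_one t)

lemma continuous_extend (γ : C(unitInterval, E)) : Continuous (extend γ) :=
  γ.continuous.comp continuous_projIcc

lemma extend_of_mem (γ : C(unitInterval, E)) {t : ℝ} (ht : t ∈ Icc (0 : ℝ) 1) :
    extend γ t = γ ⟨t, ht⟩ := by
  simp [extend, projIcc_of_mem _ ht]

/-- A curve `x + ∫ δ` has velocity `δ`. -/
lemma hasDerivWithinAt_extend [NormedSpace ℝ E] [CompleteSpace E] {γ δ : C(unitInterval, E)} {x : E}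
    (h : γ = ContinuousMap.const _ x + curveIntegral E δ) {t : ℝ} (ht : t ∈ Icc (0 : ℝ) 1) :
    HasDerivWithinAt (extend γ) (extend δ t) (Icc 0 1) t := by
  have h1 : HasDerivAt (fun s : ℝ => x + ∫ τ in (0 : ℝ)..s, extend δ τ) (extend δ t) t := by
    refine HasDerivAt.const_add x ?_
    exact intervalIntegral.integral_hasDerivAt_right
      ((continuous_extend δ).intervalIntegrable _ _)
      ((continuous_extend δ).stronglyMeasurableAtFilter _ _)
      (continuous_extend δ).continuousAt
  refine h1.hasDerivWithinAt.congr_of_mem (fun s hs => ?_) ht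
  rw [extend_of_mem _ hs, h]
  rfl

end Curves

/-! ### Smooth inverse and implicit functions on neighbourhoods -/

section Implicit

/-- The inverse function theorem for maps that are `C^∞` on a neighbourhood: the local inverse is
`C^∞` on a neighbourhood, not merely at the image point. -/
theorem exists_smooth_localInverse {E F : Type*} [NormedAddCommGroup E] [NormedSpace ℝ E]
    [CompleteSpace E] [NormedAddCommGroup F] [NormedSpace ℝ F] {f : E → F} {O : Set E}
    (hO : IsOpen O) (hf : ContDiffOn ℝ ∞ f O) {x₀ : E} (hx : x₀ ∈ O) (f' : E ≃L[ℝ] F)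
    (hf' : HasFDerivAt f (f' : E →L[ℝ] F) x₀) :
    ∃ e : OpenPartialHomeomorph E F, (e : E → F) = f ∧ x₀ ∈ e.source ∧ e.source ⊆ O ∧
      ContDiffOn ℝ ∞ e.symm e.target := by
  have hfa : ContDiffAt ℝ ∞ f x₀ := hf.contDiffAt (hO.mem_nhds hx)
  have hs : HasStrictFDerivAt f (f' : E →L[ℝ] F) x₀ := hfa.hasStrictFDerivAt' hf' (by simp)
  set e₀ := hs.toOpenPartialHomeomorph f with he₀
  have hcont : ContinuousOn (fderiv ℝ f) O :=
    hf.continuousOn_fderiv_of_isOpen hO (by simp)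
  have hO' : IsOpen (O ∩ fderiv ℝ f ⁻¹' range
      (ContinuousLinearEquiv.toContinuousLinearMap : (E ≃L[ℝ] F) → E →L[ℝ] F)) :=
    hcont.isOpen_inter_preimage hO ContinuousLinearEquiv.isOpen
  set O' := O ∩ fderiv ℝ f ⁻¹' range
      (ContinuousLinearEquiv.toContinuousLinearMap : (E ≃L[ℝ] F) → E →L[ℝ] F)
  refine ⟨e₀.restrOpen O' hO', ?_, ?_, ?_, ?_⟩
  · exact hs.toOpenPartialHomeomorph_coe
  · rw [OpenPartialHomeomorph.restrOpen_source]
    exact ⟨hs.mem_toOpenPartialHomeomorph_source, hx, ⟨f', hf'.fderiv.symm⟩⟩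
  · rw [OpenPartialHomeomorph.restrOpen_source]
    exact fun y hy => hy.2.1
  · intro y hy
    have hy' := (e₀.restrOpen O' hO').map_target hy
    rw [OpenPartialHomeomorph.restrOpen_source] at hy'
    obtain ⟨-, hyO, ⟨g, hg⟩⟩ := hy'
    have hd : ContDiffAt ℝ ∞ f ((e₀.restrOpen O' hO').symm y) :=
      hf.contDiffAt (hO.mem_nhds hyO)
    have hcoe : ((e₀.restrOpen O' hO') : E → F) = f :=
      hs.toOpenPartialHomeomorph_coe
    refine (OpenPartialHomeomorph.contDiffAt_symm _ (f₀' := g) hy ?_ ?_).contDiffWithinAt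
    · rw [hcoe, hg]
      exact (hd.differentiableAt (by simp)).hasFDerivAt
    · rw [hcoe]; exact hd

/-- The implicit function theorem for maps that are `C^∞` on a neighbourhood. -/
theorem exists_smooth_implicitFunction {P G F : Type*} [NormedAddCommGroup P] [NormedSpace ℝ P]
    [CompleteSpace P] [NormedAddCommGroup G] [NormedSpace ℝ G] [CompleteSpace G]
    [NormedAddCommGroup F] [NormedSpace ℝ F] {f : P × G → F} {O : Set (P × G)}
    (hO : IsOpen O) (hf : ContDiffOn ℝ ∞ f O) {p₀ : P} {g₀ : G} (hx : (p₀, g₀) ∈ O)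
    (h0 : f (p₀, g₀) = 0) (L : P →L[ℝ] F) (A : G ≃L[ℝ] F)
    (hf' : HasFDerivAt f (L.coprod (A : G →L[ℝ] F)) (p₀, g₀)) :
    ∃ (ψ : P → G) (V : Set P), IsOpen V ∧ p₀ ∈ V ∧ ContDiffOn ℝ ∞ ψ V ∧ ψ p₀ = g₀ ∧
      ∀ p ∈ V, (p, ψ p) ∈ O ∧ f (p, ψ p) = 0 := by
  let D : (P × G) ≃L[ℝ] (P × F) :=
    ContinuousLinearEquiv.equivOfInverse
      ((ContinuousLinearMap.fst ℝ P G).prod (L.coprod (A : G →L[ℝ] F)))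
      ((ContinuousLinearMap.fst ℝ P F).prod
        ((A.symm : F →L[ℝ] G).comp (ContinuousLinearMap.snd ℝ P F -
          L.comp (ContinuousLinearMap.fst ℝ P F))))
      (fun x => by ext <;> simp) (fun x => by ext <;> simp)
  have hd : HasFDerivAt (fun x : P × G => (x.1, f x)) (D : P × G →L[ℝ] P × F) (p₀, g₀) :=
    hasFDerivAt_fst.prodMk hf'
  obtain ⟨e, he, hes, heO, hsm⟩ := exists_smooth_localInverse hO
    (contDiff_fst.contDiffOn.prodMk hf) hx D hd
  have hval : e (p₀, g₀) = (p₀, 0) := by rw [he]; simp [h0]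
  have hinc : ContDiff ℝ ∞ (fun p : P => (p, (0 : F))) := contDiff_id.prodMk contDiff_const
  refine ⟨fun p => (e.symm (p, 0)).2, (fun p : P => (p, (0 : F))) ⁻¹' e.target,
    e.open_target.preimage hinc.continuous, ?_, ?_, ?_, ?_⟩
  · rw [mem_preimage, ← hval]; exact e.map_source hes
  · exact contDiff_snd.comp_contDiffOn (hsm.comp hinc.contDiffOn (fun p hp => hp))
  · dsimp only
    rw [← hval, e.left_inv hes]
  · intro p hp
    have h1 := e.right_inv (show ((p, 0) : P × F) ∈ e.target from hp)
    rw [he] at h1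
    have h2 : (e.symm (p, 0)).1 = p := congrArg Prod.fst h1
    have h3 : f (e.symm (p, 0)) = 0 := congrArg Prod.snd h1
    have h4 : (p, (e.symm (p, 0)).2) = e.symm (p, 0) := Prod.ext h2.symm rfl
    rw [h4]
    exact ⟨heO (e.map_target hp), h3⟩

/-- Every smooth function agrees near a given point with a smooth function on the whole space. -/
lemma exists_contDiff_eqOn_nhds {E F : Type*} [NormedAddCommGroup E] [NormedSpace ℝ E]
    [FiniteDimensional ℝ E] [NormedAddCommGroup F] [NormedSpace ℝ F] {f : E → F} {O : Set E}
    (hO : IsOpen O) (hf : ContDiffOn ℝ ∞ f O) {x₀ : E} (hx : x₀ ∈ O) :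
    ∃ (g : E → F) (V : Set E), ContDiff ℝ ∞ g ∧ IsOpen V ∧ x₀ ∈ V ∧ V ⊆ O ∧ EqOn g f V := by
  obtain ⟨r, hr, hrO⟩ := Metric.isOpen_iff.1 hO x₀ hx
  let φ : ContDiffBump x₀ := ⟨r / 4, r / 2, by positivity, by linarith⟩
  refine ⟨fun x => φ x • f x, Metric.ball x₀ (r / 4), ?_, Metric.isOpen_ball,
    Metric.mem_ball_self (by positivity),
    (Metric.ball_subset_ball (by linarith)).trans hrO, ?_⟩
  · rw [contDiff_iff_contDiffAt]
    intro x
    by_cases h : x ∈ Metric.ball x₀ r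
    · exact φ.contDiff.contDiffAt.smul (hf.contDiffAt (hO.mem_nhds (hrO h)))
    · have hcl : x ∈ (Metric.closedBall x₀ (r / 2))ᶜ := fun hc =>
        h (Metric.closedBall_subset_ball (by linarith) hc)
      refine (contDiffAt_const (c := (0 : F))).congr_of_eventuallyEq ?_
      filter_upwards [Metric.isClosed_closedBall.isOpen_compl.mem_nhds hcl] with y hy
      have : φ y = 0 := φ.zero_of_le_dist (by
        simp only [mem_compl_iff, Metric.mem_closedBall, not_le] at hy
        exact hy.le)
      simp [this]
  · intro x hx
    have : φ x = 1 := φ.one_of_mem_closedBall (Metric.ball_subset_closedBall hx)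
    simp [this]

end Implicit

/-! ### The flow of a family of commuting vector fields -/

section Flow

variable {E : Type*} [NormedAddCommGroup E] [NormedSpace ℝ E] {B : Type*} [Fintype B]

/-- The combination `∑ s_b X_b` of the vector fields `X_b` with constant coefficients. -/
noncomputable def fieldSum (X : B → E → E) (s : B → ℝ) (x : E) : E := ∑ b, s b • X b x

/-- Smooth vector fields `X_b` have a local flow in the parameters `s`: for small `s` and `x` near
`x₀` the curve `ψ (s, x)` solves `γ' = ∑ s_b X_b(γ)`, `γ 0 = x`, on `[0, 1]`, and depends smoothly
on `(s, x)` as an element of the Banach space of curves. Since the equation is trivial at `s = 0`,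
the derivative of the integral equation in the direction of the curve is the identity there, and
the implicit function theorem applies. -/
theorem exists_flow [CompleteSpace E] {X : B → E → E} (hX : ∀ b, ContDiff ℝ ∞ (X b)) (x₀ : E) :
    ∃ (ψ : (B → ℝ) × E → C(unitInterval, E)) (V : Set ((B → ℝ) × E)), IsOpen V ∧
      ((0 : B → ℝ), x₀) ∈ V ∧ ContDiffOn ℝ ∞ ψ V ∧ ψ (0, x₀) = ContinuousMap.const _ x₀ ∧
      ∀ p ∈ V, ψ p = ContinuousMap.const _ p.2 + curveIntegral E
        (∑ b, p.1 b • (⟨X b, (hX b).continuous⟩ : C(E, E)).comp (ψ p)) := by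
  let T : B → C(unitInterval, E) → C(unitInterval, E) := fun b γ =>
    curveIntegral E ((⟨X b, (hX b).continuous⟩ : C(E, E)).comp γ)
  have hT : ∀ b, ContDiff ℝ ∞ (T b) := fun b =>
    (curveIntegral E).contDiff.comp (contDiff_superposition (hX b))
  let f : ((B → ℝ) × E) × C(unitInterval, E) → C(unitInterval, E) := fun q =>
    q.2 - ContinuousLinearMap.const ℝ unitInterval q.1.2 - ∑ b, q.1.1 b • T b q.2
  have hcoord : ∀ b, ContDiff ℝ ∞
      (fun q : ((B → ℝ) × E) × C(unitInterval, E) => q.1.1 b) := fun b =>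
    (contDiff_apply ℝ ℝ b).comp (contDiff_fst.comp contDiff_fst)
  have hf : ContDiff ℝ ∞ f := by
    refine (contDiff_snd.sub ?_).sub (ContDiff.sum fun b _ => (hcoord b).smul
      ((hT b).comp contDiff_snd))
    exact (ContinuousLinearMap.contDiff (E := E) (F := C(unitInterval, E))
      (ContinuousLinearMap.const ℝ unitInterval)).comp (contDiff_snd.comp contDiff_fst)
  -- The constant curve solves the equation for `s = 0`; the derivative of `f` there is `L` in the
  -- parameters and the identity in the curve, because the terms `T b` carry the factor `s_b = 0`.
  set γ₀ : C(unitInterval, E) := ContinuousMap.const _ x₀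
  let cb : B → ((B → ℝ) × E) →L[ℝ] ℝ := fun b =>
    (ContinuousLinearMap.proj b).comp (ContinuousLinearMap.fst ℝ (B → ℝ) E)
  let L : ((B → ℝ) × E) →L[ℝ] C(unitInterval, E) :=
    -((ContinuousLinearMap.const ℝ unitInterval).comp (ContinuousLinearMap.snd ℝ (B → ℝ) E)) -
      ∑ b, (cb b).smulRight (T b γ₀)
  have hterm : ∀ b, HasFDerivAt
      (fun q : ((B → ℝ) × E) × C(unitInterval, E) => q.1.1 b • T b q.2)
      (((cb b).comp (ContinuousLinearMap.fst ℝ _ _)).smulRight (T b γ₀)) ((0, x₀), γ₀) := by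
    intro b
    have h1 : HasFDerivAt (fun q : ((B → ℝ) × E) × C(unitInterval, E) => q.1.1 b)
        ((cb b).comp (ContinuousLinearMap.fst ℝ _ _)) ((0, x₀), γ₀) :=
      ((cb b).comp (ContinuousLinearMap.fst ℝ ((B → ℝ) × E) C(unitInterval, E))).hasFDerivAt
    have h2 : HasFDerivAt (fun q : ((B → ℝ) × E) × C(unitInterval, E) => T b q.2)
        ((fderiv ℝ (T b) γ₀).comp (ContinuousLinearMap.snd ℝ _ _)) ((0, x₀), γ₀) :=
      HasFDerivAt.comp (g := T b) (((0 : B → ℝ), x₀), γ₀)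
        (((hT b).differentiable (by simp)) γ₀).hasFDerivAt hasFDerivAt_snd
    refine (h1.smul h2).congr_fderiv (ContinuousLinearMap.ext fun q => ?_)
    simp
  have hd : HasFDerivAt f (L.coprod
      ((ContinuousLinearEquiv.refl ℝ C(unitInterval, E) :
        C(unitInterval, E) →L[ℝ] C(unitInterval, E)))) ((0, x₀), γ₀) := by
    have h1 : HasFDerivAt (fun q : ((B → ℝ) × E) × C(unitInterval, E) =>
        ContinuousLinearMap.const ℝ unitInterval q.1.2)
        ((ContinuousLinearMap.const ℝ unitInterval).comp
          ((ContinuousLinearMap.snd ℝ (B → ℝ) E).comp (ContinuousLinearMap.fst ℝ _ _)))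
        ((0, x₀), γ₀) :=
      ((ContinuousLinearMap.const ℝ unitInterval).comp
          ((ContinuousLinearMap.snd ℝ (B → ℝ) E).comp
            (ContinuousLinearMap.fst ℝ _ C(unitInterval, E)))).hasFDerivAt
    have h2 := (hasFDerivAt_snd.sub h1).sub (HasFDerivAt.fun_sum (u := Finset.univ)
      fun b _ => hterm b)
    refine h2.congr_fderiv (ContinuousLinearMap.ext fun q => ?_)
    simp only [L, sub_apply, ContinuousLinearMap.coprod_apply, neg_apply, sum_apply,
      ContinuousLinearMap.comp_apply, ContinuousLinearMap.smulRight_apply,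
      ContinuousLinearMap.coe_fst', ContinuousLinearMap.coe_snd',
      ContinuousLinearEquiv.coe_coe, ContinuousLinearEquiv.refl_apply]
    abel
  obtain ⟨ψ, V, hV, h0V, hψ, hψ0, hψV⟩ := exists_smooth_implicitFunction isOpen_univ
    hf.contDiffOn (mem_univ _) (by
      ext t
      simp [f, γ₀]) L _ hd
  refine ⟨ψ, V, hV, h0V, hψ, hψ0, fun p hp => ?_⟩
  have h := (hψV p hp).2
  rw [map_sum]
  simp only [map_smul]
  have h' : ψ p - ContinuousLinearMap.const ℝ unitInterval p.2 - ∑ b, p.1 b • T b (ψ p) = 0 := h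
  rw [sub_sub, sub_eq_zero] at h'
  exact h'

/-- The derivative of the flow along a combination `Y = ∑ r_b X_b` of commuting fields: both the
parameter direction `r` and the initial velocity `Y(x)` are transported to `Y` at the endpoint,
because `(α t + β) Y` solves the linearised equation along the flow line. -/
theorem fderiv_flow_commuting [CompleteSpace E] {X : B → E → E} (hX : ∀ b, ContDiff ℝ ∞ (X b))
    {ψ : (B → ℝ) × E → C(unitInterval, E)} {V : Set ((B → ℝ) × E)} (hV : IsOpen V)
    (hψ : ContDiffOn ℝ ∞ ψ V)
    (heq : ∀ p ∈ V, ψ p = ContinuousMap.const _ p.2 + curveIntegral E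
        (∑ b, p.1 b • (⟨X b, (hX b).continuous⟩ : C(E, E)).comp (ψ p)))
    {p : (B → ℝ) × E} (hp : p ∈ V)
    (hcomm : ∀ t a b, fderiv ℝ (X a) (ψ p t) (X b (ψ p t)) =
      fderiv ℝ (X b) (ψ p t) (X a (ψ p t)))
    (r : B → ℝ) (α β : ℝ) :
    fderiv ℝ ψ p (α • r, β • fieldSum X r p.2) 1 = (α + β) • fieldSum X r (ψ p 1) := by
  have hdX : ∀ b x, HasFDerivAt (X b) (fderiv ℝ (X b) x) x := fun b x =>
    ((hX b).differentiable (by simp) x).hasFDerivAt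
  have hcX : ∀ b, Continuous (fderiv ℝ (X b)) := fun b => (hX b).continuous_fderiv (by simp)
  have hψp : HasFDerivAt ψ (fderiv ℝ ψ p) p :=
    ((hψ.contDiffAt (hV.mem_nhds hp)).differentiableAt (by simp)).hasFDerivAt
  set γ := ψ p with hγ
  set u := fderiv ℝ ψ p (α • r, β • fieldSum X r p.2) with hu
  -- The linearised integral equation.
  have hlin : u = ContinuousMap.const _ (β • fieldSum X r p.2) + curveIntegral E
      (∑ b, ((α * r b) • (⟨X b, (hX b).continuous⟩ : C(E, E)).comp γ +
        p.1 b • curveApply unitInterval E E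
          ((⟨fderiv ℝ (X b), hcX b⟩ : C(E, E →L[ℝ] E)).comp γ) u)) := by
    have hterm : ∀ b, HasFDerivAt (fun q : (B → ℝ) × E =>
        q.1 b • (⟨X b, (hX b).continuous⟩ : C(E, E)).comp (ψ q))
        (p.1 b • (curveApply unitInterval E E
            ((⟨fderiv ℝ (X b), hcX b⟩ : C(E, E →L[ℝ] E)).comp γ)).comp (fderiv ℝ ψ p) +
          ((ContinuousLinearMap.proj b).comp (ContinuousLinearMap.fst ℝ (B → ℝ) E)).smulRight
            ((⟨X b, (hX b).continuous⟩ : C(E, E)).comp γ)) p := by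
      intro b
      have h1 : HasFDerivAt (fun q : (B → ℝ) × E => q.1 b)
          ((ContinuousLinearMap.proj b).comp (ContinuousLinearMap.fst ℝ (B → ℝ) E)) p :=
        ((ContinuousLinearMap.proj (R := ℝ) (φ := fun _ : B => ℝ) b).comp
          (ContinuousLinearMap.fst ℝ (B → ℝ) E)).hasFDerivAt
      have h2 := HasFDerivAt.comp p (hasFDerivAt_superposition (hdX b) (hX b).continuous (hcX b)
        (ψ p)) hψp
      exact h1.smul h2
    have h1 : HasFDerivAt (fun q : (B → ℝ) × E =>
        ContinuousLinearMap.const ℝ unitInterval q.2 + curveIntegral E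
          (∑ b, q.1 b • (⟨X b, (hX b).continuous⟩ : C(E, E)).comp (ψ q))) _ p :=
      (((ContinuousLinearMap.const ℝ unitInterval).comp
        (ContinuousLinearMap.snd ℝ (B → ℝ) E)).hasFDerivAt).add
      ((curveIntegral E).hasFDerivAt.comp p (HasFDerivAt.fun_sum (u := Finset.univ)
        fun b _ => hterm b))
    have h2 := hψp.unique (h1.congr_of_eventuallyEq (by
      filter_upwards [hV.mem_nhds hp] with q hq
      exact heq q hq))
    rw [hu]
    conv_lhs => rw [h2]
    simp only [add_apply, ContinuousLinearMap.comp_apply,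
      sum_apply, smul_apply,
      ContinuousLinearMap.smulRight_apply, ContinuousLinearMap.proj_apply,
      ContinuousLinearMap.coe_fst', ContinuousLinearMap.coe_snd', Pi.smul_apply, smul_eq_mul]
    congr 2
    exact Finset.sum_congr rfl fun b _ => add_comm _ _
  have hγ' : ∀ t ∈ Icc (0 : ℝ) 1, HasDerivWithinAt (extend γ)
      (fieldSum X p.1 (extend γ t)) (Icc 0 1) t := by
    intro t ht
    have := hasDerivWithinAt_extend (heq p hp) ht
    convert this using 1
    simp [fieldSum, extend, hγ, ContinuousMap.sum_apply]
  have hγ0 : extend γ 0 = p.2 := by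
    have := congrArg (fun δ : C(unitInterval, E) => δ 0) (heq p hp)
    simp only [ContinuousMap.add_apply, curveIntegral_zero, ContinuousMap.const_apply,
      add_zero] at this
    rw [← this, extend_of_mem _ (by simp : (0 : ℝ) ∈ Icc (0 : ℝ) 1)]
    rfl
  have hu' : ∀ t ∈ Icc (0 : ℝ) 1, HasDerivWithinAt (extend u)
      (α • fieldSum X r (extend γ t) +
        ∑ b, p.1 b • fderiv ℝ (X b) (extend γ t) (extend u t)) (Icc 0 1) t := by
    intro t ht
    have := hasDerivWithinAt_extend hlin ht
    convert this using 1
    simp only [extend, fieldSum, ContinuousMap.sum_apply, ContinuousMap.add_apply,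
      ContinuousMap.smul_apply, ContinuousMap.comp_apply, ContinuousMap.coe_mk,
      curveApply_apply, Finset.sum_add_distrib, Finset.smul_sum, smul_smul]
  have hu0 : extend u 0 = β • fieldSum X r p.2 := by
    have := congrArg (fun δ : C(unitInterval, E) => δ 0) hlin
    simp only [ContinuousMap.add_apply, curveIntegral_zero, ContinuousMap.const_apply,
      add_zero] at this
    rw [← this, extend_of_mem _ (by simp : (0 : ℝ) ∈ Icc (0 : ℝ) 1)]
    rfl
  -- The difference between `u` and `(α t + β) Y` solves a homogeneous linear equation.
  let A : ℝ → E →L[ℝ] E := fun t => ∑ b, p.1 b • fderiv ℝ (X b) (extend γ t)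
  have hA : Continuous A := continuous_finsetSum _ fun b _ =>
    ((hcX b).comp (continuous_extend γ)).const_smul (p.1 b)
  obtain ⟨K, hK⟩ := isCompact_Icc.exists_bound_of_continuousOn (f := A) (s := Icc (0 : ℝ) 1)
    hA.continuousOn
  let d : ℝ → E := fun t => extend u t - (α * t + β) • fieldSum X r (extend γ t)
  have hd : ∀ t ∈ Icc (0 : ℝ) 1, HasDerivWithinAt d (A t (d t)) (Icc 0 1) t := by
    intro t ht
    have hγ₁ : extend γ t = ψ p (projIcc 0 1 zero_le_one t) := rfl
    have h1 : HasDerivWithinAt (fun τ => fieldSum X r (extend γ τ))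
        (∑ b, r b • fderiv ℝ (X b) (extend γ t) (fieldSum X p.1 (extend γ t))) (Icc 0 1) t := by
      refine HasDerivWithinAt.fun_sum fun b _ => ?_
      exact ((hdX b (extend γ t)).comp_hasDerivWithinAt t (hγ' t ht)).const_smul (r b)
    have h2 : HasDerivWithinAt (fun τ : ℝ => α * τ + β) α (Icc 0 1) t := by
      simpa using (((hasDerivAt_id t).const_mul α).add_const β).hasDerivWithinAt
    refine ((hu' t ht).sub (h2.smul h1)).congr_deriv ?_
    have hc : ∑ b, r b • fderiv ℝ (X b) (extend γ t) (fieldSum X p.1 (extend γ t)) =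
        A t (fieldSum X r (extend γ t)) := by
      simp only [A, fieldSum, map_sum, map_smul, sum_apply,
        smul_apply, Finset.smul_sum]
      refine Finset.sum_congr rfl fun a _ => Finset.sum_congr rfl fun b _ => ?_
      rw [hγ₁, hcomm]
    rw [hc]
    have hAu : A t (extend u t) =
        ∑ b, p.1 b • fderiv ℝ (X b) (extend γ t) (extend u t) := by
      simp [A, sum_apply]
    simp only [d, map_sub, map_smul, hAu]
    abel
  have hzero := eq_zero_of_abs_deriv_le_mul_abs_self_of_eq_zero_right (f := d)
    (f' := fun t => A t (d t)) (K := K) (a := 0) (b := 1)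
    (fun t ht => (hd t ht).continuousWithinAt)
    (fun t ht => (hd t ⟨ht.1, ht.2.le⟩).mono_of_mem_nhdsWithin (Icc_mem_nhdsGE_of_mem ht))
    (by simp [d, hu0, hγ0])
    (fun t ht => ((A t).le_opNorm _).trans
      (mul_le_mul_of_nonneg_right (hK t ⟨ht.1, ht.2.le⟩) (norm_nonneg _)))
    1 (by simp)
  have h1 : ∀ δ : C(unitInterval, E), extend δ 1 = δ 1 := fun δ => by
    rw [extend_of_mem _ (by simp : (1 : ℝ) ∈ Icc (0 : ℝ) 1)]; rfl
  simp only [d, h1, mul_one, sub_eq_zero] at hzero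
  exact hzero

/-- The local flow of commuting vector fields defined on an open set. The fields are extended to the
whole space, and only flow lines that stay where the extensions agree with them are considered. -/
theorem exists_commuting_flow [FiniteDimensional ℝ E] {X : B → E → E} {O : Set E}
    (hO : IsOpen O) (hX : ∀ b, ContDiffOn ℝ ∞ (X b) O)
    (hcomm : ∀ x ∈ O, ∀ a b, fderiv ℝ (X a) x (X b x) = fderiv ℝ (X b) x (X a x))
    {x₀ : E} (hx₀ : x₀ ∈ O) :
    ∃ (ψ : (B → ℝ) × E → C(unitInterval, E)) (V : Set ((B → ℝ) × E)), IsOpen V ∧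
      ((0 : B → ℝ), x₀) ∈ V ∧ ContDiffOn ℝ ∞ ψ V ∧
      ∀ p ∈ V, (∀ t, ψ p t ∈ O) ∧ extend (ψ p) 0 = p.2 ∧
        (p.1 = 0 → ψ p = ContinuousMap.const _ p.2) ∧
        (∀ t ∈ Icc (0 : ℝ) 1, HasDerivWithinAt (extend (ψ p))
          (fieldSum X p.1 (extend (ψ p) t)) (Icc 0 1) t) ∧
        ∀ (r : B → ℝ) (α β : ℝ), fderiv ℝ ψ p (α • r, β • fieldSum X r p.2) 1 =
          (α + β) • fieldSum X r (ψ p 1) := by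
  have : CompleteSpace E := FiniteDimensional.complete ℝ E
  choose Y W hY hW hxW hWO hYX using fun b => exists_contDiff_eqOn_nhds hO (hX b) hx₀
  obtain ⟨ψ, V, hV, h0V, hψ, hψ0, heq⟩ := exists_flow hY x₀
  let O' : Set E := O ∩ ⋂ b, W b
  have hO' : IsOpen O' := hO.inter (isOpen_iInter_of_finite hW)
  have hxO' : x₀ ∈ O' := ⟨hx₀, mem_iInter.2 hxW⟩
  obtain ⟨ε, hε, hεO⟩ := Metric.isOpen_iff.1 hO' x₀ hxO'
  let V' : Set ((B → ℝ) × E) := V ∩ ψ ⁻¹' Metric.ball (ψ (0, x₀)) ε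
  have hV' : IsOpen V' := hψ.continuousOn.isOpen_inter_preimage hV Metric.isOpen_ball
  refine ⟨ψ, V', hV', ⟨h0V, Metric.mem_ball_self hε⟩, hψ.mono inter_subset_left,
    fun p hp => ?_⟩
  have hmem : ∀ t, ψ p t ∈ O' := by
    intro t
    refine hεO ?_
    have h1 : dist (ψ p t) (ψ (0, x₀) t) < ε :=
      ((ψ p).dist_apply_le_dist t).trans_lt hp.2
    rwa [hψ0] at h1
  have hYt : ∀ b, ∀ x ∈ O', Y b x = X b x := fun b x hx => hYX b (mem_iInter.1 hx.2 b)
  have hdY : ∀ b, ∀ x ∈ O', fderiv ℝ (Y b) x = fderiv ℝ (X b) x := fun b x hx =>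
    Filter.EventuallyEq.fderiv_eq (by
      filter_upwards [(hW b).mem_nhds (mem_iInter.1 hx.2 b)] with y hy
      exact hYX b hy)
  have hsum : ∀ r, ∀ x ∈ O', fieldSum Y r x = fieldSum X r x := fun r x hx =>
    Finset.sum_congr rfl fun b _ => by rw [hYt b x hx]
  have h0 : ψ p 0 = p.2 := by
    have := congrArg (fun δ : C(unitInterval, E) => δ 0) (heq p hp.1)
    simpa only [ContinuousMap.add_apply, curveIntegral_zero, ContinuousMap.const_apply,
      add_zero] using this
  have h00 : extend (ψ p) 0 = p.2 := by
    rw [extend_of_mem _ (by simp : (0 : ℝ) ∈ Icc (0 : ℝ) 1)]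
    exact h0
  refine ⟨fun t => (hmem t).1, h00, ?_, ?_, ?_⟩
  · intro hp0
    have := heq p hp.1
    rw [hp0] at this
    simpa using this
  · intro t ht
    have := hasDerivWithinAt_extend (heq p hp.1) ht
    convert this using 1
    rw [← hsum p.1 (extend (ψ p) t) (hmem _)]
    simp [fieldSum, extend, ContinuousMap.sum_apply]
  · intro r α β
    have h := fderiv_flow_commuting hY hV hψ heq hp.1 (fun t a b => by
      rw [hdY a _ (hmem t), hdY b _ (hmem t), hYt a _ (hmem t), hYt b _ (hmem t)]
      exact hcomm _ (hmem t).1 a b) r α β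
    rw [hsum _ _ (hmem 1)] at h
    rw [← h, ← hsum r p.2 (h0 ▸ hmem 0)]

end Flow

/-! ### Straightening commuting vector fields -/

section Straightening

variable {E : Type*} [NormedAddCommGroup E] [NormedSpace ℝ E] {B : Type*} [Fintype B]

/-- `γ` is an integral curve of `∑ s_b X_b` over `[0, 1]` that stays in `U`. -/
def IsFlowLine (X : B → E → E) (U : Set E) (s : B → ℝ) (γ : ℝ → E) : Prop :=
  ∀ t ∈ Icc (0 : ℝ) 1, γ t ∈ U ∧ HasDerivWithinAt γ (fieldSum X s (γ t)) (Icc 0 1) t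

lemma fieldSum_single [DecidableEq B] (X : B → E → E) (b : B) (x : E) :
    fieldSum X (Pi.single b 1) x = X b x := by
  simp [fieldSum, Pi.single_apply]

lemma fieldSum_add (X : B → E → E) (r s : B → ℝ) (x : E) :
    fieldSum X (r + s) x = fieldSum X r x + fieldSum X s x := by
  simp [fieldSum, add_smul, Finset.sum_add_distrib]

lemma fieldSum_neg (X : B → E → E) (r : B → ℝ) (x : E) :
    fieldSum X (-r) x = -fieldSum X r x := by
  simp [fieldSum]

/-- A function on `[0, 1]` with constant derivative is affine. -/
lemma eq_add_smul_of_hasDerivWithinAt {F : Type*} [NormedAddCommGroup F] [NormedSpace ℝ F]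
    {k : ℝ → F} {c : F} (h : ∀ t ∈ Icc (0 : ℝ) 1, HasDerivWithinAt k c (Icc 0 1) t)
    {t : ℝ} (ht : t ∈ Icc (0 : ℝ) 1) : k t = k 0 + t • c := by
  have h1 : ∀ t ∈ Icc (0 : ℝ) 1,
      HasDerivWithinAt (fun τ => k τ - τ • c) 0 (Icc 0 1) t := fun t ht => by
    refine ((h t ht).sub ((hasDerivWithinAt_id t (Icc (0 : ℝ) 1)).smul_const c)).congr_deriv ?_
    simp
  have h2 := constant_of_has_deriv_right_zero (a := 0) (b := 1)
    (fun t ht => (h1 t ht).continuousWithinAt)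
    (fun t ht => (h1 t ⟨ht.1, ht.2.le⟩).mono_of_mem_nhdsWithin (Icc_mem_nhdsGE_of_mem ht)) t ht
  rw [zero_smul, sub_zero, sub_eq_iff_eq_add] at h2
  exact h2

/-- If every field `X_b` has constant rate of change `c_b` on `f`, then `f` is affine along flow
lines. -/
lemma IsFlowLine.apply_eq {X : B → E → E} {U : Set E} {s : B → ℝ} {γ : ℝ → E}
    (hγ : IsFlowLine X U s γ) {F : Type*} [NormedAddCommGroup F] [NormedSpace ℝ F] {f : E → F}
    (hf : ∀ x ∈ U, DifferentiableAt ℝ f x) {c : B → F}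
    (hc : ∀ x ∈ U, ∀ b, fderiv ℝ f x (X b x) = c b) {t : ℝ} (ht : t ∈ Icc (0 : ℝ) 1) :
    f (γ t) = f (γ 0) + t • ∑ b, s b • c b := by
  refine eq_add_smul_of_hasDerivWithinAt (k := fun t => f (γ t)) (fun t ht => ?_) ht
  have := (hf _ (hγ t ht).1).hasFDerivAt.comp_hasDerivWithinAt t (hγ t ht).2
  refine this.congr_deriv ?_
  simp only [fieldSum, map_sum, map_smul, hc _ (hγ t ht).1]

lemma IsFlowLine.continuousOn {X : B → E → E} {U : Set E} {s : B → ℝ} {γ : ℝ → E}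
    (hγ : IsFlowLine X U s γ) : ContinuousOn γ (Icc 0 1) :=
  fun t ht => (hγ t ht).2.continuousWithinAt

omit [NormedSpace ℝ E] in
lemma eventually_curve_mem {T : Type*} [TopologicalSpace T] {Ψ : T → C(unitInterval, E)} {a : T}
    {x₀ : E} (hc : ContinuousAt Ψ a) (ha : Ψ a = ContinuousMap.const _ x₀) {U : Set E}
    (hU : U ∈ 𝓝 x₀) : ∀ᶠ p in 𝓝 a, ∀ t, Ψ p t ∈ U := by
  obtain ⟨ε, hε, hεU⟩ := Metric.mem_nhds_iff.1 hU
  filter_upwards [hc.preimage_mem_nhds (Metric.ball_mem_nhds _ hε)] with p hp t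
  refine hεU ?_
  have h1 : dist (Ψ p t) (Ψ a t) < ε := ((Ψ p).dist_apply_le_dist t).trans_lt hp
  rwa [ha] at h1

omit [NormedSpace ℝ E] in
lemma continuousOn_det [DecidableEq B] {M : E → Matrix B B ℝ} {s : Set E}
    (hM : ∀ a b, ContinuousOn (fun x => M x a b) s) : ContinuousOn (fun x => (M x).det) s :=
  (Continuous.matrix_det continuous_id).comp_continuousOn
    (continuousOn_pi.2 fun a => continuousOn_pi.2 fun b => hM a b)

/-- Let the matrix `(X_b f_a)(x₀)` of commuting fields `X_b` and functions `f_a` vanishing at `x₀`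
be invertible. Then the time `w` needed to come from `{f = 0}` along the flow is a smooth function
near `x₀`: its components satisfy `X_b w_a = δ_{ab}`, and `f = G w` with `G` smooth and invertible.
Here `G` is the mean of the matrix `X_b f_a` over the flow line that leads to `{f = 0}`. -/
theorem exists_straightening [FiniteDimensional ℝ E] [DecidableEq B] {X : B → E → E} {O : Set E}
    (hO : IsOpen O) (hX : ∀ b, ContDiffOn ℝ ∞ (X b) O)
    (hcomm : ∀ x ∈ O, ∀ a b, fderiv ℝ (X a) x (X b x) = fderiv ℝ (X b) x (X a x))
    {x₀ : E} (hx₀ : x₀ ∈ O) {f : B → E → ℝ} (hf : ∀ a, ContDiffOn ℝ ∞ (f a) O)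
    (hf0 : ∀ a, f a x₀ = 0)
    (hunit : IsUnit (Matrix.of fun a b => fderiv ℝ (f a) x₀ (X b x₀))) :
    ∃ (w : B → E → ℝ) (G : E → Matrix B B ℝ) (U : Set E), IsOpen U ∧ x₀ ∈ U ∧ U ⊆ O ∧
      (∀ a, ContDiffOn ℝ ∞ (w a) U) ∧ (∀ a b, ContDiffOn ℝ ∞ (fun x => G x a b) U) ∧
      (∀ x ∈ U, IsUnit (G x)) ∧ (∀ x ∈ U, ∀ a, f a x = ∑ b, G x a b * w b x) ∧
      (∀ x ∈ U, ∀ a b, fderiv ℝ (w a) x (X b x) = if a = b then 1 else 0) ∧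
      ∀ᶠ x in 𝓝 x₀, ∃ γ : ℝ → E, γ 0 = x ∧ (∀ a, f a (γ 1) = 0) ∧
        IsFlowLine X U (fun b => -w b x) γ := by
  have : CompleteSpace E := FiniteDimensional.complete ℝ E
  have hdf : ∀ a, ∀ x ∈ O, HasFDerivAt (f a) (fderiv ℝ (f a) x) x := fun a x hx =>
    (((hf a).contDiffAt (hO.mem_nhds hx)).differentiableAt (by simp)).hasFDerivAt
  -- The functions `X_b f_a`, extended to the whole space.
  have hh : ∀ a b, ContDiffOn ℝ ∞ (fun x => fderiv ℝ (f a) x (X b x)) O := fun a b =>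
    ((hf a).fderiv_of_isOpen hO (by simp)).clm_apply (hX b)
  choose H W hH hW hxW hWO hHW using fun a b => exists_contDiff_eqOn_nhds hO (hh a b) hx₀
  let O' : Set E := O ∩ ⋂ a, ⋂ b, W a b
  have hO' : IsOpen O' := hO.inter (isOpen_iInter_of_finite fun a => isOpen_iInter_of_finite (hW a))
  have hxO' : x₀ ∈ O' := ⟨hx₀, mem_iInter.2 fun a => mem_iInter.2 (hxW a)⟩
  have hHO : ∀ x ∈ O', ∀ a b, fderiv ℝ (f a) x (X b x) = H a b x := fun x hx a b =>
    (hHW a b (mem_iInter.1 (mem_iInter.1 hx.2 a) b)).symm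
  obtain ⟨ψ, V, hV, h0V, hψ, hflow⟩ := exists_commuting_flow hO'
    (fun b => (hX b).mono inter_subset_left) (fun x hx => hcomm x hx.1) hxO'
  let ev : C(unitInterval, E) →L[ℝ] E := ContinuousMap.evalCLM ℝ (1 : unitInterval)
  have hev : ∀ γ, ev γ = γ 1 := fun _ => rfl
  have hψd : ∀ p ∈ V, HasFDerivAt ψ (fderiv ℝ ψ p) p := fun p hp =>
    ((hψ.contDiffAt (hV.mem_nhds hp)).differentiableAt (by simp)).hasFDerivAt
  have hψ0 : ψ (0, x₀) = ContinuousMap.const _ x₀ := (hflow _ h0V).2.2.1 rfl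
  let fv : E → B → ℝ := fun x a => f a x
  have hfv : ContDiffOn ℝ ∞ fv O := contDiffOn_pi.2 hf
  have hdfv : ∀ x ∈ O, HasFDerivAt fv (ContinuousLinearMap.pi fun a => fderiv ℝ (f a) x) x :=
    fun x hx => hasFDerivAt_pi.2 fun a => hdf a x hx
  -- The time `S` after which the flow line from `x` meets `{f = 0}`.
  let sw : E × (B → ℝ) → (B → ℝ) × E := fun q => (q.2, q.1)
  have hsw : ContDiff ℝ ∞ sw := contDiff_snd.prodMk contDiff_fst
  let g : E × (B → ℝ) → B → ℝ := fun q => fv (ev (ψ (sw q)))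
  have hg : ContDiffOn ℝ ∞ g (sw ⁻¹' V) :=
    hfv.comp (ev.contDiff.comp_contDiffOn (hψ.comp hsw.contDiffOn fun q hq => hq))
      fun q hq => ((hflow _ hq).1 1).1
  let A : (B → ℝ) ≃L[ℝ] (B → ℝ) :=
    (Matrix.toLinearEquiv' (Matrix.of fun a b => fderiv ℝ (f a) x₀ (X b x₀))
      (Matrix.isUnit_iff_isUnit_det _ |>.1 hunit |> Matrix.invertibleOfIsUnitDet _)
      ).toContinuousLinearEquiv
  have hA : ∀ s, A s = (Matrix.of fun a b => fderiv ℝ (f a) x₀ (X b x₀)).mulVec s := fun s => rfl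
  let Dψ := fderiv ℝ ψ (0, x₀)
  let L : E →L[ℝ] (B → ℝ) := (ContinuousLinearMap.pi fun a => fderiv ℝ (f a) x₀).comp
    (ev.comp (Dψ.comp (ContinuousLinearMap.inr ℝ (B → ℝ) E)))
  have hgd : HasFDerivAt g (L.coprod (A : (B → ℝ) →L[ℝ] (B → ℝ))) (x₀, 0) := by
    have h1 : HasFDerivAt sw ((ContinuousLinearMap.snd ℝ E (B → ℝ)).prod
        (ContinuousLinearMap.fst ℝ E (B → ℝ))) (x₀, 0) := hasFDerivAt_snd.prodMk hasFDerivAt_fst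
    have h2 := HasFDerivAt.comp (g := ψ) (x₀, (0 : B → ℝ)) (hψd (0, x₀) h0V) h1
    have h3 := ev.hasFDerivAt.comp (x₀, (0 : B → ℝ)) h2
    have hpt : (ev ∘ ψ ∘ sw) (x₀, 0) = x₀ := by
      simp [hev, sw, hψ0]
    have h4 := HasFDerivAt.comp (g := fv) (x₀, (0 : B → ℝ)) (hpt.symm ▸ hdfv x₀ hx₀) h3
    refine h4.congr_fderiv (ContinuousLinearMap.ext fun q => ?_)
    obtain ⟨v, s⟩ := q
    have h5 := (hflow _ h0V).2.2.2.2 s 1 0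
    simp only [one_smul, zero_smul, add_zero, hψ0, ContinuousMap.const_apply] at h5
    have h6 : Dψ (s, v) = Dψ (s, 0) + Dψ (0, v) := by
      rw [← map_add]; simp
    simp only [ContinuousLinearMap.comp_apply, ContinuousLinearMap.prod_apply,
      ContinuousLinearMap.coe_fst', ContinuousLinearMap.coe_snd',
      ContinuousLinearMap.coprod_apply, L, ContinuousLinearMap.inr_apply,
      ContinuousLinearEquiv.coe_coe, hA]
    rw [show fderiv ℝ ψ (sw (x₀, 0)) = Dψ from rfl, h6, map_add, map_add, add_comm, hpt]
    congr 1
    rw [hev, show Dψ (s, 0) 1 = fieldSum X s x₀ from h5]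
    ext a
    simp [fieldSum, Matrix.mulVec, dotProduct, mul_comm]
  obtain ⟨S, V₁, hV₁, hxV₁, hS, hS0, hSV⟩ := exists_smooth_implicitFunction
    (hV.preimage hsw.continuous) hg (show (x₀, (0 : B → ℝ)) ∈ sw ⁻¹' V from h0V)
    (by ext a; simp [g, hev, sw, hψ0, fv, hf0]) L A hgd
  have hSV' : ∀ x ∈ V₁, (S x, x) ∈ V := fun x hx => (hSV x hx).1
  let ψS : E → C(unitInterval, E) := fun x => ψ (S x, x)
  have hψS : ContDiffOn ℝ ∞ ψS V₁ := hψ.comp (hS.prodMk contDiffOn_id) hSV'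
  have hψS0 : ψS x₀ = ContinuousMap.const _ x₀ := by simp only [ψS, hS0, hψ0]
  have hSd : ∀ x ∈ V₁, HasFDerivAt S (fderiv ℝ S x) x := fun x hx =>
    ((hS.contDiffAt (hV₁.mem_nhds hx)).differentiableAt (by simp)).hasFDerivAt
  let G : E → Matrix B B ℝ := fun x => Matrix.of fun a b =>
    curveIntegral ℝ ((⟨H a b, (hH a b).continuous⟩ : C(E, ℝ)).comp (ψS x)) 1
  have hG : ∀ a b, ContDiffOn ℝ ∞ (fun x => G x a b) V₁ := fun a b =>
    ((ContinuousLinearMap.contDiff (E := C(unitInterval, ℝ)) (F := ℝ)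
      (ContinuousMap.evalCLM ℝ (1 : unitInterval))).comp ((curveIntegral ℝ).contDiff.comp
        (contDiff_superposition (hH a b)))).comp_contDiffOn hψS
  let N : E → Matrix B B ℝ := fun x => Matrix.of fun a b => H a b (ψS x 1)
  have hN : ∀ a b, ContinuousOn (fun x => N x a b) V₁ := fun a b =>
    (hH a b).continuous.comp_continuousOn (ev.continuous.comp_continuousOn hψS.continuousOn)
  have hdetG : ContinuousOn (fun x => (G x).det) V₁ := 
    continuousOn_det fun a b => (hG a b).continuousOn
  have hdetN : ContinuousOn (fun x => (N x).det) V₁ := continuousOn_det hN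
  have hunit' : (Matrix.of fun a b => H a b x₀).det ≠ 0 := by
    have := (Matrix.isUnit_iff_isUnit_det _).1 hunit
    rw [isUnit_iff_ne_zero] at this
    have h1 : (Matrix.of fun a b => H a b x₀) =
        Matrix.of fun a b => fderiv ℝ (f a) x₀ (X b x₀) := by
      ext a b
      exact (hHO x₀ hxO' a b).symm
    rwa [h1]
  have hG0 : G x₀ = Matrix.of fun a b => H a b x₀ := by
    ext a b
    simp [G, hψS0, curveIntegral_apply]
  have hN0 : N x₀ = Matrix.of fun a b => H a b x₀ := by
    ext a b
    simp [N, hψS0]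
  let U₁ : Set E := V₁ ∩ (fun x => (G x).det) ⁻¹' {0}ᶜ
  have hU₁ : IsOpen U₁ := hdetG.isOpen_inter_preimage hV₁ isOpen_compl_singleton
  let U₂ : Set E := V₁ ∩ (fun x => (N x).det) ⁻¹' {0}ᶜ
  have hU₂ : IsOpen U₂ := hdetN.isOpen_inter_preimage hV₁ isOpen_compl_singleton
  have hline : ∀ x ∈ V₁, IsFlowLine X O' (S x) (extend (ψS x)) := fun x hx t ht =>
    ⟨(hflow _ (hSV' x hx)).1 _, (hflow _ (hSV' x hx)).2.2.2.1 t ht⟩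
  have hstart : ∀ x ∈ V₁, extend (ψS x) 0 = x := fun x hx => (hflow _ (hSV' x hx)).2.1
  have hext1 : ∀ δ : C(unitInterval, E), extend δ 1 = δ 1 := fun δ => by
    rw [extend_of_mem _ (by simp : (1 : ℝ) ∈ Icc (0 : ℝ) 1)]; rfl
  have hend : ∀ x ∈ V₁, ∀ a, f a (extend (ψS x) 1) = 0 := fun x hx a => by
    rw [hext1]; exact congrFun (hSV x hx).2 a
  have hxU : x₀ ∈ (U₁ ∩ U₂) ∩ O := by
    refine ⟨⟨⟨hxV₁, ?_⟩, ⟨hxV₁, ?_⟩⟩, hx₀⟩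
    · simpa only [mem_preimage, mem_compl_iff, mem_singleton_iff, hG0] using hunit'
    · simpa only [mem_preimage, mem_compl_iff, mem_singleton_iff, hN0] using hunit'
  have hUopen : IsOpen ((U₁ ∩ U₂) ∩ O) := (hU₁.inter hU₂).inter hO
  refine ⟨fun b x => -S x b, G, (U₁ ∩ U₂) ∩ O, hUopen, hxU, inter_subset_right, ?_, ?_, ?_, ?_,
    ?_, ?_⟩
  · intro a
    exact ((contDiff_apply ℝ ℝ a).comp_contDiffOn (hS.mono fun x hx => hx.1.1.1)).neg
  · intro a b
    exact (hG a b).mono fun x hx => hx.1.1.1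
  · intro x hx
    exact (Matrix.isUnit_iff_isUnit_det _).2 (isUnit_iff_ne_zero.2 hx.1.1.2)
  · -- `f = G w` is the fundamental theorem of calculus along the flow line.
    intro x hx a
    have hxV := hx.1.1.1
    have hl := hline x hxV
    have hcont : Continuous fun t => ∑ b, S x b * H a b (extend (ψS x) t) :=
      continuous_finsetSum _ fun b _ =>
        ((hH a b).continuous.comp (continuous_extend _)).const_mul _
    have hint := intervalIntegral.integral_eq_sub_of_hasDeriv_right
      (a := 0) (b := 1) (f := fun t => f a (extend (ψS x) t))
      (f' := fun t => ∑ b, S x b * H a b (extend (ψS x) t))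
      (by
        rw [uIcc_of_le zero_le_one]
        intro t ht
        exact ((hdf a _ (hl t ht).1.1).comp_hasDerivWithinAt t (hl t ht).2).continuousWithinAt)
      (by
        intro t ht
        rw [min_eq_left zero_le_one, max_eq_right zero_le_one] at ht
        have h1 := (hdf a _ (hl t (Ioo_subset_Icc_self ht)).1.1).comp_hasDerivWithinAt t
          (hl t (Ioo_subset_Icc_self ht)).2
        refine (h1.mono_of_mem_nhdsWithin
          (mem_nhdsWithin_of_mem_nhds (Icc_mem_nhds ht.1 ht.2))).congr_deriv ?_
        simp only [fieldSum, map_sum, map_smul, smul_eq_mul]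
        exact Finset.sum_congr rfl fun b _ => by rw [hHO _ (hl t (Ioo_subset_Icc_self ht)).1])
      (hcont.intervalIntegrable _ _)
    have hterm : ∀ b, Continuous fun t => S x b * H a b (extend (ψS x) t) := fun b =>
      ((hH a b).continuous.comp (continuous_extend _)).const_mul _
    rw [hend x hxV, hstart x hxV, intervalIntegral.integral_finsetSum
      (fun b _ => (hterm b).intervalIntegrable _ _)] at hint
    have h2 : ∀ b, G x a b = ∫ t in (0 : ℝ)..1, H a b (extend (ψS x) t) := fun b => by
      simp only [G, Matrix.of_apply, curveIntegral_apply]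
      rfl
    simp only [intervalIntegral.integral_const_mul] at hint
    simp only [h2, mul_neg, Finset.sum_neg_distrib]
    rw [show f a x = -(0 - f a x) by ring, ← hint]
    congr 1
    exact Finset.sum_congr rfl fun b _ => mul_comm _ _
  · intro x hx a b
    have hxV := hx.1.1.1
    have hp := hSV' x hxV
    set v := X b x with hv
    -- Differentiating `f (ψ (S x, x) 1) = 0` along `X_b`.
    have h1 : HasFDerivAt ψS ((fderiv ℝ ψ (S x, x)).comp
        ((fderiv ℝ S x).prod (ContinuousLinearMap.id ℝ E))) x :=
      HasFDerivAt.comp (g := ψ) x (hψd _ hp) ((hSd x hxV).prodMk (hasFDerivAt_id x))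
    have h2 := HasFDerivAt.comp (g := fv) x (hdfv (ev (ψS x)) ((hflow _ hp).1 1).1)
      (ev.hasFDerivAt.comp x h1)
    have h3 : HasFDerivAt (fv ∘ ev ∘ ψS) (0 : E →L[ℝ] B → ℝ) x :=
      (hasFDerivAt_const (0 : B → ℝ) x).congr_of_eventuallyEq (by
        filter_upwards [hV₁.mem_nhds hxV] with y hy
        exact (hSV y hy).2)
    have h4 := congrArg (fun T : E →L[ℝ] B → ℝ => T v) (h2.unique h3)
    have hfl := (hflow _ hp).2.2.2.2
    have h5 : fderiv ℝ ψ (S x, x) (fderiv ℝ S x v, v) 1 =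
        fieldSum X (fderiv ℝ S x v + Pi.single b 1) (ψS x 1) := by
      have e1 := hfl (fderiv ℝ S x v) 1 0
      have e2 := hfl (Pi.single b 1) 0 1
      simp only [one_smul, zero_smul, add_zero, zero_add, fieldSum_single] at e1 e2
      have e3 : ((fderiv ℝ S x v, v) : (B → ℝ) × E) = (fderiv ℝ S x v, 0) + (0, v) := by simp
      rw [e3, map_add, ContinuousMap.add_apply, e1, fieldSum_add, fieldSum_single, ← e2]
    have h6 : (N x).mulVec (fderiv ℝ S x v + Pi.single b 1) = 0 := by
      refine Eq.trans ?_ h4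
      ext a
      simp only [ContinuousLinearMap.comp_apply, ContinuousLinearMap.prod_apply,
        ContinuousLinearMap.id_apply, ContinuousLinearMap.pi_apply, hev]
      rw [h5]
      simp only [fieldSum, map_sum, map_smul, smul_eq_mul, N, Matrix.mulVec, dotProduct,
        Matrix.of_apply]
      refine Finset.sum_congr rfl fun c _ => ?_
      rw [← hHO _ ((hflow _ hp).1 1), mul_comm]
    have h7 : fderiv ℝ S x v + Pi.single b 1 = 0 :=
      Matrix.eq_zero_of_mulVec_eq_zero hx.1.2.2 h6
    have h8 : HasFDerivAt (fun y => -S y a)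
        (-((ContinuousLinearMap.proj a).comp (fderiv ℝ S x))) x :=
      (hasFDerivAt_pi'.1 (hSd x hxV) a).neg
    rw [h8.fderiv]
    have h9 := congrFun h7 a
    simp only [Pi.add_apply, Pi.single_apply, Pi.zero_apply] at h9
    simp only [neg_apply, ContinuousLinearMap.comp_apply, ContinuousLinearMap.proj_apply]
    linarith
  · have hc : ContinuousAt ψS x₀ := hψS.continuousOn.continuousAt (hV₁.mem_nhds hxV₁)
    filter_upwards [eventually_curve_mem hc hψS0 (hUopen.mem_nhds hxU), hV₁.mem_nhds hxV₁]
      with x hx hxV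
    refine ⟨extend (ψS x), hstart x hxV, hend x hxV, fun t ht => ⟨hx _, ?_⟩⟩
    simpa only [neg_neg] using (hline x hxV t ht).2

end Straightening

section FlowBox

variable {E : Type*} [NormedAddCommGroup E] [NormedSpace ℝ E] {B : Type*} [Fintype B]

/-- Let commuting fields `X_b` and functions `f_a` satisfy `X_b f_a = δ_{ab}`. The point `x₀` of
`{f = 0}` has arbitrarily small neighbourhoods `U` that are a product of `{f = 0} ∩ U` with a cube
in the values of `f`: the projection `z x` moves `x` along the flow for the time `-f x`, it is
constant along the fields, it separates points together with `f`, and any set of the functions `f_a`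
can be moved to `0` along the flow inside `U`. -/
theorem exists_flowBox [FiniteDimensional ℝ E] [DecidableEq B] {X : B → E → E} {O : Set E}
    (hO : IsOpen O) (hX : ∀ b, ContDiffOn ℝ ∞ (X b) O)
    (hcomm : ∀ x ∈ O, ∀ a b, fderiv ℝ (X a) x (X b x) = fderiv ℝ (X b) x (X a x))
    {x₀ : E} (hx₀ : x₀ ∈ O) {f : B → E → ℝ} (hf : ∀ a, ContDiffOn ℝ ∞ (f a) O)
    (hf0 : ∀ a, f a x₀ = 0)
    (hdual : ∀ x ∈ O, ∀ a b, fderiv ℝ (f a) x (X b x) = if a = b then 1 else 0) :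
    ∃ (z : E → E) (U : Set E), IsOpen U ∧ x₀ ∈ U ∧ U ⊆ O ∧ ContDiffOn ℝ ∞ z U ∧
      (∀ x ∈ U, z x ∈ U) ∧ (∀ x ∈ U, ∀ a, f a (z x) = 0) ∧
      (∀ x ∈ U, (∀ a, f a x = 0) → z x = x) ∧
      (∀ x ∈ U, (∀ a, f a x = 0) →
        ∀ v, fderiv ℝ z x v = v - ∑ b, fderiv ℝ (f b) x v • X b x) ∧
      (∀ x ∈ U, ∀ b, fderiv ℝ z x (X b x) = 0) ∧
      (∀ x ∈ U, ∀ y ∈ U, (∀ a, f a x = f a y) → z x = z y → x = y) ∧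
      ∀ x ∈ U, ∀ s : B → ℝ, (∀ a, s a = 0 ∨ s a = -f a x) →
        ∃ γ : ℝ → E, γ 0 = x ∧ IsFlowLine X U s γ := by
  have : CompleteSpace E := FiniteDimensional.complete ℝ E
  obtain ⟨ψ, V, hV, h0V, hψ, hflow⟩ := exists_commuting_flow hO hX hcomm hx₀
  let ev : C(unitInterval, E) →L[ℝ] E := ContinuousMap.evalCLM ℝ (1 : unitInterval)
  have hev : ∀ γ, ev γ = γ 1 := fun _ => rfl
  have hψd : ∀ p ∈ V, HasFDerivAt ψ (fderiv ℝ ψ p) p := fun p hp =>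
    ((hψ.contDiffAt (hV.mem_nhds hp)).differentiableAt (by simp)).hasFDerivAt
  have hψ0 : ψ (0, x₀) = ContinuousMap.const _ x₀ := (hflow _ h0V).2.2.1 rfl
  have hdf : ∀ a, ∀ x ∈ O, HasFDerivAt (f a) (fderiv ℝ (f a) x) x := fun a x hx =>
    (((hf a).contDiffAt (hO.mem_nhds hx)).differentiableAt (by simp)).hasFDerivAt
  let fv : E → B → ℝ := fun x a => f a x
  have hfv : ContDiffOn ℝ ∞ fv O := contDiffOn_pi.2 hf
  have hdfv : ∀ x ∈ O, HasFDerivAt fv (ContinuousLinearMap.pi fun a => fderiv ℝ (f a) x) x :=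
    fun x hx => hasFDerivAt_pi.2 fun a => hdf a x hx
  have hfv0 : fv x₀ = 0 := funext hf0
  have hext1 : ∀ δ : C(unitInterval, E), extend δ 1 = δ 1 := fun δ => by
    rw [extend_of_mem _ (by simp : (1 : ℝ) ∈ Icc (0 : ℝ) 1)]; rfl
  have hshift : ∀ {s : B → ℝ} {γ : ℝ → E}, IsFlowLine X O s γ → ∀ t ∈ Icc (0 : ℝ) 1,
      fv (γ t) = fv (γ 0) + t • s := by
    intro s γ hγ t ht
    ext a
    have := hγ.apply_eq (f := f a) (fun x hx => (hdf a x hx).differentiableAt)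
      (fun x hx b => hdual x hx a b) ht
    simpa [fv] using this
  -- The projection along the flow, on the open set `V₁` where it is defined.
  let V₁ : Set E := O ∩ (fun x => (-fv x, x)) ⁻¹' V
  have hV₁ : IsOpen V₁ :=
    (hfv.continuousOn.neg.prodMk continuousOn_id).isOpen_inter_preimage hO hV
  have hxV₁ : x₀ ∈ V₁ := ⟨hx₀, by
    change (-fv x₀, x₀) ∈ V
    rw [hfv0, neg_zero]; exact h0V⟩
  let z : E → E := fun x => ψ (-fv x, x) 1
  have hz : ContDiffOn ℝ ∞ z V₁ := ev.contDiff.comp_contDiffOn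
    (hψ.comp ((hfv.mono inter_subset_left).neg.prodMk contDiffOn_id) fun x hx => hx.2)
  have hline : ∀ p ∈ V, IsFlowLine X O p.1 (extend (ψ p)) := fun p hp t ht =>
    ⟨(hflow p hp).1 _, (hflow p hp).2.2.2.1 t ht⟩
  have hstart : ∀ p ∈ V, extend (ψ p) 0 = p.2 := fun p hp => (hflow p hp).2.1
  have hfz : ∀ x ∈ V₁, fv (z x) = 0 := by
    intro x hx
    have := hshift (hline _ hx.2) 1 (by simp)
    rw [hext1, hstart _ hx.2] at this
    simpa using this
  have hzid : ∀ x ∈ V₁, fv x = 0 → z x = x := by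
    intro x hx h0
    have h1 := (hflow _ hx.2).2.2.1 (by simp [h0])
    exact congrArg (fun γ : C(unitInterval, E) => γ 1) h1
  have hdz : ∀ x ∈ V₁, HasFDerivAt z (ev.comp ((fderiv ℝ ψ (-fv x, x)).comp
      ((-(ContinuousLinearMap.pi fun a => fderiv ℝ (f a) x)).prod
        (ContinuousLinearMap.id ℝ E)))) x := fun x hx =>
    ev.hasFDerivAt.comp x (HasFDerivAt.comp (g := ψ) x (hψd _ hx.2)
      ((hdfv x hx.1).neg.prodMk (hasFDerivAt_id x)))
  have hzX : ∀ x ∈ V₁, ∀ b, fderiv ℝ z x (X b x) = 0 := by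
    intro x hx b
    rw [(hdz x hx).fderiv]
    have h1 : (-(ContinuousLinearMap.pi fun a => fderiv ℝ (f a) x)) (X b x) =
        (-1 : ℝ) • Pi.single b (1 : ℝ) := by
      ext a
      simp [hdual x hx.1, Pi.single_apply, apply_ite]
    have h2 := (hflow _ hx.2).2.2.2.2 (Pi.single b 1) (-1) 1
    rw [fieldSum_single, one_smul] at h2
    simp only [ContinuousLinearMap.comp_apply, ContinuousLinearMap.prod_apply, h1, hev,
      ContinuousLinearMap.id_apply, h2]
    simp
  have hdz0 : ∀ x ∈ V₁, fv x = 0 →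
      ∀ v, fderiv ℝ z x v = v - ∑ b, fderiv ℝ (f b) x v • X b x := by
    intro x hx h0 v
    have hp : ((0 : B → ℝ), x) ∈ V := by simpa [h0] using hx.2
    rw [(hdz x hx).fderiv, h0, neg_zero]
    simp only [ContinuousLinearMap.comp_apply, ContinuousLinearMap.prod_apply, hev,
      ContinuousLinearMap.id_apply]
    set r : B → ℝ := (-(ContinuousLinearMap.pi fun a => fderiv ℝ (f a) x)) v with hr
    have h1 : ((r, v) : (B → ℝ) × E) = (r, 0) + (0, v) := by simp
    have h2 := (hflow _ hp).2.2.2.2 r 1 0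
    simp only [one_smul, zero_smul, add_zero, (hflow _ hp).2.2.1 rfl,
      ContinuousMap.const_apply] at h2
    -- `ψ (0, y)` is the constant curve at `y`.
    have h3 : fderiv ℝ ψ (0, x) (0, v) = ContinuousMap.const _ v := by
      have e1 : HasFDerivAt (fun y : E => ψ (0, y)) ((fderiv ℝ ψ (0, x)).comp
          (ContinuousLinearMap.inr ℝ (B → ℝ) E)) x :=
        HasFDerivAt.comp (g := ψ) x (hψd _ hp) (hasFDerivAt_prodMk_right 0 x)
      have e2 : HasFDerivAt (fun y : E => ψ (0, y)) (ContinuousLinearMap.const ℝ unitInterval) x :=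
        HasFDerivAt.congr_of_eventuallyEq
          (ContinuousLinearMap.hasFDerivAt (E := E) (F := C(unitInterval, E))
            (ContinuousLinearMap.const ℝ unitInterval)) (by
          have hcont : Continuous fun y : E => ((0 : B → ℝ), y) := by fun_prop
          filter_upwards [hcont.continuousAt.preimage_mem_nhds (hV.mem_nhds hp)] with y hy
          exact (hflow _ hy).2.2.1 rfl)
      have := congrArg (fun T : E →L[ℝ] C(unitInterval, E) => T v) (e1.unique e2)
      exact this
    rw [h1, map_add, ContinuousMap.add_apply, h2, h3, ContinuousMap.const_apply, add_comm,
      sub_eq_add_neg, ← Finset.sum_neg_distrib]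
    congr 1
    exact Finset.sum_congr rfl fun b _ => by simp [hr]
  -- `z` and `f` together separate points near `x₀`.
  obtain ⟨e, he, hxe, heV, -⟩ : ∃ e : OpenPartialHomeomorph E E,
      (e : E → E) = (fun x => z x + fieldSum (fun b _ => X b x₀) (fv x) x₀) ∧ x₀ ∈ e.source ∧
        e.source ⊆ V₁ ∧ ContDiffOn ℝ ∞ e.symm e.target := by
    refine exists_smooth_localInverse hV₁ ?_ hxV₁ (ContinuousLinearEquiv.refl ℝ E) ?_
    · refine hz.add (ContDiffOn.sum fun b _ => ContDiffOn.smul ?_ contDiffOn_const)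
      exact (hf b).mono inter_subset_left
    · have h1 : HasFDerivAt z (fderiv ℝ z x₀) x₀ := (hdz x₀ hxV₁).differentiableAt.hasFDerivAt
      have h2 := h1.add (HasFDerivAt.fun_sum (u := Finset.univ) fun b _ =>
        (hdf b x₀ hx₀).smul_const (X b x₀))
      refine h2.congr_fderiv (ContinuousLinearMap.ext fun v => ?_)
      simp [hdz0 x₀ hxV₁ hfv0 v]
  have hinj : ∀ x ∈ e.source, ∀ y ∈ e.source, fv x = fv y → z x = z y → x = y := by
    intro x hx y hy h1 h2
    refine e.injOn hx hy ?_
    simp only [he, h1, h2]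
  have hzconst : ∀ {s : B → ℝ} {γ : ℝ → E}, IsFlowLine X V₁ s γ → ∀ t ∈ Icc (0 : ℝ) 1,
      z (γ t) = z (γ 0) := by
    intro s γ hγ t ht
    have := hγ.apply_eq (f := z) (fun x hx => (hdz x hx).differentiableAt)
      (c := fun _ => 0) (fun x hx b => hzX x hx b) ht
    simpa using this
  have hψc : ContinuousAt ψ (0, x₀) := (hψd _ h0V).continuousAt
  have hnear : ∀ T : Set E, IsOpen T → x₀ ∈ T → ∃ δ > 0, ∃ Q : Set E, IsOpen Q ∧ x₀ ∈ Q ∧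
      ∀ s : B → ℝ, ‖s‖ < δ → ∀ x ∈ Q, (s, x) ∈ V ∧ ∀ t, ψ (s, x) t ∈ T := by
    intro T hT hxT
    have h := Filter.Eventually.and (hV.mem_nhds h0V)
      (eventually_curve_mem hψc hψ0 (hT.mem_nhds hxT))
    rw [nhds_prod_eq] at h
    obtain ⟨p, hp, q, hq, h⟩ := Filter.eventually_prod_iff.1 h
    obtain ⟨δ, hδ, h1⟩ := Metric.eventually_nhds_iff.1 hp
    obtain ⟨Q, hQ, hQo, hxQ⟩ := eventually_nhds_iff.1 hq
    exact ⟨δ, hδ, Q, hQo, hxQ, fun s hs x hx => h (h1 (by simpa using hs)) (hQ x hx)⟩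
  -- Flow lines that start in `Q`, for times less than `δ`, stay in the source of `e`.
  obtain ⟨δ, hδ, Q, hQ, hxQ, hδQ⟩ := hnear e.source e.open_source hxe
  let Q' : Set E := Q ∩ e.source
  have hQ' : IsOpen Q' := hQ.inter e.open_source
  obtain ⟨ρ, hρ, R, hR, hxR, hρR⟩ := hnear Q' hQ' ⟨hxQ, hxe⟩
  have hRQ : R ⊆ Q' := by
    intro x hx
    have h1 := hρR 0 (by simpa using hρ) x hx
    have h2 := h1.2 0
    rwa [(hflow _ h1.1).2.2.1 rfl] at h2
  have hQV : Q' ⊆ V₁ := fun x hx => heV hx.2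
  let U : Set E := Q' ∩ (fun x => (fv x, z x)) ⁻¹' (Metric.ball 0 (min ρ δ) ×ˢ R)
  have hU : IsOpen U :=
    (((hfv.continuousOn.mono inter_subset_left).prodMk hz.continuousOn).mono
      hQV).isOpen_inter_preimage hQ' (Metric.isOpen_ball.prod hR)
  have hUmem : ∀ x, x ∈ U ↔ x ∈ Q' ∧ ‖fv x‖ < min ρ δ ∧ z x ∈ R := fun x => by
    simp [U]
  have hUV : U ⊆ V₁ := fun x hx => hQV hx.1
  have hzU : ∀ x ∈ U, z x ∈ U := by
    intro x hx
    have hx' := (hUmem x).1 hx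
    have h1 : z x ∈ Q' := hRQ hx'.2.2
    rw [hUmem, hfz x (hUV hx), hzid _ (hQV h1) (hfz x (hUV hx))]
    exact ⟨h1, by simpa using ⟨hρ, hδ⟩, hx'.2.2⟩
  refine ⟨z, U, hU, ?_, fun x hx => (hUV hx).1, hz.mono hUV, hzU,
    fun x hx a => congrFun (hfz x (hUV hx)) a, fun x hx h => hzid x (hUV hx) (funext h),
    fun x hx h => hdz0 x (hUV hx) (funext h), fun x hx => hzX x (hUV hx),
    fun x hx y hy h1 h2 => hinj x hx.1.2 y hy.1.2 (funext h1) h2, ?_⟩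
  · rw [hUmem, hfv0, hzid x₀ hxV₁ hfv0]
    exact ⟨⟨hxQ, hxe⟩, by simpa using ⟨hρ, hδ⟩, hxR⟩
  · intro x hx s hs
    have hx' := (hUmem x).1 hx
    have hnorm : ∀ t ∈ Icc (0 : ℝ) 1, ‖fv x + t • s‖ ≤ ‖fv x‖ := by
      intro t ht
      refine (pi_norm_le_iff_of_nonneg (norm_nonneg _)).2 fun a => ?_
      have h1 : ‖f a x‖ ≤ ‖fv x‖ := norm_le_pi_norm (fv x) a
      rcases hs a with h | h
      · simpa [h, fv] using h1
      · have h2 : (fv x + t • s) a = (1 - t) * f a x := by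
          simp only [Pi.add_apply, Pi.smul_apply, smul_eq_mul, h, fv]
          ring
        rw [h2, norm_mul]
        refine le_trans ?_ h1
        refine mul_le_of_le_one_left (norm_nonneg _) ?_
        rw [Real.norm_eq_abs, abs_le]
        constructor <;> linarith [ht.1, ht.2]
    have hsδ : ‖s‖ < δ := by
      refine lt_of_le_of_lt ?_ (hx'.2.1.trans_le (min_le_right _ _))
      refine (pi_norm_le_iff_of_nonneg (norm_nonneg _)).2 fun a => ?_
      have h1 : ‖f a x‖ ≤ ‖fv x‖ := norm_le_pi_norm (fv x) a
      rcases hs a with h | h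
      · simp [h]
      · rw [h, norm_neg]; exact h1
    obtain ⟨hpV, hpe⟩ := hδQ s hsδ x hx'.1.1
    have hl : IsFlowLine X V₁ s (extend (ψ (s, x))) := fun t ht =>
      ⟨heV (hpe _), (hline _ hpV t ht).2⟩
    refine ⟨extend (ψ (s, x)), hstart _ hpV, fun t ht => ⟨?_, (hl t ht).2⟩⟩
    -- The point on the flow line has the same `f` and `z` as a point reached from `z x ∈ R`.
    set y := extend (ψ (s, x)) t with hy
    have hye : y ∈ e.source := hpe _
    have hfy : fv y = fv x + t • s := by
      have := hshift (hline _ hpV) t ht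
      rwa [hstart _ hpV] at this
    have hzy : z y = z x := by
      have := hzconst hl t ht
      rwa [hstart _ hpV] at this
    have hny : ‖fv y‖ < min ρ δ := by
      rw [hfy]; exact (hnorm t ht).trans_lt hx'.2.1
    obtain ⟨hqV, hqQ⟩ := hρR (fv y) (hny.trans_le (min_le_left _ _)) (z x) hx'.2.2
    have hlq : IsFlowLine X V₁ (fv y) (extend (ψ (fv y, z x))) := fun t ht =>
      ⟨hQV (hqQ _), (hline _ hqV t ht).2⟩
    have h1 : fv (ψ (fv y, z x) 1) = fv y := by
      have := hshift (hline _ hqV) 1 (by simp)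
      rw [hstart _ hqV, hext1] at this
      simpa [hfz x (hUV hx)] using this
    have h2 : z (ψ (fv y, z x) 1) = z x := by
      have := hzconst hlq 1 (by simp)
      rw [hstart _ hqV, hext1] at this
      exact this.trans (hzid _ (hUV (hzU x hx)) (hfz x (hUV hx)))
    have h3 : y = ψ (fv y, z x) 1 :=
      hinj y hye _ (hqQ 1).2 h1.symm (hzy.trans h2.symm)
    rw [hUmem]
    refine ⟨?_, hny, hzy ▸ hx'.2.2⟩
    rw [h3]
    exact hqQ 1

end FlowBox

/-! ### Poisson brackets in terms of differentials -/

section Poisson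

variable {ι : Type*} [Fintype ι] [DecidableEq ι]

/-- The vector that corresponds to a covector by the symplectic form; `sharp (df)` is the
Hamiltonian vector field of `f`. -/
noncomputable def sharp : (Phase ι →L[ℝ] ℝ) →L[ℝ] Phase ι :=
  (ContinuousLinearMap.pi fun i =>
    -(ContinuousLinearMap.apply ℝ ℝ ((0, Pi.single i 1) : Phase ι))).prod
  (ContinuousLinearMap.pi fun i => ContinuousLinearMap.apply ℝ ℝ ((Pi.single i 1, 0) : Phase ι))

lemma sharp_fst (α : Phase ι →L[ℝ] ℝ) (i : ι) : (sharp α).1 i = -α (0, Pi.single i 1) := rfl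

lemma sharp_snd (α : Phase ι →L[ℝ] ℝ) (i : ι) : (sharp α).2 i = α (Pi.single i 1, 0) := rfl

lemma hamVec_eq_sharp (f : Phase ι → ℝ) (x : Phase ι) : hamVec f x = sharp (fderiv ℝ f x) := rfl

lemma covector_apply (α : Phase ι →L[ℝ] ℝ) (v : Phase ι) :
    α v = ∑ i, (v.1 i * α (Pi.single i 1, 0) + v.2 i * α (0, Pi.single i 1)) := by
  have h1 : v = ∑ i, (v.1 i • ((Pi.single i 1, 0) : Phase ι) +
      v.2 i • ((0, Pi.single i 1) : Phase ι)) := by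
    ext j <;> simp [Prod.fst_sum, Prod.snd_sum, Finset.sum_apply, Pi.single_apply]
  conv_lhs => rw [h1]
  simp only [map_sum, map_add, map_smul, smul_eq_mul]

lemma apply_sharp (α β : Phase ι →L[ℝ] ℝ) :
    α (sharp β) = ∑ i, (β (Pi.single i 1, 0) * α (0, Pi.single i 1) -
      β (0, Pi.single i 1) * α (Pi.single i 1, 0)) := by
  rw [covector_apply]
  refine Finset.sum_congr rfl fun i _ => ?_
  rw [sharp_fst, sharp_snd]
  ring

lemma apply_sharp_comm (α β : Phase ι →L[ℝ] ℝ) : α (sharp β) = -β (sharp α) := by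
  rw [apply_sharp, apply_sharp, ← Finset.sum_neg_distrib]
  exact Finset.sum_congr rfl fun i _ => by ring

lemma poisson_eq_sharp (f g : Phase ι → ℝ) (x : Phase ι) :
    poisson f g x = fderiv ℝ g x (sharp (fderiv ℝ f x)) := by
  rw [apply_sharp]
  rfl

lemma fderiv_hamVec (f g : Phase ι → ℝ) (x : Phase ι) :
    fderiv ℝ g x (hamVec f x) = poisson f g x :=
  (poisson_eq_sharp f g x).symm

lemma poisson_comm (f g : Phase ι → ℝ) (x : Phase ι) : poisson f g x = -poisson g f x := by
  rw [poisson_eq_sharp, poisson_eq_sharp, apply_sharp_comm]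

lemma poisson_congr {f f' g g' : Phase ι → ℝ} {x : Phase ι} (hf : f =ᶠ[𝓝 x] f')
    (hg : g =ᶠ[𝓝 x] g') : poisson f g x = poisson f' g' x := by
  rw [poisson_eq_sharp, poisson_eq_sharp, hf.fderiv_eq, hg.fderiv_eq]

lemma poisson_neg_left (f g : Phase ι → ℝ) (x : Phase ι) :
    poisson (fun y => -f y) g x = -poisson f g x := by
  rw [poisson_eq_sharp, poisson_eq_sharp, fderiv_fun_neg, map_neg, map_neg]

lemma poisson_neg_right (f g : Phase ι → ℝ) (x : Phase ι) :
    poisson f (fun y => -g y) x = -poisson f g x := by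
  rw [poisson_comm, poisson_neg_left, poisson_comm g f, neg_neg]

lemma hamVec_neg (f : Phase ι → ℝ) (x : Phase ι) :
    hamVec (fun y => -f y) x = -hamVec f x := by
  rw [hamVec_eq_sharp, hamVec_eq_sharp, fderiv_fun_neg, map_neg]

section Smooth

variable {U : Set (Phase ι)} {f g h : Phase ι → ℝ}

lemma contDiffOn_hamVec (hU : IsOpen U) (hf : ContDiffOn ℝ ∞ f U) :
    ContDiffOn ℝ ∞ (hamVec f) U :=
  (sharp (ι := ι)).contDiff.comp_contDiffOn (hf.fderiv_of_isOpen hU (by simp))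

lemma contDiffOn_poisson (hU : IsOpen U) (hf : ContDiffOn ℝ ∞ f U) (hg : ContDiffOn ℝ ∞ g U) :
    ContDiffOn ℝ ∞ (poisson f g) U :=
  ((hg.fderiv_of_isOpen hU (by simp)).clm_apply (contDiffOn_hamVec hU hf)).congr
    fun x _ => poisson_eq_sharp f g x

lemma hasFDerivAt_of_contDiffOn {E F : Type*} [NormedAddCommGroup E] [NormedSpace ℝ E]
    [NormedAddCommGroup F] [NormedSpace ℝ F] {U : Set E} {f : E → F} (hU : IsOpen U)
    (hf : ContDiffOn ℝ ∞ f U) {x : E} (hx : x ∈ U) : HasFDerivAt f (fderiv ℝ f x) x :=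
  ((hf.contDiffAt (hU.mem_nhds hx)).differentiableAt (by simp)).hasFDerivAt

omit [DecidableEq ι] in
lemma differentiableAt_of_contDiffOn {E F : Type*} [NormedAddCommGroup E] [NormedSpace ℝ E]
    [NormedAddCommGroup F] [NormedSpace ℝ F] {U : Set E} {f : E → F} (hU : IsOpen U)
    (hf : ContDiffOn ℝ ∞ f U) : ∀ x ∈ U, DifferentiableAt ℝ f x := fun _ hx =>
  (hasFDerivAt_of_contDiffOn hU hf hx).differentiableAt

omit [DecidableEq ι] in
lemma hasFDerivAt_fderiv (hU : IsOpen U) (hf : ContDiffOn ℝ ∞ f U) {x : Phase ι} (hx : x ∈ U) :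
    HasFDerivAt (fderiv ℝ f) (fderiv ℝ (fderiv ℝ f) x) x :=
  hasFDerivAt_of_contDiffOn hU (hf.fderiv_of_isOpen hU (by simp)) hx

omit [DecidableEq ι] in
lemma second_fderiv_comm (hU : IsOpen U) (hf : ContDiffOn ℝ ∞ f U) {x : Phase ι} (hx : x ∈ U)
    (v w : Phase ι) : fderiv ℝ (fderiv ℝ f) x v w = fderiv ℝ (fderiv ℝ f) x w v :=
  (hf.contDiffAt (hU.mem_nhds hx)).isSymmSndFDerivAt
    (by
      rw [minSmoothness_of_isRCLikeNormedField]
      exact WithTop.coe_le_coe.2 (le_top : (2 : ℕ∞) ≤ ⊤)) v w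

lemma hasFDerivAt_hamVec (hU : IsOpen U) (hf : ContDiffOn ℝ ∞ f U) {x : Phase ι} (hx : x ∈ U) :
    HasFDerivAt (hamVec f) (sharp.comp (fderiv ℝ (fderiv ℝ f) x)) x :=
  (sharp (ι := ι)).hasFDerivAt.comp x (hasFDerivAt_fderiv hU hf hx)

lemma fderiv_poisson (hU : IsOpen U) (hf : ContDiffOn ℝ ∞ f U) (hg : ContDiffOn ℝ ∞ g U)
    {x : Phase ι} (hx : x ∈ U) (v : Phase ι) :
    fderiv ℝ (poisson f g) x v = fderiv ℝ (fderiv ℝ g) x v (hamVec f x) +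
      fderiv ℝ g x (sharp (fderiv ℝ (fderiv ℝ f) x v)) := by
  have h1 := (hasFDerivAt_fderiv hU hg hx).clm_apply (hasFDerivAt_hamVec hU hf hx)
  have h2 : poisson f g = fun y => fderiv ℝ g y (hamVec f y) := by
    ext y; exact poisson_eq_sharp f g y
  rw [h2, h1.fderiv]
  simp [add_comm]

lemma fderiv_poisson_eq_zero (hU : IsOpen U) {k : ℝ} (hk : ∀ x ∈ U, poisson f g x = k)
    {x : Phase ι} (hx : x ∈ U) : fderiv ℝ (poisson f g) x = 0 := by
  have : poisson f g =ᶠ[𝓝 x] fun _ => k := by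
    filter_upwards [hU.mem_nhds hx] with y hy using hk y hy
  rw [this.fderiv_eq, fderiv_fun_const]
  rfl

/-- Hamiltonian vector fields commute if the bracket of their Hamiltonians is constant. -/
lemma hamVec_commute (hU : IsOpen U) (hf : ContDiffOn ℝ ∞ f U) (hg : ContDiffOn ℝ ∞ g U) {k : ℝ}
    (hk : ∀ x ∈ U, poisson f g x = k) {x : Phase ι} (hx : x ∈ U) :
    fderiv ℝ (hamVec f) x (hamVec g x) = fderiv ℝ (hamVec g) x (hamVec f x) := by
  rw [(hasFDerivAt_hamVec hU hf hx).fderiv, (hasFDerivAt_hamVec hU hg hx).fderiv]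
  refine SeparatingDual.eq_iff_forall_dual_eq (R := ℝ) |>.2 fun α => ?_
  have h := fderiv_poisson hU hf hg hx (sharp α)
  rw [fderiv_poisson_eq_zero hU hk hx] at h
  simp only [zero_apply, ContinuousLinearMap.comp_apply] at h ⊢
  rw [apply_sharp_comm α, apply_sharp_comm α, second_fderiv_comm hU hf hx,
    second_fderiv_comm hU hg hx, hamVec_eq_sharp g, apply_sharp_comm _ (fderiv ℝ g x), neg_neg]
  linarith

/-- The instance of the Jacobi identity that is needed: if `{h, f}` and `{h, g}` are constant,
then `{h, {f, g}} = 0`. -/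
lemma fderiv_poisson_hamVec (hU : IsOpen U) (hf : ContDiffOn ℝ ∞ f U) (hg : ContDiffOn ℝ ∞ g U)
    (hh : ContDiffOn ℝ ∞ h U) {k l : ℝ} (hk : ∀ x ∈ U, poisson h f x = k)
    (hl : ∀ x ∈ U, poisson h g x = l) {x : Phase ι} (hx : x ∈ U) :
    fderiv ℝ (poisson f g) x (hamVec h x) = 0 := by
  have h1 := hamVec_commute hU hh hf hk hx
  have h2 := hamVec_commute hU hh hg hl hx
  rw [(hasFDerivAt_hamVec hU hh hx).fderiv, (hasFDerivAt_hamVec hU hf hx).fderiv] at h1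
  rw [(hasFDerivAt_hamVec hU hh hx).fderiv, (hasFDerivAt_hamVec hU hg hx).fderiv] at h2
  simp only [ContinuousLinearMap.comp_apply] at h1 h2
  rw [fderiv_poisson hU hf hg hx, ← h1, hamVec_eq_sharp f, apply_sharp_comm _ (fderiv ℝ f x), ← h2,
    apply_sharp_comm (fderiv ℝ f x), apply_sharp_comm (fderiv ℝ g x), ← hamVec_eq_sharp,
    ← hamVec_eq_sharp, second_fderiv_comm hU hh hx]
  ring

end Smooth

/-! ### Recombined constraints -/

section Recombination

variable {κ μ : Type*} [Fintype κ] [Fintype μ]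

/-- Where the functions `s` vanish, the differentials of `∑ P_{ab} s_b` do not involve those of
`P`. -/
lemma fderiv_recombination {E : Type*} [NormedAddCommGroup E] [NormedSpace ℝ E] {U : Set E}
    (hU : IsOpen U) {c : E → ℝ} {s : κ → E → ℝ} {P : κ → E → ℝ}
    (hs : ∀ b, ContDiffOn ℝ ∞ (s b) U) (hP : ∀ b, ContDiffOn ℝ ∞ (P b) U)
    (hc : ∀ x ∈ U, c x = ∑ b, P b x * s b x) {x : E} (hx : x ∈ U) (h0 : ∀ b, s b x = 0) :
    fderiv ℝ c x = ∑ b, P b x • fderiv ℝ (s b) x := by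
  have h1 : HasFDerivAt (fun y => ∑ b, P b y * s b y) _ x :=
    HasFDerivAt.fun_sum (u := Finset.univ) fun b _ =>
      (hasFDerivAt_of_contDiffOn hU (hP b) hx).mul (hasFDerivAt_of_contDiffOn hU (hs b) hx)
  have h2 : c =ᶠ[𝓝 x] fun y => ∑ b, P b y * s b y := by
    filter_upwards [hU.mem_nhds hx] with y hy using hc y hy
  rw [h2.fderiv_eq, h1.fderiv]
  simp [h0]

lemma hamVec_of_fderiv_eq {c : Phase ι → ℝ} {s : κ → Phase ι → ℝ} {P : κ → ℝ} {x : Phase ι}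
    (h : fderiv ℝ c x = ∑ b, P b • fderiv ℝ (s b) x) :
    hamVec c x = ∑ b, P b • hamVec (s b) x := by
  simp only [hamVec_eq_sharp, h, map_sum, map_smul]

lemma bracketMatrix_recombination {c : κ → Phase ι → ℝ} {d : μ → Phase ι → ℝ}
    {s : κ → Phase ι → ℝ} {t : μ → Phase ι → ℝ} {P : Matrix κ κ ℝ} {Q : Matrix μ μ ℝ}
    {x : Phase ι} (hc : ∀ a, fderiv ℝ (c a) x = ∑ b, P a b • fderiv ℝ (s b) x)
    (hd : ∀ a, fderiv ℝ (d a) x = ∑ b, Q a b • fderiv ℝ (t b) x) :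
    bracketMatrix c d x = P * bracketMatrix s t x * Q.transpose := by
  ext a b
  simp only [bracketMatrix, Matrix.of_apply, Matrix.mul_apply, Matrix.transpose_apply,
    poisson_eq_sharp, hc, hd, map_sum, map_smul, sum_apply, smul_apply, smul_eq_mul,
    Finset.sum_mul, Finset.mul_sum]
  rw [Finset.sum_comm]
  refine Finset.sum_congr rfl fun i _ => ?_
  refine Finset.sum_congr rfl fun j _ => ?_
  ring

omit [Fintype κ] [Fintype μ] in
lemma bracketMatrix_comm (c : κ → Phase ι → ℝ) (d : μ → Phase ι → ℝ) (x : Phase ι) :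
    bracketMatrix d c x = -(bracketMatrix c d x).transpose := by
  ext a b
  exact poisson_comm _ _ _

lemma isUnit_bracketMatrix_comm [DecidableEq κ] {c d : κ → Phase ι → ℝ} {x : Phase ι}
    (h : IsUnit (bracketMatrix c d x)) : IsUnit (bracketMatrix d c x) := by
  rw [bracketMatrix_comm]
  exact ((Matrix.isUnit_transpose _).2 h).neg

end Recombination

end Poisson

/-! ### Abelianization -/

section Abelianization

variable {ι A : Type*} [Fintype ι] [DecidableEq ι] [Fintype A] [DecidableEq A]

/-- First class constraints `σ` with `{ℓ_a, σ_b}` invertible at `x₀`, for commuting functions `ℓ`,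
are near `x₀` a recombination of functions `s` that commute everywhere and are conjugate to `ℓ`.
The `s_b` are the times needed to come from `{σ = 0}` along the flow of `ℓ`. By the Jacobi identity
`{s_a, s_b}` is constant along this flow, and it vanishes on `{σ = 0}`. -/
theorem exists_conjugate {U₀ : Set (Phase ι)} (hU₀ : IsOpen U₀) {x₀ : Phase ι} (hx₀ : x₀ ∈ U₀)
    {ℓ σ : A → Phase ι → ℝ} (hℓ : ∀ a, ContDiffOn ℝ ∞ (ℓ a) U₀)
    (hℓℓ : ∀ x ∈ U₀, ∀ a b, poisson (ℓ a) (ℓ b) x = 0) (hσ : ∀ a, ContDiffOn ℝ ∞ (σ a) U₀)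
    (hσ0 : ∀ a, σ a x₀ = 0)
    (hσσ : ∀ x ∈ U₀, (∀ a, σ a x = 0) → ∀ a b, poisson (σ a) (σ b) x = 0)
    (hunit : IsUnit (bracketMatrix ℓ σ x₀)) :
    ∃ (s : A → Phase ι → ℝ) (G : Phase ι → Matrix A A ℝ) (U : Set (Phase ι)),
      IsOpen U ∧ x₀ ∈ U ∧ U ⊆ U₀ ∧ (∀ a, ContDiffOn ℝ ∞ (s a) U) ∧
      (∀ a b, ContDiffOn ℝ ∞ (fun x => G x a b) U) ∧ (∀ x ∈ U, IsUnit (G x)) ∧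
      (∀ x ∈ U, ∀ a, σ a x = ∑ b, G x a b * s b x) ∧
      (∀ x ∈ U, ∀ a b, poisson (s a) (s b) x = 0) ∧
      (∀ x ∈ U, ∀ a b, poisson (ℓ a) (s b) x = if a = b then 1 else 0) := by
  have hmat : (Matrix.of fun a b => fderiv ℝ (σ a) x₀ (hamVec (ℓ b) x₀)) =
      (bracketMatrix ℓ σ x₀).transpose := by
    ext a b
    exact fderiv_hamVec _ _ _
  obtain ⟨s, G, U, hU, hxU, hUU₀, hs, hG, hGu, hσs, hsX, hline⟩ :=
    exists_straightening (X := fun b => hamVec (ℓ b)) hU₀ (fun b => contDiffOn_hamVec hU₀ (hℓ b))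
      (fun x hx a b => hamVec_commute hU₀ (hℓ a) (hℓ b) (fun y hy => hℓℓ y hy a b) hx)
      hx₀ hσ hσ0 (by rw [hmat]; exact (Matrix.isUnit_transpose _).2 hunit)
  have hℓs : ∀ x ∈ U, ∀ a b, poisson (ℓ a) (s b) x = if a = b then 1 else 0 := by
    intro x hx a b
    rw [← fderiv_hamVec, hsX x hx b a]
    simp only [eq_comm]
  obtain ⟨U', hU', hU'o, hxU'⟩ := eventually_nhds_iff.1 hline
  refine ⟨s, G, U ∩ U', hU.inter hU'o, ⟨hxU, hxU'⟩, fun x hx => hUU₀ hx.1,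
    fun a => (hs a).mono inter_subset_left, fun a b => (hG a b).mono inter_subset_left,
    fun x hx => hGu x hx.1, fun x hx => hσs x hx.1, fun x hx a b => ?_,
    fun x hx => hℓs x hx.1⟩
  obtain ⟨γ, hγ0, hγ1, hγ⟩ := hU' x hx.2
  have hy : γ 1 ∈ U := (hγ 1 (by simp)).1
  have hs0 : ∀ b, s b (γ 1) = 0 := by
    have h1 : (G (γ 1)).mulVec (fun b => s b (γ 1)) = 0 := by
      ext a
      have := hσs _ hy a
      rw [hγ1 a] at this
      exact this.symm
    have h2 := (Matrix.isUnit_iff_isUnit_det _).1 (hGu _ hy)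
    exact congrFun (Matrix.eq_zero_of_mulVec_eq_zero (isUnit_iff_ne_zero.1 h2) h1)
  -- The brackets `{s, s}` vanish at the end of the flow line, where `σ = 0`, and they are constant
  -- along it.
  have hend : bracketMatrix s s (γ 1) = 0 := by
    have h1 : bracketMatrix σ σ (γ 1) = 0 := by
      ext a b
      exact hσσ _ (hUU₀ hy) hγ1 a b
    have h2 : ∀ a, fderiv ℝ (σ a) (γ 1) = ∑ b, G (γ 1) a b • fderiv ℝ (s b) (γ 1) := fun a =>
      fderiv_recombination hU hs (hG a) (fun x hx => hσs x hx a) hy hs0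
    rw [bracketMatrix_recombination h2 h2] at h1
    have h3 := ((Matrix.isUnit_transpose _).2 (hGu _ hy)).mul_left_eq_zero.1 h1
    exact (hGu _ hy).mul_right_eq_zero.1 h3
  have hconst := hγ.apply_eq (f := poisson (s a) (s b)) (c := fun _ => 0)
    (fun y hy => (hasFDerivAt_of_contDiffOn hU
      (contDiffOn_poisson hU (hs a) (hs b)) hy).differentiableAt)
    (fun y hy c => fderiv_poisson_hamVec hU (hs a) (hs b) ((hℓ c).mono hUU₀)
      (fun y hy => hℓs y hy c a) (fun y hy => hℓs y hy c b) hy) (t := 1) (by simp)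
  rw [hγ0] at hconst
  simp only [smul_zero, Finset.sum_const_zero, add_zero] at hconst
  rw [← hconst]
  exact congrFun (congrFun hend a) b

/-- The linear function whose Hamiltonian vector field is the constant vector with the components
of the covector `α`. -/
noncomputable def gradientHamiltonian (α : Phase ι →L[ℝ] ℝ) : Phase ι →L[ℝ] ℝ :=
  ∑ i, (α (0, Pi.single i 1) •
      (ContinuousLinearMap.proj i).comp (ContinuousLinearMap.fst ℝ (ι → ℝ) (ι → ℝ)) -
    α (Pi.single i 1, 0) •
      (ContinuousLinearMap.proj i).comp (ContinuousLinearMap.snd ℝ (ι → ℝ) (ι → ℝ)))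

lemma gradientHamiltonian_q (α : Phase ι →L[ℝ] ℝ) (i : ι) :
    gradientHamiltonian α (Pi.single i 1, 0) = α (0, Pi.single i 1) := by
  simp [gradientHamiltonian, Pi.single_apply]

lemma gradientHamiltonian_p (α : Phase ι →L[ℝ] ℝ) (i : ι) :
    gradientHamiltonian α (0, Pi.single i 1) = -α (Pi.single i 1, 0) := by
  simp [gradientHamiltonian, Pi.single_apply]

/-- First class constraints with independent differentials at `x₀` are near `x₀` a recombination of
functions that commute everywhere. The linear functions whose Hamiltonian vector fields are the
gradients of the constraints at `x₀` commute, and their brackets with the constraints form a Gram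
matrix, so that the constraints can be made conjugate to them. -/
theorem exists_abelianization {U₀ : Set (Phase ι)} (hU₀ : IsOpen U₀) {x₀ : Phase ι}
    (hx₀ : x₀ ∈ U₀) {σ : A → Phase ι → ℝ} (hσ : ∀ a, ContDiffOn ℝ ∞ (σ a) U₀)
    (hσ0 : ∀ a, σ a x₀ = 0)
    (hσσ : ∀ x ∈ U₀, (∀ a, σ a x = 0) → ∀ a b, poisson (σ a) (σ b) x = 0)
    (hind : LinearIndependent ℝ fun a => fderiv ℝ (σ a) x₀) :
    ∃ (s : A → Phase ι → ℝ) (G : Phase ι → Matrix A A ℝ) (U : Set (Phase ι)),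
      IsOpen U ∧ x₀ ∈ U ∧ U ⊆ U₀ ∧ (∀ a, ContDiffOn ℝ ∞ (s a) U) ∧
      (∀ a b, ContDiffOn ℝ ∞ (fun x => G x a b) U) ∧ (∀ x ∈ U, IsUnit (G x)) ∧
      (∀ x ∈ U, ∀ a, σ a x = ∑ b, G x a b * s b x) ∧
      (∀ x ∈ U, ∀ a b, poisson (s a) (s b) x = 0) := by
  let ℓ : A → Phase ι → ℝ := fun a x => gradientHamiltonian (fderiv ℝ (σ a) x₀) x
  have hdℓ : ∀ a x, fderiv ℝ (ℓ a) x = gradientHamiltonian (fderiv ℝ (σ a) x₀) := fun a x =>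
    (gradientHamiltonian (fderiv ℝ (σ a) x₀)).fderiv
  -- Passing from covectors to gradients is a symplectic map, so `{ℓ_a, ℓ_b}` is the constant
  -- `{σ_a, σ_b}(x₀)`.
  have hℓℓ : ∀ x ∈ U₀, ∀ a b, poisson (ℓ a) (ℓ b) x = 0 := by
    intro x _ a b
    have h := hσσ x₀ hx₀ hσ0 a b
    rw [poisson_eq_sharp, apply_sharp] at h ⊢
    rw [← h]
    refine Finset.sum_congr rfl fun i _ => ?_
    rw [hdℓ, hdℓ, gradientHamiltonian_q, gradientHamiltonian_q, gradientHamiltonian_p,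
      gradientHamiltonian_p]
    ring
  have hgram : ∀ a b, poisson (ℓ a) (σ b) x₀ =
      ∑ i, (fderiv ℝ (σ a) x₀ (0, Pi.single i 1) * fderiv ℝ (σ b) x₀ (0, Pi.single i 1) +
        fderiv ℝ (σ a) x₀ (Pi.single i 1, 0) * fderiv ℝ (σ b) x₀ (Pi.single i 1, 0)) := by
    intro a b
    rw [poisson_eq_sharp, apply_sharp]
    refine Finset.sum_congr rfl fun i _ => ?_
    rw [hdℓ, gradientHamiltonian_q, gradientHamiltonian_p]
    ring
  have hunit : IsUnit (bracketMatrix ℓ σ x₀) := by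
    rw [Matrix.isUnit_iff_isUnit_det, isUnit_iff_ne_zero]
    intro hdet
    obtain ⟨v, hv, hv0⟩ := Matrix.exists_mulVec_eq_zero_iff.2 hdet
    apply hv
    -- The Gram matrix annihilates `v`, so `∑ v_a dσ_a` has length zero.
    set α : Phase ι →L[ℝ] ℝ := ∑ a, v a • fderiv ℝ (σ a) x₀ with hα
    have h1 : ∑ i, (α (0, Pi.single i 1) * α (0, Pi.single i 1) +
        α (Pi.single i 1, 0) * α (Pi.single i 1, 0)) = 0 := by
      have h2 : ∑ a, v a * (bracketMatrix ℓ σ x₀).mulVec v a = 0 := by simp [hv0]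
      rw [← h2]
      simp only [Matrix.mulVec, dotProduct, bracketMatrix, Matrix.of_apply, hgram, hα,
        sum_apply, smul_apply, smul_eq_mul, Finset.sum_mul, Finset.mul_sum,
        ← Finset.sum_add_distrib]
      rw [Finset.sum_comm]
      refine Finset.sum_congr rfl fun a _ => ?_
      rw [Finset.sum_comm]
      refine Finset.sum_congr rfl fun b _ => ?_
      refine Finset.sum_congr rfl fun i _ => ?_
      ring
    have h3 : α = 0 := by
      have h4 := (Finset.sum_eq_zero_iff_of_nonneg (fun i _ =>
        add_nonneg (mul_self_nonneg _) (mul_self_nonneg _))).1 h1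
      refine ContinuousLinearMap.ext fun w => ?_
      rw [covector_apply, zero_apply]
      refine Finset.sum_eq_zero fun i hi => ?_
      have h5 := h4 i hi
      have h6 := mul_self_nonneg (α (0, Pi.single i 1))
      have h7 := mul_self_nonneg (α (Pi.single i 1, 0))
      have h8 : α (0, Pi.single i 1) = 0 := mul_self_eq_zero.1 (by linarith)
      have h9 : α (Pi.single i 1, 0) = 0 := mul_self_eq_zero.1 (by linarith)
      rw [h8, h9]
      ring
    ext a
    exact Fintype.linearIndependent_iff.1 hind v h3 a
  obtain ⟨s, G, U, hU, hxU, hUU₀, hs, hG, hGu, hσs, hss, -⟩ :=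
    exists_conjugate hU₀ hx₀
      (fun a => (gradientHamiltonian (fderiv ℝ (σ a) x₀)).contDiff.contDiffOn)
      hℓℓ hσ hσ0 hσσ hunit
  exact ⟨s, G, U, hU, hxU, hUU₀, hs, hG, hGu, hσs, hss⟩

/-- Two sets of first class constraints `χ`, `σ` with `{χ_a, σ_b}` invertible at a common zero `x₀`
are near `x₀` recombinations of canonically conjugate sets `c`, `s`. -/
theorem exists_conjugate_abelianization {U₀ : Set (Phase ι)} (hU₀ : IsOpen U₀) {x₀ : Phase ι}
    (hx₀ : x₀ ∈ U₀) {χ σ : A → Phase ι → ℝ} (hχ : IsGaugeTheory U₀ χ) (hσ : IsGaugeTheory U₀ σ)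
    (hχ0 : ∀ a, χ a x₀ = 0) (hσ0 : ∀ a, σ a x₀ = 0) (hunit : IsUnit (bracketMatrix χ σ x₀)) :
    ∃ (c s : A → Phase ι → ℝ) (P Q : Phase ι → Matrix A A ℝ) (U : Set (Phase ι)),
      IsOpen U ∧ x₀ ∈ U ∧ U ⊆ U₀ ∧
      (∀ a, ContDiffOn ℝ ∞ (c a) U) ∧ (∀ a, ContDiffOn ℝ ∞ (s a) U) ∧
      (∀ a b, ContDiffOn ℝ ∞ (fun x => P x a b) U) ∧
      (∀ a b, ContDiffOn ℝ ∞ (fun x => Q x a b) U) ∧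
      (∀ x ∈ U, IsUnit (P x)) ∧ (∀ x ∈ U, IsUnit (Q x)) ∧
      (∀ x ∈ U, ∀ a, χ a x = ∑ b, P x a b * c b x) ∧
      (∀ x ∈ U, ∀ a, σ a x = ∑ b, Q x a b * s b x) ∧
      (∀ x ∈ U, ∀ a b, poisson (c a) (c b) x = 0) ∧
      (∀ x ∈ U, ∀ a b, poisson (s a) (s b) x = 0) ∧
      (∀ x ∈ U, ∀ a b, poisson (c a) (s b) x = if a = b then 1 else 0) := by
  obtain ⟨s, Q, U₁, hU₁, hxU₁, hU₁₀, hs, hQ, hQu, hσs, hss⟩ := exists_abelianization hU₀ hx₀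
    hσ.smooth hσ0 (fun x hx h => hσ.firstClass x ⟨hx, h⟩) (hσ.regular x₀ ⟨hx₀, hσ0⟩)
  have hs0 : ∀ b, s b x₀ = 0 := by
    have h1 : (Q x₀).mulVec (fun b => s b x₀) = 0 := by
      ext a
      have := hσs _ hxU₁ a
      rw [hσ0 a] at this
      exact this.symm
    have h2 := (Matrix.isUnit_iff_isUnit_det _).1 (hQu _ hxU₁)
    exact congrFun (Matrix.eq_zero_of_mulVec_eq_zero (isUnit_iff_ne_zero.1 h2) h1)
  have hunit' : IsUnit (bracketMatrix s χ x₀) := by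
    have h1 : ∀ a, fderiv ℝ (σ a) x₀ = ∑ b, Q x₀ a b • fderiv ℝ (s b) x₀ := fun a =>
      fderiv_recombination hU₁ hs (hQ a) (fun x hx => hσs x hx a) hxU₁ hs0
    have h2 : ∀ a, fderiv ℝ (χ a) x₀ = ∑ b, (1 : Matrix A A ℝ) a b • fderiv ℝ (χ b) x₀ :=
      fun a => by simp [Matrix.one_apply]
    have h3 := isUnit_bracketMatrix_comm hunit
    rw [bracketMatrix_recombination h1 h2, Matrix.transpose_one, mul_one] at h3
    exact isUnit_of_mul_isUnit_right h3
  obtain ⟨c, P, U, hU, hxU, hU₁', hc, hP, hPu, hχc, hcc, hsc⟩ := exists_conjugate hU₁ hxU₁ hs hss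
    (fun a => (hχ.smooth a).mono hU₁₀) hχ0 (fun x hx h => hχ.firstClass x ⟨hU₁₀ hx, h⟩) hunit'
  -- The sign turns `{s, c} = δ` into `{-c, s} = δ`.
  refine ⟨fun a x => -c a x, s, fun x => -P x, Q, U, hU, hxU, hU₁'.trans hU₁₀,
    fun a => (hc a).neg, fun a => (hs a).mono hU₁', fun a b => (hP a b).neg,
    fun a b => (hQ a b).mono hU₁', fun x hx => (hPu x hx).neg, fun x hx => hQu x (hU₁' hx), ?_,
    fun x hx => hσs x (hU₁' hx), ?_, fun x hx => hss x (hU₁' hx), ?_⟩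
  · intro x hx a
    rw [hχc x hx a]
    simp
  · intro x hx a b
    rw [poisson_neg_left, poisson_neg_right, hcc x hx]
    simp
  · intro x hx a b
    rw [poisson_neg_left, poisson_comm, neg_neg, hsc x hx]
    simp only [eq_comm]

/-- `U` is a neighbourhood on which `(c, s)` are canonical coordinates that split off: `{c, c} = 0`,
`{s, s} = 0`, `{c_a, s_b} = δ_{ab}`, the map `z` is a projection of `U` to `{c = s = 0}` that is
constant along the flows of `c` and `s` and separates points together with `(c, s)`, and the flows
of `c` and of `s` move every point of `U` inside `U` to `s = 0` and to `c = 0`, respectively. -/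
structure IsDarbouxBox (U : Set (Phase ι)) (c s : A → Phase ι → ℝ) (z : Phase ι → Phase ι) :
    Prop where
  isOpen : IsOpen U
  smooth_c : ∀ a, ContDiffOn ℝ ∞ (c a) U
  smooth_s : ∀ a, ContDiffOn ℝ ∞ (s a) U
  smooth_z : ContDiffOn ℝ ∞ z U
  bracket_cc : ∀ x ∈ U, ∀ a b, poisson (c a) (c b) x = 0
  bracket_ss : ∀ x ∈ U, ∀ a b, poisson (s a) (s b) x = 0
  bracket_cs : ∀ x ∈ U, ∀ a b, poisson (c a) (s b) x = if a = b then 1 else 0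
  z_mem : ∀ x ∈ U, z x ∈ U
  c_z : ∀ x ∈ U, ∀ a, c a (z x) = 0
  s_z : ∀ x ∈ U, ∀ a, s a (z x) = 0
  z_eq_self : ∀ x ∈ U, (∀ a, c a x = 0) → (∀ a, s a x = 0) → z x = x
  fderiv_z : ∀ x ∈ U, (∀ a, c a x = 0) → (∀ a, s a x = 0) → ∀ v, fderiv ℝ z x v =
    v + ∑ a, fderiv ℝ (c a) x v • hamVec (s a) x - ∑ a, fderiv ℝ (s a) x v • hamVec (c a) x
  fderiv_z_hamVec_c : ∀ x ∈ U, ∀ a, fderiv ℝ z x (hamVec (c a) x) = 0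
  fderiv_z_hamVec_s : ∀ x ∈ U, ∀ a, fderiv ℝ z x (hamVec (s a) x) = 0
  injOn : ∀ x ∈ U, ∀ y ∈ U, (∀ a, c a x = c a y) → (∀ a, s a x = s a y) → z x = z y → x = y
  line_c : ∀ x ∈ U, ∃ γ : ℝ → Phase ι, γ 0 = x ∧
    IsFlowLine (fun a => hamVec (c a)) U (fun a => -s a x) γ
  line_s : ∀ x ∈ U, ∃ γ : ℝ → Phase ι, γ 0 = x ∧
    IsFlowLine (fun a => hamVec (s a)) U (fun a => c a x) γ

lemma IsDarbouxBox.symm {U : Set (Phase ι)} {c s : A → Phase ι → ℝ} {z : Phase ι → Phase ι}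
    (h : IsDarbouxBox U c s z) : IsDarbouxBox U s (fun a x => -c a x) z where
  isOpen := h.isOpen
  smooth_c := h.smooth_s
  smooth_s a := (h.smooth_c a).neg
  smooth_z := h.smooth_z
  bracket_cc := h.bracket_ss
  bracket_ss x hx a b := by rw [poisson_neg_left, poisson_neg_right, h.bracket_cc x hx]; simp
  bracket_cs x hx a b := by
    rw [poisson_neg_right, poisson_comm, neg_neg, h.bracket_cs x hx]
    simp only [eq_comm]
  z_mem := h.z_mem
  c_z := h.s_z
  s_z x hx a := by rw [h.c_z x hx, neg_zero]
  z_eq_self x hx h1 h2 := h.z_eq_self x hx (fun a => neg_eq_zero.1 (h2 a)) h1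
  fderiv_z x hx h1 h2 v := by
    rw [h.fderiv_z x hx (fun a => neg_eq_zero.1 (h2 a)) h1]
    simp only [fderiv_fun_neg, neg_apply, hamVec_neg, smul_neg, neg_smul, Finset.sum_neg_distrib]
    abel
  fderiv_z_hamVec_c := h.fderiv_z_hamVec_s
  fderiv_z_hamVec_s x hx a := by rw [hamVec_neg, map_neg, h.fderiv_z_hamVec_c x hx, neg_zero]
  injOn x hx y hy h1 h2 := h.injOn x hx y hy (fun a => neg_injective (h2 a)) h1
  line_c x hx := by simpa only [neg_neg] using h.line_s x hx
  line_s x hx := by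
    obtain ⟨γ, h0, hγ⟩ := h.line_c x hx
    refine ⟨γ, h0, fun t ht => ⟨(hγ t ht).1, (hγ t ht).2.congr_deriv ?_⟩⟩
    simp [fieldSum, hamVec_neg]

/-- Canonically conjugate sets of functions near a common zero have arbitrarily small Darboux
boxes. -/
theorem exists_darbouxBox {U₀ : Set (Phase ι)} (hU₀ : IsOpen U₀) {x₀ : Phase ι} (hx₀ : x₀ ∈ U₀)
    {c s : A → Phase ι → ℝ} (hc : ∀ a, ContDiffOn ℝ ∞ (c a) U₀)
    (hs : ∀ a, ContDiffOn ℝ ∞ (s a) U₀)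
    (hcc : ∀ x ∈ U₀, ∀ a b, poisson (c a) (c b) x = 0)
    (hss : ∀ x ∈ U₀, ∀ a b, poisson (s a) (s b) x = 0)
    (hcs : ∀ x ∈ U₀, ∀ a b, poisson (c a) (s b) x = if a = b then 1 else 0)
    (hc0 : ∀ a, c a x₀ = 0) (hs0 : ∀ a, s a x₀ = 0) :
    ∃ (z : Phase ι → Phase ι) (U : Set (Phase ι)), x₀ ∈ U ∧ U ⊆ U₀ ∧ IsDarbouxBox U c s z := by
  -- The Hamiltonians of the fields dual to `(c, s)`.
  let ℓ : A ⊕ A → Phase ι → ℝ := Sum.elim (fun a x => -s a x) c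
  let f : A ⊕ A → Phase ι → ℝ := Sum.elim c s
  have hℓ : ∀ b, ContDiffOn ℝ ∞ (ℓ b) U₀ := by
    rintro (a | a)
    exacts [(hs a).neg, hc a]
  have hf : ∀ b, ContDiffOn ℝ ∞ (f b) U₀ := by
    rintro (a | a)
    exacts [hc a, hs a]
  have hdual : ∀ x ∈ U₀, ∀ a b, poisson (ℓ b) (f a) x = if a = b then 1 else 0 := by
    rintro x hx (a | a) (b | b)
    · simp only [ℓ, f, Sum.elim_inl, poisson_neg_left, Sum.inl.injEq]
      rw [poisson_comm, neg_neg, hcs x hx]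
    · simp only [ℓ, f, Sum.elim_inl, Sum.elim_inr, hcc x hx, reduceCtorEq, if_false]
    · simp only [ℓ, f, Sum.elim_inl, Sum.elim_inr, poisson_neg_left, hss x hx, reduceCtorEq,
        if_false, neg_zero]
    · simp only [ℓ, f, Sum.elim_inr, hcs x hx, Sum.inr.injEq]
      simp only [eq_comm]
  have hℓℓ : ∀ a b, ∃ k : ℝ, ∀ x ∈ U₀, poisson (ℓ a) (ℓ b) x = k := by
    rintro (a | a) b
    · refine ⟨-(if b = Sum.inr a then -1 else 0), fun x hx => ?_⟩
      rw [poisson_comm]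
      simp only [ℓ, Sum.elim_inl, poisson_neg_right]
      have := hdual x hx (Sum.inr a) b
      simp only [ℓ, f, Sum.elim_inr] at this
      rw [this]
      by_cases h : b = Sum.inr a
      · simp [h]
      · simp [h, Ne.symm h]
    · refine ⟨-(if b = Sum.inl a then 1 else 0), fun x hx => ?_⟩
      rw [poisson_comm]
      have := hdual x hx (Sum.inl a) b
      simp only [f, Sum.elim_inl] at this
      simp only [ℓ, Sum.elim_inr] at this ⊢
      rw [this]
      simp only [eq_comm]
  obtain ⟨z, U, hU, hxU, hUU₀, hz, hzU, hfz, hzid, hdz, hzX, hinj, hline⟩ :=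
    exists_flowBox (X := fun b => hamVec (ℓ b)) hU₀ (fun b => contDiffOn_hamVec hU₀ (hℓ b))
      (fun x hx a b => by
        obtain ⟨k, hk⟩ := hℓℓ a b
        exact hamVec_commute hU₀ (hℓ a) (hℓ b) hk hx)
      hx₀ hf (by rintro (a | a); exacts [hc0 a, hs0 a])
      (fun x hx a b => by rw [fderiv_hamVec]; exact hdual x hx a b)
  refine ⟨z, U, hxU, hUU₀, ?_⟩
  exact
    { isOpen := hU
      smooth_c := fun a => (hc a).mono hUU₀
      smooth_s := fun a => (hs a).mono hUU₀
      smooth_z := hz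
      bracket_cc := fun x hx => hcc x (hUU₀ hx)
      bracket_ss := fun x hx => hss x (hUU₀ hx)
      bracket_cs := fun x hx => hcs x (hUU₀ hx)
      z_mem := hzU
      c_z := fun x hx a => hfz x hx (Sum.inl a)
      s_z := fun x hx a => hfz x hx (Sum.inr a)
      z_eq_self := fun x hx h1 h2 => hzid x hx (by rintro (a | a); exacts [h1 a, h2 a])
      fderiv_z := fun x hx h1 h2 v => by
        rw [hdz x hx (by rintro (a | a); exacts [h1 a, h2 a]) v, Fintype.sum_sum_type]
        simp only [f, ℓ, Sum.elim_inl, Sum.elim_inr, hamVec_neg, smul_neg, Finset.sum_neg_distrib]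
        abel
      fderiv_z_hamVec_c := fun x hx a => hzX x hx (Sum.inr a)
      fderiv_z_hamVec_s := fun x hx a => by
        have := hzX x hx (Sum.inl a)
        simp only [ℓ, Sum.elim_inl, hamVec_neg, map_neg, neg_eq_zero] at this
        exact this
      injOn := fun x hx y hy h1 h2 => hinj x hx y hy (by
        rintro (a | a); exacts [h1 a, h2 a])
      line_c := fun x hx => by
        obtain ⟨γ, h0, hγ⟩ := hline x hx (Sum.elim (fun _ => 0) (fun a => -s a x)) (by
          rintro (a | a); exacts [Or.inl rfl, Or.inr rfl])
        refine ⟨γ, h0, fun t ht => ⟨(hγ t ht).1, (hγ t ht).2.congr_deriv ?_⟩⟩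
        simp [fieldSum, ℓ, Fintype.sum_sum_type]
      line_s := fun x hx => by
        obtain ⟨γ, h0, hγ⟩ := hline x hx (Sum.elim (fun a => -c a x) (fun _ => 0)) (by
          rintro (a | a); exacts [Or.inr rfl, Or.inl rfl])
        refine ⟨γ, h0, fun t ht => ⟨(hγ t ht).1, (hγ t ht).2.congr_deriv ?_⟩⟩
        simp [fieldSum, ℓ, Fintype.sum_sum_type, hamVec_neg] }

end Abelianization

/-! ### The Dirac bracket of two conjugate sets -/

section Dirac

variable {ι κ A I : Type*} [Fintype ι] [DecidableEq ι] [Fintype A] [DecidableEq A]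

omit [Fintype ι] [DecidableEq ι] in
lemma mem_surface_elim {U : Set (Phase ι)} {c : κ → Phase ι → ℝ} {d : I → Phase ι → ℝ}
    {x : Phase ι} :
    x ∈ surface U (Sum.elim c d) ↔ x ∈ U ∧ (∀ a, c a x = 0) ∧ ∀ i, d i x = 0 := by
  simp only [surface, mem_ofPred_eq, Sum.forall, Sum.elim_inl, Sum.elim_inr]

lemma IsGaugeTheory.mono {U V : Set (Phase ι)} {c : κ → Phase ι → ℝ} (h : IsGaugeTheory U c)
    (hV : IsOpen V) (hVU : V ⊆ U) : IsGaugeTheory V c where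
  isOpen := hV
  smooth a := (h.smooth a).mono hVU
  regular x hx := h.regular x ⟨hVU hx.1, hx.2⟩
  firstClass x hx := h.firstClass x ⟨hVU hx.1, hx.2⟩

omit [Fintype A] [DecidableEq A] in
lemma bracketMatrix_elim (c g : A → Phase ι → ℝ) (x : Phase ι) :
    bracketMatrix (Sum.elim c g) (Sum.elim c g) x =
      Matrix.fromBlocks (bracketMatrix c c x) (bracketMatrix c g x)
        (bracketMatrix g c x) (bracketMatrix g g x) := by
  ext (a | a) (b | b) <;> rfl

lemma bracketMatrix_elim_mul {c g : A → Phase ι → ℝ} {x : Phase ι}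
    (hcc : bracketMatrix c c x = 0) (hgg : bracketMatrix g g x = 0)
    (hcg : IsUnit (bracketMatrix c g x)) :
    bracketMatrix (Sum.elim c g) (Sum.elim c g) x *
      Matrix.fromBlocks 0 (-(bracketMatrix c g x)⁻¹.transpose) (bracketMatrix c g x)⁻¹ 0 = 1 := by
  have h1 : bracketMatrix c g x * (bracketMatrix c g x)⁻¹ = 1 :=
    Matrix.mul_nonsing_inv _ ((Matrix.isUnit_iff_isUnit_det _).1 hcg)
  have h2 : (bracketMatrix c g x)⁻¹ * bracketMatrix c g x = 1 :=
    Matrix.nonsing_inv_mul _ ((Matrix.isUnit_iff_isUnit_det _).1 hcg)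
  rw [bracketMatrix_elim, hcc, hgg, bracketMatrix_comm c g, Matrix.fromBlocks_multiply]
  simp only [Matrix.zero_mul, Matrix.mul_zero, zero_add, add_zero, h1, neg_mul_neg,
    ← Matrix.transpose_mul, h2, Matrix.transpose_one, Matrix.fromBlocks_one]

lemma isUnit_bracketMatrix_elim {c g : A → Phase ι → ℝ} {x : Phase ι}
    (hcc : bracketMatrix c c x = 0) (hgg : bracketMatrix g g x = 0)
    (hcg : IsUnit (bracketMatrix c g x)) :
    IsUnit (bracketMatrix (Sum.elim c g) (Sum.elim c g) x) :=
  IsUnit.of_mul_eq_one _ (bracketMatrix_elim_mul hcc hgg hcg)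

/-- The inverse of the Dirac matrix of two conjugate sets has off-diagonal blocks only. -/
lemma diracBracket_elim {c g : A → Phase ι → ℝ} {x : Phase ι}
    (hcc : bracketMatrix c c x = 0) (hgg : bracketMatrix g g x = 0)
    (hcg : IsUnit (bracketMatrix c g x)) (f h : Phase ι → ℝ) :
    diracBracket (Sum.elim c g) f h x = poisson f h x +
      ∑ a, ∑ b, poisson f (c a) x * (bracketMatrix c g x)⁻¹ b a * poisson (g b) h x -
      ∑ a, ∑ b, poisson f (g a) x * (bracketMatrix c g x)⁻¹ a b * poisson (c b) h x := by
  rw [diracBracket, Matrix.inv_eq_right_inv (bracketMatrix_elim_mul hcc hgg hcg)]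
  simp only [Fintype.sum_sum_type, Sum.elim_inl, Sum.elim_inr, Matrix.fromBlocks_apply₁₁,
    Matrix.fromBlocks_apply₁₂, Matrix.fromBlocks_apply₂₁, Matrix.fromBlocks_apply₂₂,
    Matrix.zero_apply, Matrix.neg_apply, Matrix.transpose_apply, mul_zero, zero_mul,
    Finset.sum_const_zero, zero_add, add_zero, mul_neg, neg_mul, Finset.sum_neg_distrib]
  ring

lemma diracBracket_elim_swap {c g : A → Phase ι → ℝ} {x : Phase ι}
    (hcc : bracketMatrix c c x = 0) (hgg : bracketMatrix g g x = 0)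
    (hcg : IsUnit (bracketMatrix c g x)) (f h : Phase ι → ℝ) :
    diracBracket (Sum.elim c g) f h x = diracBracket (Sum.elim g c) f h x := by
  have h1 : (bracketMatrix g c x)⁻¹ = -(bracketMatrix c g x)⁻¹.transpose := by
    refine Matrix.inv_eq_right_inv ?_
    rw [bracketMatrix_comm c g, neg_mul_neg, ← Matrix.transpose_mul,
      Matrix.nonsing_inv_mul _ ((Matrix.isUnit_iff_isUnit_det _).1 hcg), Matrix.transpose_one]
  rw [diracBracket_elim hcc hgg hcg, diracBracket_elim hgg hcc (isUnit_bracketMatrix_comm hcg), h1]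
  simp only [Matrix.neg_apply, Matrix.transpose_apply, mul_neg, neg_mul, Finset.sum_neg_distrib]
  ring

/-- The Dirac bracket does not change when one of the two conjugate sets is recombined. -/
lemma diracBracket_elim_recombination {c k g : A → Phase ι → ℝ} {x : Phase ι} {P : Matrix A A ℝ}
    {ε : ℝ} (hP : IsUnit P) (hε : ε * ε = 1)
    (hc : ∀ a, fderiv ℝ (c a) x = ∑ b, P a b • fderiv ℝ (k b) x)
    (hkk : bracketMatrix k k x = 0) (hgg : bracketMatrix g g x = 0)
    (hkg : bracketMatrix k g x = ε • (1 : Matrix A A ℝ)) (f h : Phase ι → ℝ) :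
    IsUnit (bracketMatrix c g x) ∧ IsUnit (bracketMatrix (Sum.elim c g) (Sum.elim c g) x) ∧
    diracBracket (Sum.elim c g) f h x = poisson f h x +
      ε * ∑ a, poisson f (k a) x * poisson (g a) h x -
      ε * ∑ a, poisson f (g a) x * poisson (k a) h x := by
  have hP1 : P⁻¹ * P = 1 := Matrix.nonsing_inv_mul _ ((Matrix.isUnit_iff_isUnit_det _).1 hP)
  have hP2 : P * P⁻¹ = 1 := Matrix.mul_nonsing_inv _ ((Matrix.isUnit_iff_isUnit_det _).1 hP)
  have hcc : bracketMatrix c c x = 0 := by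
    rw [bracketMatrix_recombination hc hc, hkk, Matrix.mul_zero, Matrix.zero_mul]
  have hcg : bracketMatrix c g x = ε • P := by
    rw [bracketMatrix_recombination (Q := 1) (t := g) hc
      (fun a => by simp [Matrix.one_apply, ite_smul]), hkg]
    simp
  have hmul : bracketMatrix c g x * (ε • P⁻¹) = 1 := by
    rw [hcg, Matrix.smul_mul, Matrix.mul_smul, hP2, smul_smul, hε, one_smul]
  have hunit : IsUnit (bracketMatrix c g x) := IsUnit.of_mul_eq_one _ hmul
  refine ⟨hunit, isUnit_bracketMatrix_elim hcc hgg hunit, ?_⟩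
  have hfc : ∀ f a, poisson f (c a) x = ∑ b, P a b * poisson f (k b) x := fun f a => by
    rw [poisson_eq_sharp, hc]
    simp only [sum_apply, smul_apply, smul_eq_mul, ← poisson_eq_sharp]
  have hcf : ∀ f a, poisson (c a) f x = ∑ b, P a b * poisson (k b) f x := fun f a => by
    rw [poisson_comm, hfc, ← Finset.sum_neg_distrib]
    exact Finset.sum_congr rfl fun b _ => by rw [poisson_comm f]; ring
  have hinv : ∀ b d, ∑ a, P⁻¹ b a * P a d = if b = d then 1 else 0 := fun b d => by
    rw [← Matrix.mul_apply, hP1, Matrix.one_apply]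
  rw [diracBracket_elim hcc hgg hunit, Matrix.inv_eq_right_inv hmul]
  have h1 : ∑ a, ∑ b, poisson f (c a) x * (ε • P⁻¹) b a * poisson (g b) h x =
      ε * ∑ a, poisson f (k a) x * poisson (g a) h x := by
    rw [Finset.sum_comm, Finset.mul_sum]
    refine Finset.sum_congr rfl fun b _ => ?_
    calc ∑ a, poisson f (c a) x * (ε • P⁻¹) b a * poisson (g b) h x
        = ∑ d, ε * (∑ a, P⁻¹ b a * P a d) * poisson f (k d) x * poisson (g b) h x := by
          simp only [hfc, Matrix.smul_apply, smul_eq_mul, Finset.sum_mul, Finset.mul_sum]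
          rw [Finset.sum_comm]
          refine Finset.sum_congr rfl fun _ _ => ?_
          refine Finset.sum_congr rfl fun _ _ => ?_
          ring
      _ = ε * (poisson f (k b) x * poisson (g b) h x) := by
          simp only [hinv]
          simp [mul_assoc]
  have h2 : ∑ a, ∑ b, poisson f (g a) x * (ε • P⁻¹) a b * poisson (c b) h x =
      ε * ∑ a, poisson f (g a) x * poisson (k a) h x := by
    rw [Finset.mul_sum]
    refine Finset.sum_congr rfl fun b _ => ?_
    calc ∑ a, poisson f (g b) x * (ε • P⁻¹) b a * poisson (c a) h x
        = ∑ d, ε * (∑ a, P⁻¹ b a * P a d) * poisson f (g b) x * poisson (k d) h x := by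
          simp only [hcf, Matrix.smul_apply, smul_eq_mul, Finset.sum_mul, Finset.mul_sum]
          rw [Finset.sum_comm]
          refine Finset.sum_congr rfl fun _ _ => ?_
          refine Finset.sum_congr rfl fun _ _ => ?_
          ring
      _ = ε * (poisson f (g b) x * poisson (k b) h x) := by
          simp only [hinv]
          simp [mul_assoc]
  rw [h1, h2]

/-- Fixing `χ` by `σ` and fixing `σ` by `χ` yield the same reduced theory: the definition of the
Dirac bracket is symmetric in the two sets, and `η` commutes with both. -/
theorem haveCommonReduction {U : Set (Phase ι)} {χ σ : A → Phase ι → ℝ} {η : I → Phase ι → ℝ}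
    (hχ : IsGaugeTheory U χ) (hσ : IsGaugeTheory U σ) (hχη : IsGaugeTheory U (Sum.elim χ η))
    (hση : IsGaugeTheory U (Sum.elim σ η))
    (hχσ : ∀ x ∈ surface U (Sum.elim χ σ), IsUnit (bracketMatrix χ σ x)) :
    HaveCommonReduction U χ η σ σ η χ := by
  have hcc : ∀ x ∈ surface U (Sum.elim χ σ), bracketMatrix χ χ x = 0 := fun x hx => by
    ext a b
    exact hχ.firstClass x ⟨hx.1, (mem_surface_elim.1 hx).2.1⟩ a b
  have hgg : ∀ x ∈ surface U (Sum.elim χ σ), bracketMatrix σ σ x = 0 := fun x hx => by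
    ext a b
    exact hσ.firstClass x ⟨hx.1, (mem_surface_elim.1 hx).2.2⟩ a b
  have hD : ∀ x ∈ surface U (Sum.elim (Sum.elim χ σ) η),
      ∀ i j, diracBracket (Sum.elim χ σ) (η i) (η j) x = 0 := fun x hx i j => by
    obtain ⟨hxU, h1, h3⟩ := mem_surface_elim.1 hx
    have hxs : x ∈ surface U (Sum.elim χ σ) := ⟨hxU, h1⟩
    obtain ⟨-, h1, h2⟩ := mem_surface_elim.1 hxs
    have hc := hχη.firstClass x (mem_surface_elim.2 ⟨hxU, h1, h3⟩)
    have hs := hση.firstClass x (mem_surface_elim.2 ⟨hxU, h2, h3⟩)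
    rw [diracBracket_elim (hcc x hxs) (hgg x hxs) (hχσ x hxs)]
    have e1 : ∀ a, poisson (η i) (χ a) x = 0 := fun a => hc (Sum.inr i) (Sum.inl a)
    have e2 : ∀ a, poisson (η i) (σ a) x = 0 := fun a => hs (Sum.inr i) (Sum.inl a)
    have e3 : poisson (η i) (η j) x = 0 := hc (Sum.inr i) (Sum.inr j)
    simp [e1, e2, e3]
  have hsurf : surface U (Sum.elim (Sum.elim χ σ) η) = surface U (Sum.elim (Sum.elim σ χ) η) := by
    ext x
    simp only [surface, Sum.forall, Sum.elim_inl, Sum.elim_inr, mem_ofPred_eq]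
    tauto
  refine ⟨?_, fun x hx => ⟨?_, ?_⟩, fun f h _ _ x hx => ?_, hsurf, fun x hx => ⟨hD x hx, ?_⟩⟩
  · ext x
    simp only [surface, Sum.forall, Sum.elim_inl, Sum.elim_inr, mem_ofPred_eq]
    tauto
  · exact isUnit_bracketMatrix_elim (hcc x hx) (hgg x hx) (hχσ x hx)
  · exact isUnit_bracketMatrix_elim (hgg x hx) (hcc x hx) (isUnit_bracketMatrix_comm (hχσ x hx))
  · exact diracBracket_elim_swap (hcc x hx) (hgg x hx) (hχσ x hx) f h
  · intro i j
    have hxs : x ∈ surface U (Sum.elim χ σ) := ⟨hx.1, fun a => hx.2 (Sum.inl a)⟩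
    rw [← diracBracket_elim_swap (hcc x hxs) (hgg x hxs) (hχσ x hxs)]
    exact hD x hx i j

end Dirac

/-! ### Invariance of regular zero sets -/

section Tangency

variable {E : Type*} [NormedAddCommGroup E] [NormedSpace ℝ E]

/-- A function that vanishes on the regular zero set `{f = 0}` is locally bounded by a multiple of
`‖f‖`: the distance of `x` to the zero set is at most a multiple of `‖f x‖`. -/
lemma exists_norm_le_mul_norm [CompleteSpace E] {F G : Type*} [NormedAddCommGroup F]
    [NormedSpace ℝ F] [CompleteSpace F] [NormedAddCommGroup G] [NormedSpace ℝ G] {f : E → F}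
    {f' : E →L[ℝ] F} {h : E → G} {h' : E →L[ℝ] G} {p : E} (hf : HasStrictFDerivAt f f' p)
    (hsurj : f'.range = ⊤) (hp : f p = 0) (hh : HasStrictFDerivAt h h' p) {V : Set E}
    (hV : V ∈ 𝓝 p) (h0 : ∀ x ∈ V, f x = 0 → h x = 0) :
    ∃ C, ∀ᶠ x in 𝓝 p, ‖h x‖ ≤ C * ‖f x‖ := by
  obtain ⟨R, hR⟩ := f'.exists_nonlinearRightInverse_of_surjective hsurj
  have hK : (0 : ℝ) < R.nnnorm := hR
  obtain ⟨s, hs, hfs⟩ := hf.approximates_deriv_on_nhds (c := R.nnnorm⁻¹ / 2)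
    (Or.inr (by positivity))
  obtain ⟨K', s', hs', hhs⟩ := hh.exists_lipschitzOnWith
  obtain ⟨r, hr, hrs⟩ := Metric.mem_nhds_iff.1 (Filter.inter_mem (Filter.inter_mem hs hs') hV)
  have hsmall : ∀ᶠ x in 𝓝 p, 2 * R.nnnorm * ‖f x‖ < r / 2 := by
    have h1 : ContinuousAt (fun x => 2 * R.nnnorm * ‖f x‖) p :=
      continuousAt_const.mul hf.continuousAt.norm
    refine h1.eventually_lt continuousAt_const ?_
    rw [hp, norm_zero, mul_zero]
    positivity
  refine ⟨K' * (2 * R.nnnorm), ?_⟩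
  filter_upwards [Metric.ball_mem_nhds p (half_pos hr), hsmall] with x hx hfx
  -- `f` maps the ball of radius `ε` about `x` onto a neighbourhood of `f x` that contains `0`.
  set ε := 2 * R.nnnorm * ‖f x‖ with hε
  have hεr : Metric.closedBall x ε ⊆ Metric.ball p r := fun y hy => by
    rw [Metric.mem_ball] at hx ⊢
    rw [Metric.mem_closedBall] at hy
    linarith [dist_triangle y x p]
  obtain ⟨y, hy, hfy⟩ := hfs.surjOn_closedBall_of_nonlinearRightInverse R (b := x) (ε := ε)
    (by positivity) (fun y hy => (hrs (hεr hy)).1.1) (show (0 : F) ∈ _ by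
      rw [Metric.mem_closedBall, dist_zero_left, hε]
      refine le_of_eq ?_
      push_cast
      field_simp
      ring)
  have hhy := h0 y (hrs (hεr hy)).2 hfy
  have hxs : x ∈ s' := (hrs (hεr (Metric.mem_closedBall_self (by positivity)))).1.2
  have h1 := hhs.dist_le_mul x hxs y (hrs (hεr hy)).1.2
  rw [hhy, dist_zero_right] at h1
  rw [Metric.mem_closedBall, dist_comm] at hy
  calc ‖h x‖ ≤ K' * dist x y := h1
    _ ≤ K' * ε := by gcongr
    _ = K' * (2 * R.nnnorm) * ‖f x‖ := by rw [hε]; ring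

/-- Independent linear forms take all values: a functional that vanishes on the range is a linear
relation between them. -/
lemma range_pi_eq_top {B : Type*} [Fintype B] {α : B → E →L[ℝ] ℝ} (hα : LinearIndependent ℝ α) :
    (ContinuousLinearMap.pi α).range = ⊤ := by
  classical
  by_contra hne
  obtain ⟨φ, hφ0, hφ⟩ := Submodule.exists_le_ker_of_lt_top _ (lt_top_iff_ne_top.2 hne)
  have hφs : ∀ v, φ v = ∑ b, φ (Pi.single b 1) * v b := fun v => by
    conv_lhs => rw [pi_eq_sum_univ' v]
    simp [map_sum, mul_comm, Pi.single]
  have h1 : ∑ b, φ (Pi.single b 1) • α b = 0 := by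
    refine ContinuousLinearMap.ext fun v => ?_
    have h2 : φ (ContinuousLinearMap.pi α v) = 0 := hφ ⟨v, rfl⟩
    rw [hφs] at h2
    simpa [sum_apply, smul_apply] using h2
  have h3 := Fintype.linearIndependent_iff.1 hα _ h1
  exact hφ0 (LinearMap.ext fun v => by rw [hφs]; simp [h3])

/-- A vector field that is tangent to the regular zero set `{f = 0}` preserves it: along an integral
curve, `|d f / dt|` is locally bounded by a multiple of `|f|`. -/
lemma eq_zero_of_tangent [CompleteSpace E] {B : Type*} [Fintype B] {U : Set E} (hU : IsOpen U)
    {f : B → E → ℝ} (hf : ∀ b, ContDiffOn ℝ ∞ (f b) U)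
    (hreg : ∀ x ∈ U, (∀ b, f b x = 0) → LinearIndependent ℝ fun b => fderiv ℝ (f b) x)
    {Y : E → E} (hY : ContDiffOn ℝ ∞ Y U)
    (htan : ∀ x ∈ U, (∀ b, f b x = 0) → ∀ b, fderiv ℝ (f b) x (Y x) = 0) {γ : ℝ → E}
    (hγ : ∀ t ∈ Icc (0 : ℝ) 1, γ t ∈ U ∧ HasDerivWithinAt γ (Y (γ t)) (Icc 0 1) t)
    (h0 : ∀ b, f b (γ 0) = 0) {t : ℝ} (ht : t ∈ Icc (0 : ℝ) 1) (b : B) : f b (γ t) = 0 := by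
  let F : E → B → ℝ := fun x b => f b x
  have hF : ContDiffOn ℝ ∞ F U := contDiffOn_pi.2 hf
  have hFs : ∀ x ∈ U, HasStrictFDerivAt F (ContinuousLinearMap.pi fun b => fderiv ℝ (f b) x) x :=
    fun x hx => by
      refine hasStrictFDerivAt_pi.2 fun b => ?_
      exact ((hf b).contDiffAt (hU.mem_nhds hx)).hasStrictFDerivAt (by simp)
  let h : E → B → ℝ := fun x b => fderiv ℝ (f b) x (Y x)
  have hh : ContDiffOn ℝ ∞ h U := contDiffOn_pi.2 fun b =>
    ((hf b).fderiv_of_isOpen hU (by simp)).clm_apply hY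
  have hγc : ContinuousOn γ (Icc 0 1) := fun t ht => (hγ t ht).2.continuousWithinAt
  have hFγ : ContinuousOn (fun t => F (γ t)) (Icc 0 1) :=
    hF.continuousOn.comp hγc fun t ht => (hγ t ht).1
  have hder : ∀ t ∈ Icc (0 : ℝ) 1, HasDerivWithinAt (fun t => F (γ t)) (h (γ t)) (Icc 0 1) t :=
    fun t ht => (hFs _ (hγ t ht).1).hasFDerivAt.comp_hasDerivWithinAt t (hγ t ht).2
  have hclosed : IsClosed ({t | F (γ t) = 0} ∩ Icc 0 1) := by
    rw [inter_comm]
    exact hFγ.preimage_isClosed_of_isClosed isClosed_Icc isClosed_singleton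
  -- The set of times with `f = 0` is closed and, by the inequality of Gronwall, open to the right.
  have hsub : Icc (0 : ℝ) 1 ⊆ {t | F (γ t) = 0} := by
    refine hclosed.Icc_subset_of_forall_mem_nhdsWithin (funext h0) fun t ht => ?_
    obtain ⟨ht0, ht1⟩ := ht
    have htI : t ∈ Icc (0 : ℝ) 1 := ⟨ht1.1, ht1.2.le⟩
    have htU := (hγ t htI).1
    obtain ⟨C, hC⟩ := exists_norm_le_mul_norm (hFs _ htU)
      (range_pi_eq_top (hreg _ htU fun b => congrFun ht0 b)) ht0
      ((hh.contDiffAt (hU.mem_nhds htU)).hasStrictFDerivAt (by simp)) (hU.mem_nhds htU)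
      fun x hx hx0 => funext (htan x hx fun b => congrFun hx0 b)
    have hev : ∀ᶠ τ in 𝓝[Icc 0 1] t, ‖h (γ τ)‖ ≤ C * ‖F (γ τ)‖ := (hγc t htI).eventually hC
    obtain ⟨δ, hδ, hδs⟩ := Metric.mem_nhdsWithin_iff.1 hev
    let b' := min (t + δ / 2) 1
    have htb : t < b' := lt_min (by linarith) ht1.2
    have hbI : ∀ τ ∈ Icc t b', τ ∈ Icc (0 : ℝ) 1 := fun τ hτ =>
      ⟨ht1.1.trans hτ.1, hτ.2.trans (min_le_right _ _)⟩
    have hzero := eq_zero_of_abs_deriv_le_mul_abs_self_of_eq_zero_right (a := t) (b := b')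
      (f := fun t => F (γ t)) (K := C) (hFγ.mono hbI)
      (fun τ hτ => (hder τ (hbI τ ⟨hτ.1, hτ.2.le⟩)).mono_of_mem_nhdsWithin
        (Icc_mem_nhdsGE_of_mem ⟨(hbI τ ⟨hτ.1, hτ.2.le⟩).1, hτ.2.trans_le (min_le_right _ _)⟩))
      ht0 (fun τ hτ => hδs ⟨by
        rw [Metric.mem_ball, Real.dist_eq, abs_of_nonneg (by linarith [hτ.1])]
        linarith [hτ.2.le.trans (min_le_left (t + δ / 2) 1)], hbI τ ⟨hτ.1, hτ.2.le⟩⟩)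
    exact Filter.mem_of_superset (Ioc_mem_nhdsGT htb) fun τ hτ => hzero τ ⟨hτ.1.le, hτ.2⟩
  exact congrFun (hsub ht) b

/-- The flow line traversed backwards. -/
lemma IsFlowLine.reverse {B : Type*} [Fintype B] {X : B → E → E} {U : Set E} {s : B → ℝ}
    {γ : ℝ → E} (hγ : IsFlowLine X U s γ) : IsFlowLine X U (-s) (fun t => γ (1 - t)) := by
  intro t ht
  have ht' : 1 - t ∈ Icc (0 : ℝ) 1 := ⟨by linarith [ht.2], by linarith [ht.1]⟩
  refine ⟨(hγ _ ht').1, ?_⟩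
  have h1 : HasDerivWithinAt (fun t : ℝ => 1 - t) (-1) (Icc 0 1) t :=
    (hasDerivWithinAt_id t _).const_sub 1
  have h2 := (hγ _ ht').2.scomp t h1 fun τ hτ => ⟨by linarith [hτ.2], by linarith [hτ.1]⟩
  refine h2.congr_deriv ?_
  rw [fieldSum_neg, neg_one_smul]

end Tangency

/-! ### Gauge orbits -/

section Orbits

variable {ι A : Type*} [Fintype ι] [DecidableEq ι] [Fintype A] [DecidableEq A]

/-- The generators of the constraints `c` are on `S` a recombination of fields `hamVec k`. If the
flow of the latter leads every point of `S` inside `S` to `g = 0` and preserves a quantity `z` that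
separates the points of `S` with `g = 0`, then every gauge orbit has exactly one point with
`g = 0`. -/
lemma existsUnique_mem_gaugeOrbit {S : Set (Phase ι)} {c k g : A → Phase ι → ℝ}
    {P Q : Phase ι → Matrix A A ℝ}
    (hc : ∀ x ∈ S, ∀ a, hamVec (c a) x = ∑ b, P x a b • hamVec (k b) x)
    (hQP : ∀ x ∈ S, Q x * P x = 1) (hQ : ∀ a b, ContinuousOn (fun x => Q x a b) S)
    {F : Type*} [NormedAddCommGroup F] [NormedSpace ℝ F] {z : Phase ι → F}
    (hz : ∀ x ∈ S, DifferentiableAt ℝ z x)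
    (hzk : ∀ x ∈ S, ∀ a, fderiv ℝ z x (hamVec (k a) x) = 0)
    (hinj : ∀ y ∈ S, ∀ y' ∈ S, (∀ a, g a y = 0) → (∀ a, g a y' = 0) → z y = z y' → y = y')
    (hline : ∀ x ∈ S, ∃ (r : A → ℝ) (γ : ℝ → Phase ι), γ 0 = x ∧
      IsFlowLine (fun a => hamVec (k a)) S r γ ∧ ∀ a, g a (γ 1) = 0)
    {x : Phase ι} (hx : x ∈ S) : ∃! y, y ∈ gaugeOrbit S c x ∧ ∀ a, g a y = 0 := by
  have hstep : ∀ {x y}, GaugeStep S c x y → x ∈ S ∧ y ∈ S ∧ z x = z y := by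
    rintro x y ⟨γ, l, -, rfl, rfl, hγ⟩
    refine ⟨(hγ 0 (by simp)).1, (hγ 1 (by simp)).1, ?_⟩
    have h1 := eq_add_smul_of_hasDerivWithinAt (k := fun t => z (γ t)) (c := 0) (fun t ht => by
      have h2 := (hz _ (hγ t ht).1).hasFDerivAt.comp_hasDerivWithinAt t (hγ t ht).2
      refine h2.congr_deriv ?_
      simp [hc _ (hγ t ht).1, hzk _ (hγ t ht).1]) (t := 1) (by simp)
    simpa using h1.symm
  have horb : ∀ {x y}, Relation.EqvGen (GaugeStep S c) x y → (x ∈ S ↔ y ∈ S) ∧ z x = z y := by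
    intro x y h
    induction h with
    | rel x y h => exact ⟨iff_of_true (hstep h).1 (hstep h).2.1, (hstep h).2.2⟩
    | refl x => exact ⟨Iff.rfl, rfl⟩
    | symm x y _ ih => exact ⟨ih.1.symm, ih.2.symm⟩
    | trans x y w _ _ ih1 ih2 => exact ⟨ih1.1.trans ih2.1, ih1.2.trans ih2.2⟩
  obtain ⟨r, γ, rfl, hγ, hg⟩ := hline x hx
  -- The speeds `r` with respect to the fields `hamVec k` are the multipliers `r Q` with respect to
  -- the generators of `c`.
  have hmem : GaugeStep S c (γ 0) (γ 1) := by
    refine ⟨γ, fun t a => ∑ b, r b * Q (γ t) b a, ?_, rfl, rfl,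
      fun t ht => ⟨(hγ t ht).1, (hγ t ht).2.congr_deriv ?_⟩⟩
    · refine continuousOn_pi.2 fun a => continuousOn_finsetSum _ fun b _ => ?_
      exact continuousOn_const.mul ((hQ b a).comp hγ.continuousOn fun t ht => (hγ t ht).1)
    · have hQP' : ∀ b d, ∑ a, Q (γ t) b a * P (γ t) a d = if b = d then 1 else 0 := fun b d => by
        rw [← Matrix.mul_apply, hQP _ (hγ t ht).1, Matrix.one_apply]
      symm
      calc ∑ a, (∑ b, r b * Q (γ t) b a) • hamVec (c a) (γ t)
          = ∑ b, ∑ a, (r b * Q (γ t) b a) • hamVec (c a) (γ t) := by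
            simp only [Finset.sum_smul]
            exact Finset.sum_comm
        _ = ∑ b, ∑ d, (r b * ∑ a, Q (γ t) b a * P (γ t) a d) • hamVec (k d) (γ t) := by
            refine Finset.sum_congr rfl fun b _ => ?_
            simp only [hc _ (hγ t ht).1, Finset.smul_sum, Finset.sum_smul, Finset.mul_sum,
              smul_smul, mul_assoc]
            exact Finset.sum_comm
        _ = fieldSum (fun a => hamVec (k a)) r (γ t) := by
            simp [hQP', fieldSum, ite_smul, mul_ite]
  refine ⟨γ 1, ⟨Relation.EqvGen.rel _ _ hmem, hg⟩, ?_⟩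
  rintro y ⟨hy, hgy⟩
  have h1 := horb (Relation.EqvGen.rel _ _ hmem)
  have h2 := horb hy
  exact hinj y (h2.1.1 hx) _ (h1.1.1 hx) hgy hg (h2.2.symm.trans h1.2)

end Orbits

/-! ### Smoothness of the inverse matrix -/

section MatrixInverse

variable {E : Type*} [NormedAddCommGroup E] [NormedSpace ℝ E] {B : Type*} [Fintype B]
  [DecidableEq B] {M : E → Matrix B B ℝ} {U : Set E}

lemma contDiffOn_det (hM : ∀ a b, ContDiffOn ℝ ∞ (fun x => M x a b) U) :
    ContDiffOn ℝ ∞ (fun x => (M x).det) U := by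
  simp only [Matrix.det_apply]
  exact ContDiffOn.sum fun τ _ => (contDiffOn_prod fun a _ => hM _ _).const_smul _

lemma contDiffOn_matrix_inv (hM : ∀ a b, ContDiffOn ℝ ∞ (fun x => M x a b) U)
    (hu : ∀ x ∈ U, IsUnit (M x)) (a b : B) : ContDiffOn ℝ ∞ (fun x => (M x)⁻¹ a b) U := by
  have h1 : ∀ x, (M x)⁻¹ a b = (M x).det⁻¹ * ((M x).updateRow b (Pi.single a 1)).det := fun x => by
    rw [Matrix.inv_def, Matrix.smul_apply, Matrix.adjugate_apply, Ring.inverse_eq_inv', smul_eq_mul]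
  simp only [h1]
  refine ((contDiffOn_det hM).inv fun x hx => ?_).mul (contDiffOn_det fun d e => ?_)
  · exact ((Matrix.isUnit_iff_isUnit_det _).1 (hu x hx)).ne_zero
  · simp only [Matrix.updateRow_apply]
    split_ifs
    exacts [contDiffOn_const, hM d e]

end MatrixInverse

/-! ### Gauge fixing in a Darboux box -/

section AdaptedBox

variable {ι A I : Type*} [Fintype ι] [DecidableEq ι] [Fintype A] [DecidableEq A]

/-- A Darboux box `U` with canonical coordinates `(c, s)` of which `χ = P c` and `σ = Q s` are
smooth invertible recombinations, for the gauge theories `(U, χ, η)` and `(U, σ, η)`. -/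
structure IsAdaptedBox (U : Set (Phase ι)) (χ σ : A → Phase ι → ℝ) (η : I → Phase ι → ℝ)
    (c s : A → Phase ι → ℝ) (P Q : Phase ι → Matrix A A ℝ) (z : Phase ι → Phase ι) : Prop where
  box : IsDarbouxBox U c s z
  theory_chi : IsGaugeTheory U χ
  theory_sigma : IsGaugeTheory U σ
  theory_chi_eta : IsGaugeTheory U (Sum.elim χ η)
  theory_sigma_eta : IsGaugeTheory U (Sum.elim σ η)
  smooth_P : ∀ a b, ContDiffOn ℝ ∞ (fun x => P x a b) U
  smooth_Q : ∀ a b, ContDiffOn ℝ ∞ (fun x => Q x a b) U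
  unit_P : ∀ x ∈ U, IsUnit (P x)
  unit_Q : ∀ x ∈ U, IsUnit (Q x)
  chi_eq : ∀ x ∈ U, ∀ a, χ a x = ∑ b, P x a b * c b x
  sigma_eq : ∀ x ∈ U, ∀ a, σ a x = ∑ b, Q x a b * s b x

variable {U : Set (Phase ι)} {χ σ : A → Phase ι → ℝ} {η : I → Phase ι → ℝ}
  {c s : A → Phase ι → ℝ} {P Q : Phase ι → Matrix A A ℝ} {z : Phase ι → Phase ι}

namespace IsAdaptedBox

/-- The roles of `χ` and `σ` can be exchanged: `{s, -c} = δ`. -/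
lemma symm (h : IsAdaptedBox U χ σ η c s P Q z) :
    IsAdaptedBox U σ χ η s (fun a x => -c a x) Q (fun x => -P x) z where
  box := h.box.symm
  theory_chi := h.theory_sigma
  theory_sigma := h.theory_chi
  theory_chi_eta := h.theory_sigma_eta
  theory_sigma_eta := h.theory_chi_eta
  smooth_P := h.smooth_Q
  smooth_Q a b := (h.smooth_P a b).neg
  unit_P := h.unit_Q
  unit_Q x hx := (h.unit_P x hx).neg
  chi_eq := h.sigma_eq
  sigma_eq x hx a := by simp [h.chi_eq x hx a]

lemma inv_mul_P (h : IsAdaptedBox U χ σ η c s P Q z) {x : Phase ι} (hx : x ∈ U) :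
    (P x)⁻¹ * P x = 1 :=
  Matrix.nonsing_inv_mul _ ((Matrix.isUnit_iff_isUnit_det _).1 (h.unit_P x hx))

lemma c_eq (h : IsAdaptedBox U χ σ η c s P Q z) {x : Phase ι} (hx : x ∈ U) (a : A) :
    c a x = ∑ b, (P x)⁻¹ a b * χ b x := by
  have h1 : (fun a => χ a x) = (P x).mulVec fun a => c a x := funext fun a => h.chi_eq x hx a
  have h2 : (P x)⁻¹.mulVec (fun a => χ a x) = fun a => c a x := by
    rw [h1, Matrix.mulVec_mulVec, h.inv_mul_P hx, Matrix.one_mulVec]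
  exact (congrFun h2 a).symm

lemma c_eq_zero_iff (h : IsAdaptedBox U χ σ η c s P Q z) {x : Phase ι} (hx : x ∈ U) :
    (∀ a, c a x = 0) ↔ ∀ a, χ a x = 0 :=
  ⟨fun h0 a => by simp [h.chi_eq x hx, h0], fun h0 a => by simp [h.c_eq hx, h0]⟩

lemma s_eq_zero_iff (h : IsAdaptedBox U χ σ η c s P Q z) {x : Phase ι} (hx : x ∈ U) :
    (∀ a, s a x = 0) ↔ ∀ a, σ a x = 0 :=
  h.symm.c_eq_zero_iff hx

lemma fderiv_chi (h : IsAdaptedBox U χ σ η c s P Q z) {x : Phase ι} (hx : x ∈ U)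
    (h0 : ∀ a, c a x = 0) (a : A) : fderiv ℝ (χ a) x = ∑ b, P x a b • fderiv ℝ (c b) x :=
  fderiv_recombination h.box.isOpen h.box.smooth_c (h.smooth_P a)
    (fun x hx => h.chi_eq x hx a) hx h0

lemma fderiv_c (h : IsAdaptedBox U χ σ η c s P Q z) {x : Phase ι} (hx : x ∈ U)
    (h0 : ∀ a, c a x = 0) (a : A) : fderiv ℝ (c a) x = ∑ b, (P x)⁻¹ a b • fderiv ℝ (χ b) x :=
  fderiv_recombination h.box.isOpen h.theory_chi.smooth
    (contDiffOn_matrix_inv h.smooth_P h.unit_P a) (fun _ hx => h.c_eq hx a) hx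
    ((h.c_eq_zero_iff hx).1 h0)

lemma isUnit_bracketMatrix (h : IsAdaptedBox U χ σ η c s P Q z) {x : Phase ι} (hx : x ∈ U)
    (hc : ∀ a, c a x = 0) (hs : ∀ a, s a x = 0) : IsUnit (bracketMatrix χ σ x) := by
  have h1 : bracketMatrix c s x = 1 := by
    ext a b
    rw [Matrix.one_apply]
    exact h.box.bracket_cs x hx a b
  rw [bracketMatrix_recombination (h.fderiv_chi hx hc) (h.symm.fderiv_chi hx hs), h1,
    Matrix.mul_one]
  exact (h.unit_P x hx).mul ((Matrix.isUnit_transpose _).2 (h.unit_Q x hx))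

/-- The flow lines of `c` that start on `χ = η = 0` stay there. -/
lemma flowLine_mem_surface [Finite I] (h : IsAdaptedBox U χ σ η c s P Q z) {r : A → ℝ}
    {γ : ℝ → Phase ι} (hγ : IsFlowLine (fun a => hamVec (c a)) U r γ)
    (h0 : γ 0 ∈ surface U (Sum.elim χ η)) {t : ℝ} (ht : t ∈ Icc (0 : ℝ) 1) :
    γ t ∈ surface U (Sum.elim χ η) := by
  have := Fintype.ofFinite I
  refine ⟨(hγ t ht).1, fun b => ?_⟩
  have hT := h.theory_chi_eta
  refine eq_zero_of_tangent hT.isOpen hT.smooth (fun x hx hx0 => hT.regular x ⟨hx, hx0⟩)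
    (Y := fieldSum (fun a => hamVec (c a)) r) ?_ (fun x hx hx0 b => ?_) hγ h0.2 ht b
  · exact ContDiffOn.sum fun a _ =>
      (contDiffOn_hamVec h.box.isOpen (h.box.smooth_c a)).const_smul (r a)
  · have hc := (h.c_eq_zero_iff hx).2 fun a => hx0 (Sum.inl a)
    have h1 : ∀ d, poisson (χ d) (Sum.elim χ η b) x = 0 := fun d =>
      hT.firstClass x ⟨hx, hx0⟩ (Sum.inl d) b
    have h2 : ∀ a : A, fderiv ℝ (Sum.elim χ η b) x (hamVec (c a) x) = 0 := fun a => by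
      rw [hamVec_of_fderiv_eq (h.fderiv_c hx hc a)]
      simp only [map_sum, map_smul, fderiv_hamVec, h1, smul_zero, Finset.sum_const_zero]
    simp only [fieldSum, map_sum, map_smul, h2, smul_zero, Finset.sum_const_zero]

/-- The flow line of `c` from a point of `χ = 0` to `s = 0` leads to the projection of the point. -/
lemma exists_flowLine (h : IsAdaptedBox U χ σ η c s P Q z) {x : Phase ι} (hx : x ∈ U)
    (hc : ∀ a, c a x = 0) : ∃ γ : ℝ → Phase ι, γ 0 = x ∧ γ 1 = z x ∧
      IsFlowLine (fun a => hamVec (c a)) U (fun a => -s a x) γ := by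
  obtain ⟨γ, rfl, hγ⟩ := h.box.line_c x hx
  have h1 : (1 : ℝ) ∈ Icc (0 : ℝ) 1 := by simp
  have hz := hγ.apply_eq (differentiableAt_of_contDiffOn h.box.isOpen h.box.smooth_z)
    (c := 0) h.box.fderiv_z_hamVec_c h1
  have hc' := fun a => hγ.apply_eq (differentiableAt_of_contDiffOn h.box.isOpen (h.box.smooth_c a))
    (c := 0) (fun x hx b => by rw [fderiv_hamVec]; exact h.box.bracket_cc x hx b a) h1
  have hs' := fun a => hγ.apply_eq (differentiableAt_of_contDiffOn h.box.isOpen (h.box.smooth_s a))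
    (c := fun b => if b = a then 1 else 0)
    (fun x hx b => by rw [fderiv_hamVec]; exact h.box.bracket_cs x hx b a) h1
  refine ⟨γ, rfl, ?_, hγ⟩
  refine h.box.injOn _ (hγ 1 h1).1 _ (h.box.z_mem _ hx) (fun a => ?_) (fun a => ?_) ?_
  · rw [hc', h.box.c_z _ hx]
    simp [hc]
  · rw [hs', h.box.s_z _ hx]
    simp
  · rw [hz, h.box.z_eq_self _ (h.box.z_mem _ hx) (h.box.c_z _ hx) (h.box.s_z _ hx)]
    simp

/-- On `χ = 0` the functions `η` and `η ∘ z` have the same zeros. -/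
lemma eta_z_eq_zero_iff [Finite I] (h : IsAdaptedBox U χ σ η c s P Q z) {x : Phase ι} (hx : x ∈ U)
    (hc : ∀ a, c a x = 0) : (∀ i, η i (z x) = 0) ↔ ∀ i, η i x = 0 := by
  obtain ⟨γ, h0, h1, hγ⟩ := h.exists_flowLine hx hc
  constructor
  · intro hη
    have h2 := h.flowLine_mem_surface hγ.reverse (t := 1) (by
      simp only [sub_zero, h1]
      exact mem_surface_elim.2 ⟨h.box.z_mem x hx,
        (h.c_eq_zero_iff (h.box.z_mem x hx)).1 (h.box.c_z x hx), hη⟩) (by simp)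
    simp only [sub_self, h0] at h2
    exact (mem_surface_elim.1 h2).2.2
  · intro hη
    have h2 := h.flowLine_mem_surface hγ (t := 1) (by
      rw [h0]
      exact mem_surface_elim.2 ⟨hx, (h.c_eq_zero_iff hx).1 hc, hη⟩) (by simp)
    rw [h1] at h2
    exact (mem_surface_elim.1 h2).2.2

/-- In an adapted box `σ = 0` gauge-fixes `χ`: the flow of `c` leads to `s = 0` inside `χ = η = 0`,
and the projection `z` is the invariant that identifies the orbit. -/
theorem isPartialGaugeFixing [Finite I] (h : IsAdaptedBox U χ σ η c s P Q z) :
    IsPartialGaugeFixing U χ η σ where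
  orbit x hx := by
    have hS : ∀ y ∈ surface U (Sum.elim χ η), y ∈ U ∧ ∀ a, c a y = 0 := fun y hy =>
      ⟨hy.1, (h.c_eq_zero_iff hy.1).2 (mem_surface_elim.1 hy).2.1⟩
    refine existsUnique_mem_gaugeOrbit (k := c) (P := P) (Q := fun x => (P x)⁻¹) (z := z)
      (fun x hx a => ?_) (fun x hx => h.inv_mul_P hx.1) (fun a b => ?_) (fun x hx => ?_)
      (fun x hx a => h.box.fderiv_z_hamVec_c x hx.1 a) (fun y hy y' hy' hg hg' hyz => ?_)
      (fun y hy => ?_) hx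
    · exact hamVec_of_fderiv_eq (h.fderiv_chi hx.1 (hS x hx).2 a)
    · exact (contDiffOn_matrix_inv h.smooth_P h.unit_P a b).continuousOn.mono fun x hx => hx.1
    · exact (hasFDerivAt_of_contDiffOn h.box.isOpen h.box.smooth_z hx.1).differentiableAt
    · refine h.box.injOn y hy.1 y' hy'.1 (fun a => ?_) (fun a => ?_) hyz
      · rw [(hS y hy).2, (hS y' hy').2]
      · rw [(h.s_eq_zero_iff hy.1).2 hg, (h.s_eq_zero_iff hy'.1).2 hg']
    · obtain ⟨γ, h0, h1, hγ⟩ := h.exists_flowLine hy.1 (hS y hy).2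
      refine ⟨_, γ, h0, fun t ht => ⟨?_, (hγ t ht).2⟩, ?_⟩
      · exact h.flowLine_mem_surface hγ (h0 ▸ hy) ht
      · rw [h1]
        exact (h.s_eq_zero_iff (h.box.z_mem y hy.1)).1 (h.box.s_z y hy.1)
  dirac x hx hg := h.isUnit_bracketMatrix hx.1
    ((h.c_eq_zero_iff hx.1).2 (mem_surface_elim.1 hx).2.1) ((h.s_eq_zero_iff hx.1).2 hg)

theorem equivalentVia [Finite I] (h : IsAdaptedBox U χ σ η c s P Q z) :
    EquivalentVia U χ η σ σ η χ where
  theory := h.theory_chi_eta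
  theory' := h.theory_sigma_eta
  fixing := h.isPartialGaugeFixing
  fixing' := h.symm.isPartialGaugeFixing
  reduction := haveCommonReduction h.theory_chi h.theory_sigma h.theory_chi_eta h.theory_sigma_eta
    fun _ hx => h.isUnit_bracketMatrix hx.1 ((h.c_eq_zero_iff hx.1).2 (mem_surface_elim.1 hx).2.1)
      ((h.s_eq_zero_iff hx.1).2 (mem_surface_elim.1 hx).2.2)

end IsAdaptedBox

/-- The points of `χ = σ = 0` have arbitrarily small adapted boxes. -/
theorem exists_adaptedBox {Γ : Set (Phase ι)} (hχ : IsGaugeTheory Γ χ) (hσ : IsGaugeTheory Γ σ)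
    (hχη : IsGaugeTheory Γ (Sum.elim χ η)) (hση : IsGaugeTheory Γ (Sum.elim σ η)) {x₀ : Phase ι}
    (hx₀ : x₀ ∈ surface Γ (Sum.elim χ σ)) (hunit : IsUnit (bracketMatrix χ σ x₀))
    {W : Set (Phase ι)} (hW : W ∈ 𝓝 x₀) :
    ∃ (U : Set (Phase ι)) (c s : A → Phase ι → ℝ) (P Q : Phase ι → Matrix A A ℝ)
      (z : Phase ι → Phase ι), x₀ ∈ U ∧ U ⊆ Γ ∩ W ∧ IsAdaptedBox U χ σ η c s P Q z := by
  obtain ⟨hxΓ, hχ0, hσ0⟩ := mem_surface_elim.1 hx₀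
  obtain ⟨c, s, P, Q, U₁, hU₁, hx₁, hU₁Γ, hc, hs, hP, hQ, hPu, hQu, hχc, hσs, hcc, hss, hcs⟩ :=
    exists_conjugate_abelianization hχ.isOpen hxΓ hχ hσ hχ0 hσ0 hunit
  have hinv : ∀ {M : Matrix A A ℝ} {v : A → ℝ}, IsUnit M → M.mulVec v = 0 → v = 0 :=
    fun hM hv => (Matrix.mulVec_injective_iff_isUnit.2 hM) (by rw [hv, Matrix.mulVec_zero])
  have hc0 : ∀ a, c a x₀ = 0 := congrFun <| hinv (hPu x₀ hx₁) <| funext fun a =>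
    (hχc x₀ hx₁ a).symm.trans (hχ0 a)
  have hs0 : ∀ a, s a x₀ = 0 := congrFun <| hinv (hQu x₀ hx₁) <| funext fun a =>
    (hσs x₀ hx₁ a).symm.trans (hσ0 a)
  obtain ⟨W', hW'W, hW', hxW'⟩ := mem_nhds_iff.1 hW
  have hsub : U₁ ∩ W' ⊆ U₁ := inter_subset_left
  obtain ⟨z, U, hxU, hUU, hbox⟩ := exists_darbouxBox (hU₁.inter hW') ⟨hx₁, hxW'⟩
    (fun a => (hc a).mono hsub) (fun a => (hs a).mono hsub) (fun x hx => hcc x hx.1)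
    (fun x hx => hss x hx.1) (fun x hx => hcs x hx.1) hc0 hs0
  have hU₁' : ∀ x ∈ U, x ∈ U₁ := fun x hx => (hUU hx).1
  have hΓ : U ⊆ Γ := fun x hx => hU₁Γ (hU₁' x hx)
  refine ⟨U, c, s, P, Q, z, hxU, fun x hx => ⟨hΓ hx, hW'W (hUU hx).2⟩, ?_⟩
  exact
    { box := hbox
      theory_chi := hχ.mono hbox.isOpen hΓ
      theory_sigma := hσ.mono hbox.isOpen hΓ
      theory_chi_eta := hχη.mono hbox.isOpen hΓ
      theory_sigma_eta := hση.mono hbox.isOpen hΓ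
      smooth_P := fun a b => (hP a b).mono hU₁'
      smooth_Q := fun a b => (hQ a b).mono hU₁'
      unit_P := fun x hx => hPu x (hU₁' x hx)
      unit_Q := fun x hx => hQu x (hU₁' x hx)
      chi_eq := fun x hx => hχc x (hU₁' x hx)
      sigma_eq := fun x hx => hσs x (hU₁' x hx) }

end AdaptedBox

/-! ### Functions that are invariant under the canonical coordinates -/

section Invariants

variable {ι A I : Type*} [Fintype ι] [DecidableEq ι] [Fintype A] [DecidableEq A]
  {U : Set (Phase ι)} {c s : A → Phase ι → ℝ} {z : Phase ι → Phase ι}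

namespace IsDarbouxBox

/-- A function that commutes with `c` and `s` has the same value at `x` and at `z x`, because a flow
line of `c` followed by one of `s` joins these points. -/
lemma apply_z (h : IsDarbouxBox U c s z) {k : Phase ι → ℝ} (hk : ContDiffOn ℝ ∞ k U)
    (hck : ∀ x ∈ U, ∀ a, poisson (c a) k x = 0) (hsk : ∀ x ∈ U, ∀ a, poisson (s a) k x = 0)
    {x : Phase ι} (hx : x ∈ U) : k (z x) = k x := by
  have h1 : (1 : ℝ) ∈ Icc (0 : ℝ) 1 := by simp
  have hd := fun {f : Phase ι → ℝ} (hf : ContDiffOn ℝ ∞ f U) =>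
    differentiableAt_of_contDiffOn h.isOpen hf
  have hdz := differentiableAt_of_contDiffOn h.isOpen h.smooth_z
  obtain ⟨γ, rfl, hγ⟩ := h.line_c x hx
  obtain ⟨δ, hδ0, hδ⟩ := h.line_s (γ 1) (hγ 1 h1).1
  have ek := hγ.apply_eq (hd hk) (c := 0)
    (fun x hx a => (fderiv_hamVec _ _ _).trans (hck x hx a)) h1
  have ez := hγ.apply_eq hdz (c := 0) h.fderiv_z_hamVec_c h1
  have es := fun a => hγ.apply_eq (hd (h.smooth_s a)) (c := fun b => if b = a then 1 else 0)
    (fun x hx b => by rw [fderiv_hamVec]; exact h.bracket_cs x hx b a) h1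
  have ek' := hδ.apply_eq (hd hk) (c := 0)
    (fun x hx a => (fderiv_hamVec _ _ _).trans (hsk x hx a)) h1
  have ez' := hδ.apply_eq hdz (c := 0) h.fderiv_z_hamVec_s h1
  have es' := fun a => hδ.apply_eq (hd (h.smooth_s a)) (c := 0) (fun x hx b => by
    rw [fderiv_hamVec]; exact h.bracket_ss x hx b a) h1
  have ec' := fun a => hδ.apply_eq (hd (h.smooth_c a)) (c := fun b => -if a = b then 1 else 0)
    (fun x hx b => by rw [fderiv_hamVec, poisson_comm, h.bracket_cs x hx a b]) h1
  -- The flow line `γ` of `c` ends on `s = 0`, and `δ`, a flow line of `s`, ends on `c = s = 0`.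
  have hend : z (δ 1) = δ 1 := h.z_eq_self _ (hδ 1 h1).1 (fun a => by rw [ec', hδ0]; simp)
    (fun a => by rw [es', hδ0, es]; simp)
  have hz : δ 1 = z (γ 0) := by
    rw [← hend, ez', hδ0, ez]
    simp
  rw [← hz, ek', hδ0, ek]
  simp

/-- The bracket of two functions that commute with `c` and `s` has the same value at `x` and at
`z x`. -/
lemma poisson_z (h : IsDarbouxBox U c s z) {k l : Phase ι → ℝ} (hk : ContDiffOn ℝ ∞ k U)
    (hck : ∀ x ∈ U, ∀ a, poisson (c a) k x = 0) (hsk : ∀ x ∈ U, ∀ a, poisson (s a) k x = 0)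
    (hl : ContDiffOn ℝ ∞ l U) (hcl : ∀ x ∈ U, ∀ a, poisson (c a) l x = 0)
    (hsl : ∀ x ∈ U, ∀ a, poisson (s a) l x = 0) {x : Phase ι} (hx : x ∈ U) :
    poisson k l (z x) = poisson k l x :=
  h.apply_z (contDiffOn_poisson h.isOpen hk hl)
    (fun x hx a => by
      rw [← fderiv_hamVec]
      exact fderiv_poisson_hamVec h.isOpen hk hl (h.smooth_c a) (fun x hx => hck x hx a)
        (fun x hx => hcl x hx a) hx)
    (fun x hx a => by
      rw [← fderiv_hamVec]
      exact fderiv_poisson_hamVec h.isOpen hk hl (h.smooth_s a) (fun x hx => hsk x hx a)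
        (fun x hx => hsl x hx a) hx) hx

section Comp

variable {F : Type*} [NormedAddCommGroup F] [NormedSpace ℝ F]

lemma contDiffOn_comp_z (h : IsDarbouxBox U c s z) {f : Phase ι → F} (hf : ContDiffOn ℝ ∞ f U) :
    ContDiffOn ℝ ∞ (fun x => f (z x)) U :=
  hf.comp h.smooth_z h.z_mem

lemma fderiv_comp_z (h : IsDarbouxBox U c s z) {f : Phase ι → F} (hf : ContDiffOn ℝ ∞ f U)
    {x : Phase ι} (hx : x ∈ U) :
    fderiv ℝ (fun x => f (z x)) x = (fderiv ℝ f (z x)).comp (fderiv ℝ z x) :=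
  ((hasFDerivAt_of_contDiffOn h.isOpen hf (h.z_mem x hx)).comp x
    (hasFDerivAt_of_contDiffOn h.isOpen h.smooth_z hx)).fderiv

end Comp

lemma poisson_c_comp_z (h : IsDarbouxBox U c s z) {f : Phase ι → ℝ} (hf : ContDiffOn ℝ ∞ f U)
    {x : Phase ι} (hx : x ∈ U) (a : A) : poisson (c a) (fun x => f (z x)) x = 0 := by
  rw [← fderiv_hamVec, h.fderiv_comp_z hf hx, ContinuousLinearMap.comp_apply,
    h.fderiv_z_hamVec_c x hx, map_zero]

lemma poisson_s_comp_z (h : IsDarbouxBox U c s z) {f : Phase ι → ℝ} (hf : ContDiffOn ℝ ∞ f U)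
    {x : Phase ι} (hx : x ∈ U) (a : A) : poisson (s a) (fun x => f (z x)) x = 0 := by
  rw [← fderiv_hamVec, h.fderiv_comp_z hf hx, ContinuousLinearMap.comp_apply,
    h.fderiv_z_hamVec_s x hx, map_zero]

/-- A critical point `x` of a function `k` that commutes with `c` and `s` yields the critical point
`z x`: the brackets of `k` with the functions `α ∘ z`, for linear `α`, are the same at both points,
and at `z x` they are the components of the Hamiltonian vector field of `k`. -/
lemma fderiv_z_eq_zero (h : IsDarbouxBox U c s z) {k : Phase ι → ℝ} (hk : ContDiffOn ℝ ∞ k U)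
    (hck : ∀ x ∈ U, ∀ a, poisson (c a) k x = 0) (hsk : ∀ x ∈ U, ∀ a, poisson (s a) k x = 0)
    {x : Phase ι} (hx : x ∈ U) (h0 : fderiv ℝ k x = 0) : fderiv ℝ k (z x) = 0 := by
  have hy := h.z_mem x hx
  have hX : hamVec k (z x) = 0 := by
    refine SeparatingDual.eq_zero_of_forall_dual_eq_zero (R := ℝ) fun α => ?_
    have hα : ContDiffOn ℝ ∞ α U := α.contDiff.contDiffOn
    have h1 := h.poisson_z hk hck hsk (h.contDiffOn_comp_z hα)
      (fun x hx => h.poisson_c_comp_z hα hx) (fun x hx => h.poisson_s_comp_z hα hx) hx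
    rw [poisson_eq_sharp k _ x, h0, map_zero, map_zero, ← fderiv_hamVec, h.fderiv_comp_z hα hy,
      ContinuousLinearMap.comp_apply, h.fderiv_z _ hy (h.c_z x hx) (h.s_z x hx)] at h1
    simp only [fderiv_hamVec] at h1
    rw [α.fderiv] at h1
    have h2 : ∀ a, poisson k (c a) (z x) = 0 := fun a => by
      rw [poisson_comm, hck _ hy, neg_zero]
    have h3 : ∀ a, poisson k (s a) (z x) = 0 := fun a => by
      rw [poisson_comm, hsk _ hy, neg_zero]
    simpa [h2, h3] using h1
  refine ContinuousLinearMap.ext fun v => ?_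
  rw [covector_apply, zero_apply]
  refine Finset.sum_eq_zero fun i _ => ?_
  rw [hamVec_eq_sharp] at hX
  rw [← sharp_snd, ← neg_neg (fderiv ℝ k (z x) (0, Pi.single i 1)), ← sharp_fst, hX]
  simp

end IsDarbouxBox

namespace IsAdaptedBox

variable {χ σ : A → Phase ι → ℝ} {η : I → Phase ι → ℝ} {P Q : Phase ι → Matrix A A ℝ}

lemma smooth_eta (h : IsAdaptedBox U χ σ η c s P Q z) (i : I) : ContDiffOn ℝ ∞ (η i) U :=
  h.theory_chi_eta.smooth (Sum.inr i)

/-- Where `χ = η = 0`, the brackets `{c, η}` vanish. -/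
lemma poisson_c_eta (h : IsAdaptedBox U χ σ η c s P Q z) {x : Phase ι} (hx : x ∈ U)
    (hc : ∀ a, c a x = 0) (hη : ∀ i, η i x = 0) (a : A) (i : I) : poisson (c a) (η i) x = 0 := by
  have h1 : ∀ b, poisson (χ b) (η i) x = 0 := fun b =>
    h.theory_chi_eta.firstClass x (mem_surface_elim.2 ⟨hx, (h.c_eq_zero_iff hx).1 hc, hη⟩)
      (Sum.inl b) (Sum.inr i)
  rw [← fderiv_hamVec, hamVec_of_fderiv_eq (h.fderiv_c hx hc a)]
  simp [fderiv_hamVec, h1]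

/-- On `χ = σ = η = 0` the differentials of `η ∘ z` and of `η` agree, since `η` commutes there with
`c` and `s`. -/
lemma fderiv_eta_z (h : IsAdaptedBox U χ σ η c s P Q z) {x : Phase ι} (hx : x ∈ U)
    (hc : ∀ a, c a x = 0) (hs : ∀ a, s a x = 0) (hη : ∀ i, η i x = 0) (i : I) :
    fderiv ℝ (fun x => η i (z x)) x = fderiv ℝ (η i) x := by
  refine ContinuousLinearMap.ext fun v => ?_
  rw [h.box.fderiv_comp_z (h.smooth_eta i) hx, ContinuousLinearMap.comp_apply,
    h.box.z_eq_self x hx hc hs, h.box.fderiv_z x hx hc hs]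
  simp only [map_add, map_sub, map_sum, map_smul, fderiv_hamVec, h.poisson_c_eta hx hc hη,
    h.symm.poisson_c_eta hx hs hη]
  simp

/-- The functions `η ∘ z` are first class, because `η` is so at the projected point. -/
lemma poisson_eta_z (h : IsAdaptedBox U χ σ η c s P Q z) {x : Phase ι} (hx : x ∈ U)
    (hη : ∀ i, η i (z x) = 0) (i j : I) :
    poisson (fun x => η i (z x)) (fun x => η j (z x)) x = 0 := by
  have hk := fun i => h.box.contDiffOn_comp_z (h.smooth_eta i)
  have hck : ∀ i, ∀ x ∈ U, ∀ a, poisson (c a) (fun x => η i (z x)) x = 0 := fun i x hx =>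
    h.box.poisson_c_comp_z (h.smooth_eta i) hx
  have hsk : ∀ i, ∀ x ∈ U, ∀ a, poisson (s a) (fun x => η i (z x)) x = 0 := fun i x hx =>
    h.box.poisson_s_comp_z (h.smooth_eta i) hx
  have hy := h.box.z_mem x hx
  have hc := h.box.c_z x hx
  have hs := h.box.s_z x hx
  rw [← h.box.poisson_z (hk i) (hck i) (hsk i) (hk j) (hck j) (hsk j) hx, poisson_eq_sharp,
    h.fderiv_eta_z hy hc hs hη, h.fderiv_eta_z hy hc hs hη, ← poisson_eq_sharp]
  exact h.theory_chi_eta.firstClass _ (mem_surface_elim.2 ⟨hy, (h.c_eq_zero_iff hy).1 hc, hη⟩)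
    (Sum.inr i) (Sum.inr j)

/-- A relation between the differentials of `η ∘ z` at `x` would be one between those of `η`
at `z x`. -/
lemma linearIndependent_fderiv_eta_z [Finite I] (h : IsAdaptedBox U χ σ η c s P Q z) {x : Phase ι}
    (hx : x ∈ U) (hη : ∀ i, η i (z x) = 0) :
    LinearIndependent ℝ fun i => fderiv ℝ (fun x => η i (z x)) x := by
  have := Fintype.ofFinite I
  have hk := fun i => h.box.contDiffOn_comp_z (h.smooth_eta i)
  have hck : ∀ i, ∀ x ∈ U, ∀ a, poisson (c a) (fun x => η i (z x)) x = 0 := fun i x hx =>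
    h.box.poisson_c_comp_z (h.smooth_eta i) hx
  have hsk : ∀ i, ∀ x ∈ U, ∀ a, poisson (s a) (fun x => η i (z x)) x = 0 := fun i x hx =>
    h.box.poisson_s_comp_z (h.smooth_eta i) hx
  have hy := h.box.z_mem x hx
  have hc := h.box.c_z x hx
  have hs := h.box.s_z x hx
  have hreg := h.theory_chi_eta.regular _
    (mem_surface_elim.2 ⟨hy, (h.c_eq_zero_iff hy).1 hc, hη⟩)
  have hreg' := Fintype.linearIndependent_iff.1 (hreg.comp _ Sum.inr_injective)
  refine Fintype.linearIndependent_iff.2 fun g hg => hreg' g ?_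
  let k : Phase ι → ℝ := fun x => ∑ i, g i * η i (z x)
  have hkd : ∀ x ∈ U, fderiv ℝ k x = ∑ i, g i • fderiv ℝ (fun x => η i (z x)) x := fun x hx => by
    refine HasFDerivAt.fderiv (HasFDerivAt.fun_sum fun i _ => ?_)
    exact (hasFDerivAt_of_contDiffOn h.box.isOpen (hk i) hx).const_mul (g i)
  have hkill : ∀ f, (∀ i, ∀ x ∈ U, poisson f (fun x => η i (z x)) x = 0) →
      ∀ x ∈ U, poisson f k x = 0 := fun f hf x hx => by
    rw [← fderiv_hamVec, hkd x hx]
    simp [sum_apply, smul_apply, fderiv_hamVec, hf _ x hx]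
  have h1 := h.box.fderiv_z_eq_zero (k := k)
    (ContDiffOn.sum fun i _ => contDiffOn_const.mul (hk i))
    (fun x hx a => hkill (c a) (fun i x hx => hck i x hx a) x hx)
    (fun x hx a => hkill (s a) (fun i x hx => hsk i x hx a) x hx) hx (by rw [hkd x hx, hg])
  rw [hkd _ hy] at h1
  rw [← h1]
  exact Finset.sum_congr rfl fun i _ => by
    rw [h.fderiv_eta_z hy hc hs hη]; rfl

end IsAdaptedBox

end Invariants

/-! ### The extended phase space -/

section Extended

variable {ι A : Type*}

/-- The projection `base` as a continuous linear map. -/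
noncomputable def baseL (ι A : Type*) :
    Phase (ι ⊕ A) →L[ℝ] Phase ι :=
  (ContinuousLinearMap.pi fun i => (ContinuousLinearMap.proj (Sum.inl i)).comp
    (ContinuousLinearMap.fst ℝ (ι ⊕ A → ℝ) (ι ⊕ A → ℝ))).prod
  (ContinuousLinearMap.pi fun i => (ContinuousLinearMap.proj (Sum.inl i)).comp
    (ContinuousLinearMap.snd ℝ (ι ⊕ A → ℝ) (ι ⊕ A → ℝ)))

/-- The coordinate `φ_a` as a continuous linear form. -/
noncomputable def phiL (ι : Type*) (a : A) : Phase (ι ⊕ A) →L[ℝ] ℝ :=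
  (ContinuousLinearMap.proj (Sum.inr a)).comp
    (ContinuousLinearMap.fst ℝ (ι ⊕ A → ℝ) (ι ⊕ A → ℝ))

/-- The coordinate `π^a` as a continuous linear form. -/
noncomputable def piL (ι : Type*) (a : A) : Phase (ι ⊕ A) →L[ℝ] ℝ :=
  (ContinuousLinearMap.proj (Sum.inr a)).comp
    (ContinuousLinearMap.snd ℝ (ι ⊕ A → ℝ) (ι ⊕ A → ℝ))

/-- The function `φ_a - c_a` on the extended phase space. -/
def phiSub (c : A → Phase ι → ℝ) (a : A) (w : Phase (ι ⊕ A)) : ℝ := phiCoord a w - c a (base w)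

/-- The function `π^a + s_a` on the extended phase space. -/
def piAdd (s : A → Phase ι → ℝ) (a : A) (w : Phase (ι ⊕ A)) : ℝ := piCoord a w + s a (base w)

lemma baseL_apply (w : Phase (ι ⊕ A)) : baseL ι A w = base w := rfl

lemma phiL_apply (a : A) (w : Phase (ι ⊕ A)) : phiL ι a w = phiCoord a w := rfl

lemma piL_apply (a : A) (w : Phase (ι ⊕ A)) : piL ι a w = piCoord a w := rfl

@[simp] lemma base_lift (x : Phase ι) (φ π : A → ℝ) : base (lift x φ π) = x := rfl

@[simp] lemma phiCoord_lift (x : Phase ι) (φ π : A → ℝ) (a : A) :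
    phiCoord a (lift x φ π) = φ a := rfl

@[simp] lemma piCoord_lift (x : Phase ι) (φ π : A → ℝ) (a : A) :
    piCoord a (lift x φ π) = π a := rfl

lemma lift_base (w : Phase (ι ⊕ A)) :
    lift (base w) (fun a => phiCoord a w) (fun a => piCoord a w) = w := by
  ext (i | a) <;> rfl

lemma ext_extended {w w' : Phase (ι ⊕ A)} (h1 : base w = base w')
    (h2 : ∀ a, phiCoord a w = phiCoord a w') (h3 : ∀ a, piCoord a w = piCoord a w') : w = w' := by
  rw [← lift_base w, ← lift_base w', h1, funext h2, funext h3]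

lemma fderiv_phiCoord (a : A) (w : Phase (ι ⊕ A)) : fderiv ℝ (phiCoord a) w = phiL ι a :=
  (phiL ι a).fderiv

lemma fderiv_piCoord (a : A) (w : Phase (ι ⊕ A)) : fderiv ℝ (piCoord a) w = piL ι a :=
  (piL ι a).fderiv

/-- The isomorphism `lift` as a continuous linear map. -/
noncomputable def liftL (ι A : Type*) [Fintype ι] [Fintype A] :
    Phase ι × (A → ℝ) × (A → ℝ) →L[ℝ] Phase (ι ⊕ A) :=
  LinearMap.toContinuousLinearMap
    { toFun := fun v => lift v.1 v.2.1 v.2.2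
      map_add' := fun v w => by ext (i | a) <;> rfl
      map_smul' := fun r v => by ext (i | a) <;> rfl }

variable [Fintype ι] [Fintype A]

lemma liftL_apply (v : Phase ι × (A → ℝ) × (A → ℝ)) : liftL ι A v = lift v.1 v.2.1 v.2.2 := rfl

lemma contDiff_phiCoord (a : A) : ContDiff ℝ ∞ (phiCoord a : Phase (ι ⊕ A) → ℝ) :=
  (phiL ι a).contDiff

lemma contDiff_piCoord (a : A) : ContDiff ℝ ∞ (piCoord a : Phase (ι ⊕ A) → ℝ) :=
  (piL ι a).contDiff

lemma hasFDerivAt_comp_base {F : Type*} [NormedAddCommGroup F] [NormedSpace ℝ F] {U : Set (Phase ι)}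
    (hU : IsOpen U) {f : Phase ι → F} (hf : ContDiffOn ℝ ∞ f U) {w : Phase (ι ⊕ A)}
    (hw : base w ∈ U) :
    HasFDerivAt (fun w => f (base w)) ((fderiv ℝ f (base w)).comp (baseL ι A)) w :=
  HasFDerivAt.comp w (hasFDerivAt_of_contDiffOn hU hf hw) (baseL ι A).hasFDerivAt

lemma contDiffOn_comp_base {F : Type*} [NormedAddCommGroup F] [NormedSpace ℝ F] {U : Set (Phase ι)}
    {f : Phase ι → F} (hf : ContDiffOn ℝ ∞ f U) :
    ContDiffOn ℝ ∞ (fun w : Phase (ι ⊕ A) => f (base w)) (base ⁻¹' U) :=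
  hf.comp (baseL ι A).contDiff.contDiffOn fun _ hw => hw

omit [Fintype ι] [Fintype A] in
lemma isOpen_preimage_base {U : Set (Phase ι)} (hU : IsOpen U) :
    IsOpen (base ⁻¹' U : Set (Phase (ι ⊕ A))) :=
  hU.preimage (baseL ι A).continuous

section Pair

variable {U : Set (Phase ι)} {c s : A → Phase ι → ℝ} {w : Phase (ι ⊕ A)}

lemma contDiffOn_phiSub (hc : ∀ a, ContDiffOn ℝ ∞ (c a) U) (a : A) :
    ContDiffOn ℝ ∞ (phiSub c a) (base ⁻¹' U) :=
  (contDiff_phiCoord a).contDiffOn.sub (contDiffOn_comp_base (hc a))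

lemma contDiffOn_piAdd (hs : ∀ a, ContDiffOn ℝ ∞ (s a) U) (a : A) :
    ContDiffOn ℝ ∞ (piAdd s a) (base ⁻¹' U) :=
  (contDiff_piCoord a).contDiffOn.add (contDiffOn_comp_base (hs a))

lemma fderiv_phiSub (hU : IsOpen U) (hc : ∀ a, ContDiffOn ℝ ∞ (c a) U) (hw : base w ∈ U) (a : A) :
    fderiv ℝ (phiSub c a) w = phiL ι a - (fderiv ℝ (c a) (base w)).comp (baseL ι A) :=
  ((phiL ι a).hasFDerivAt.sub (hasFDerivAt_comp_base hU (hc a) hw)).fderiv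

lemma fderiv_piAdd (hU : IsOpen U) (hs : ∀ a, ContDiffOn ℝ ∞ (s a) U) (hw : base w ∈ U) (a : A) :
    fderiv ℝ (piAdd s a) w = piL ι a + (fderiv ℝ (s a) (base w)).comp (baseL ι A) :=
  ((piL ι a).hasFDerivAt.add (hasFDerivAt_comp_base hU (hs a) hw)).fderiv

end Pair

variable [DecidableEq A]

/-- The three components of a covector on the extended phase space. -/
lemma covector_lift (F : Phase (ι ⊕ A) →L[ℝ] ℝ) (v : Phase ι) (φ π : A → ℝ) :
    F (lift v φ π) = F (lift v 0 0) + ∑ a, φ a * F (lift 0 (Pi.single a 1) 0) +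
      ∑ a, π a * F (lift 0 0 (Pi.single a 1)) := by
  have h1 : lift v φ π = lift v 0 0 + ∑ a, φ a • lift (0 : Phase ι) (Pi.single a 1) (0 : A → ℝ) +
      ∑ a, π a • lift (0 : Phase ι) (0 : A → ℝ) (Pi.single a 1) := by
    have h2 : (v, φ, π) = ((v, 0, 0) : Phase ι × (A → ℝ) × (A → ℝ)) +
        ∑ a, φ a • ((0, Pi.single a 1, 0) : Phase ι × (A → ℝ) × (A → ℝ)) +
        ∑ a, π a • ((0, 0, Pi.single a 1) : Phase ι × (A → ℝ) × (A → ℝ)) := by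
      refine Prod.ext ?_ (Prod.ext ?_ ?_)
      · simp [Prod.fst_sum]
      · funext d
        simp [Prod.fst_sum, Prod.snd_sum, Finset.sum_apply, Pi.single_apply]
      · funext d
        simp [Prod.snd_sum, Finset.sum_apply, Pi.single_apply]
    have h3 := congrArg (liftL ι A) h2
    simpa only [map_add, map_sum, map_smul, liftL_apply] using h3
  rw [h1]
  simp only [map_add, map_sum, map_smul, smul_eq_mul]

variable [DecidableEq ι]

lemma sharp_extended (F : Phase (ι ⊕ A) →L[ℝ] ℝ) :
    sharp F = lift (sharp (F.comp ((liftL ι A).comp (ContinuousLinearMap.inl ℝ _ _))))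
      (fun a => -F (lift 0 0 (Pi.single a 1))) (fun a => F (lift 0 (Pi.single a 1) 0)) := by
  have e1 : ∀ i : ι, ((0, Pi.single (Sum.inl i) 1) : Phase (ι ⊕ A)) =
      lift (0, Pi.single i 1) 0 0 := fun i => by
    ext (j | a) <;> simp [lift, Pi.single_apply]
  have e2 : ∀ i : ι, ((Pi.single (Sum.inl i) 1, 0) : Phase (ι ⊕ A)) =
      lift (Pi.single i 1, 0) 0 0 := fun i => by
    ext (j | a) <;> simp [lift, Pi.single_apply]
  have e3 : ∀ a : A, ((0, Pi.single (Sum.inr a) 1) : Phase (ι ⊕ A)) =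
      lift 0 0 (Pi.single a 1) := fun a => by
    ext (j | a) <;> simp [lift, Pi.single_apply]
  have e4 : ∀ a : A, ((Pi.single (Sum.inr a) 1, 0) : Phase (ι ⊕ A)) =
      lift 0 (Pi.single a 1) 0 := fun a => by
    ext (j | a) <;> simp [lift, Pi.single_apply]
  refine Prod.ext (funext ?_) (funext ?_)
  · rintro (i | a)
    · rw [sharp_fst, e1]; rfl
    · rw [sharp_fst, e3]; rfl
  · rintro (i | a)
    · rw [sharp_snd, e2]; rfl
    · rw [sharp_snd, e4]; rfl

lemma hamVec_phiCoord (a : A) (w : Phase (ι ⊕ A)) :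
    hamVec (phiCoord a) w = lift 0 0 (Pi.single a 1) := by
  rw [hamVec_eq_sharp, fderiv_phiCoord, sharp_extended]
  have h1 : (phiL ι a).comp ((liftL ι A).comp (ContinuousLinearMap.inl ℝ _ _)) = 0 := rfl
  rw [h1, map_zero]
  congr 1
  · funext b; simp [phiL_apply]
  · funext b; simp [phiL_apply, Pi.single_apply, eq_comm]

lemma hamVec_piCoord (a : A) (w : Phase (ι ⊕ A)) :
    hamVec (piCoord a) w = lift 0 (-Pi.single a 1) 0 := by
  rw [hamVec_eq_sharp, fderiv_piCoord, sharp_extended]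
  have h1 : (piL ι a).comp ((liftL ι A).comp (ContinuousLinearMap.inl ℝ _ _)) = 0 := rfl
  rw [h1, map_zero]
  congr 1
  funext b; simp [piL_apply, Pi.single_apply, eq_comm]

lemma hamVec_comp_base {U : Set (Phase ι)} (hU : IsOpen U) {f : Phase ι → ℝ}
    (hf : ContDiffOn ℝ ∞ f U) {w : Phase (ι ⊕ A)} (hw : base w ∈ U) :
    hamVec (fun w => f (base w)) w = lift (hamVec f (base w)) 0 0 := by
  rw [hamVec_eq_sharp, (hasFDerivAt_comp_base hU hf hw).fderiv, sharp_extended, hamVec_eq_sharp]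
  have h1 : (baseL ι A).comp ((liftL ι A).comp (ContinuousLinearMap.inl ℝ _ _)) =
      ContinuousLinearMap.id ℝ _ := rfl
  rw [ContinuousLinearMap.comp_assoc, h1, ContinuousLinearMap.comp_id]
  congr 1
  · funext b
    simp only [ContinuousLinearMap.comp_apply, baseL_apply, base_lift, map_zero, neg_zero]; rfl
  · funext b
    simp only [ContinuousLinearMap.comp_apply, baseL_apply, base_lift, map_zero]; rfl

section Pair

variable {U : Set (Phase ι)} {c s : A → Phase ι → ℝ} {w : Phase (ι ⊕ A)}

lemma hamVec_phiSub (hU : IsOpen U) (hc : ∀ a, ContDiffOn ℝ ∞ (c a) U) (hw : base w ∈ U) (a : A) :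
    hamVec (phiSub c a) w = lift (-hamVec (c a) (base w)) 0 (Pi.single a 1) := by
  rw [hamVec_eq_sharp, fderiv_phiSub hU hc hw, map_sub, ← fderiv_phiCoord a w, ← hamVec_eq_sharp,
    hamVec_phiCoord, ← (hasFDerivAt_comp_base hU (hc a) hw).fderiv, ← hamVec_eq_sharp,
    hamVec_comp_base hU (hc a) hw]
  have h1 := map_sub (liftL ι A) (0, 0, Pi.single a 1) (hamVec (c a) (base w), 0, 0)
  rw [liftL_apply, liftL_apply, liftL_apply] at h1
  simpa using h1.symm

lemma hamVec_piAdd (hU : IsOpen U) (hs : ∀ a, ContDiffOn ℝ ∞ (s a) U) (hw : base w ∈ U) (a : A) :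
    hamVec (piAdd s a) w = lift (hamVec (s a) (base w)) (-Pi.single a 1) 0 := by
  rw [hamVec_eq_sharp, fderiv_piAdd hU hs hw, map_add, ← fderiv_piCoord a w, ← hamVec_eq_sharp,
    hamVec_piCoord, ← (hasFDerivAt_comp_base hU (hs a) hw).fderiv, ← hamVec_eq_sharp,
    hamVec_comp_base hU (hs a) hw]
  have h1 := map_add (liftL ι A) (0, -Pi.single a 1, 0) (hamVec (s a) (base w), 0, 0)
  rw [liftL_apply, liftL_apply, liftL_apply] at h1
  simpa using h1.symm

/-- A flow line of `c` lifts to one of `φ - c`, with the opposite speeds. -/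
lemma isFlowLine_phiSub (hU : IsOpen U) (hc : ∀ a, ContDiffOn ℝ ∞ (c a) U) {r : A → ℝ}
    {γ : ℝ → Phase ι} (hγ : IsFlowLine (fun a => hamVec (c a)) U (fun a => -r a) γ)
    (φ π : A → ℝ) : IsFlowLine (fun a => hamVec (phiSub c a)) (base ⁻¹' U) r
      (fun t => lift (γ t) φ (π + t • r)) := by
  intro t ht
  have ht' : base (lift (γ t) φ (π + t • r)) ∈ U := (hγ t ht).1
  refine ⟨ht', ?_⟩
  have h1 : HasDerivWithinAt (fun t : ℝ => π + t • r) r (Icc 0 1) t :=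
    (((hasDerivWithinAt_id t _).smul_const r).const_add π).congr_deriv (one_smul _ _)
  have h2 := (liftL ι A).hasFDerivAt.comp_hasDerivWithinAt t
    ((hγ t ht).2.prodMk ((hasDerivWithinAt_const t (Icc (0 : ℝ) 1) φ).prodMk h1))
  refine h2.congr_deriv ?_
  simp only [fieldSum, hamVec_phiSub hU hc ht', base_lift]
  have h3 : (∑ a, -r a • hamVec (c a) (γ t), (0 : A → ℝ), r) =
      ∑ a, r a • ((-hamVec (c a) (γ t), 0, Pi.single a 1) : Phase ι × (A → ℝ) × (A → ℝ)) := by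
    refine Prod.ext ?_ (Prod.ext ?_ ?_)
    · simp [Prod.fst_sum]
    · simp [Prod.fst_sum, Prod.snd_sum]
    · funext d
      simp [Prod.snd_sum, Finset.sum_apply, Pi.single_apply]
  rw [h3]
  simp only [map_sum, map_smul, liftL_apply]

/-- A flow line of `s` lifts to one of `π + s`. -/
lemma isFlowLine_piAdd (hU : IsOpen U) (hs : ∀ a, ContDiffOn ℝ ∞ (s a) U) {r : A → ℝ}
    {γ : ℝ → Phase ι} (hγ : IsFlowLine (fun a => hamVec (s a)) U r γ)
    (φ π : A → ℝ) : IsFlowLine (fun a => hamVec (piAdd s a)) (base ⁻¹' U) r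
      (fun t => lift (γ t) (φ + t • -r) π) := by
  intro t ht
  have ht' : base (lift (γ t) (φ + t • -r) π) ∈ U := (hγ t ht).1
  refine ⟨ht', ?_⟩
  have h1 : HasDerivWithinAt (fun t : ℝ => φ + t • -r) (-r) (Icc 0 1) t :=
    (((hasDerivWithinAt_id t _).smul_const (-r)).const_add φ).congr_deriv (one_smul _ _)
  have h2 := (liftL ι A).hasFDerivAt.comp_hasDerivWithinAt t
    ((hγ t ht).2.prodMk (h1.prodMk (hasDerivWithinAt_const t (Icc (0 : ℝ) 1) π)))
  refine h2.congr_deriv ?_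
  simp only [fieldSum, hamVec_piAdd hU hs ht', base_lift]
  have h3 : (∑ a, r a • hamVec (s a) (γ t), -r, (0 : A → ℝ)) =
      ∑ a, r a • ((hamVec (s a) (γ t), -Pi.single a 1, 0) : Phase ι × (A → ℝ) × (A → ℝ)) := by
    refine Prod.ext ?_ (Prod.ext ?_ ?_)
    · simp [Prod.fst_sum]
    · funext d
      simp [Prod.fst_sum, Prod.snd_sum, Finset.sum_apply, Pi.single_apply]
    · simp [Prod.snd_sum]
  rw [h3]
  simp only [map_sum, map_smul, liftL_apply]

end Pair

end Extended

/-! ### The linking theory -/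

section Linking

variable {ι A I : Type*} [Fintype ι] [DecidableEq ι] [Fintype A] [DecidableEq A]
  {U : Set (Phase ι)} {c s : A → Phase ι → ℝ} {z : Phase ι → Phase ι} {χ σ : A → Phase ι → ℝ}
  {η : I → Phase ι → ℝ} {P Q : Phase ι → Matrix A A ℝ}

lemma forall_sum_mul_eq_zero_iff {M : Matrix A A ℝ} (hM : IsUnit M) {v : A → ℝ} :
    (∀ a, ∑ b, M a b * v b = 0) ↔ ∀ a, v a = 0 := by
  have h1 : (∀ a, ∑ b, M a b * v b = 0) ↔ M.mulVec v = 0 :=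
    ⟨fun h => funext h, fun h a => congrFun h a⟩
  rw [h1, (Matrix.mulVec_injective_iff_isUnit.2 hM).eq_iff' (Matrix.mulVec_zero M)]
  exact ⟨fun h => congrFun h, fun h => funext h⟩

namespace IsDarbouxBox

variable {w : Phase (ι ⊕ A)}

lemma fderiv_phiSub_lift (h : IsDarbouxBox U c s z) (hw : base w ∈ U) (b : A) (v : Phase ι)
    (φ π : A → ℝ) :
    fderiv ℝ (phiSub c b) w (lift v φ π) = φ b - fderiv ℝ (c b) (base w) v := by
  rw [fderiv_phiSub h.isOpen h.smooth_c hw]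
  simp [sub_apply, phiL_apply, baseL_apply]

lemma fderiv_piAdd_lift (h : IsDarbouxBox U c s z) (hw : base w ∈ U) (b : A) (v : Phase ι)
    (φ π : A → ℝ) :
    fderiv ℝ (piAdd s b) w (lift v φ π) = π b + fderiv ℝ (s b) (base w) v := by
  rw [fderiv_piAdd h.isOpen h.smooth_s hw]
  simp [add_apply, piL_apply, baseL_apply]

lemma poisson_phiSub (h : IsDarbouxBox U c s z) (hw : base w ∈ U) (a : A)
    (f : Phase (ι ⊕ A) → ℝ) : poisson (phiSub c a) f w =
      fderiv ℝ f w (lift (-hamVec (c a) (base w)) 0 (Pi.single a 1)) := by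
  rw [← fderiv_hamVec, hamVec_phiSub h.isOpen h.smooth_c hw]

lemma poisson_piAdd (h : IsDarbouxBox U c s z) (hw : base w ∈ U) (a : A)
    (f : Phase (ι ⊕ A) → ℝ) : poisson (piAdd s a) f w =
      fderiv ℝ f w (lift (hamVec (s a) (base w)) (-Pi.single a 1) 0) := by
  rw [← fderiv_hamVec, hamVec_piAdd h.isOpen h.smooth_s hw]

lemma poisson_phiSub_phiSub (h : IsDarbouxBox U c s z) (hw : base w ∈ U) (a b : A) :
    poisson (phiSub c a) (phiSub c b) w = 0 := by
  rw [h.poisson_phiSub hw, h.fderiv_phiSub_lift hw, map_neg, fderiv_hamVec, h.bracket_cc _ hw]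
  simp

lemma poisson_piAdd_piAdd (h : IsDarbouxBox U c s z) (hw : base w ∈ U) (a b : A) :
    poisson (piAdd s a) (piAdd s b) w = 0 := by
  rw [h.poisson_piAdd hw, h.fderiv_piAdd_lift hw, fderiv_hamVec, h.bracket_ss _ hw]
  simp

/-- The two brackets `{φ_a, π^b}` and `{c_a, s_b}` cancel. -/
lemma poisson_phiSub_piAdd (h : IsDarbouxBox U c s z) (hw : base w ∈ U) (a b : A) :
    poisson (phiSub c a) (piAdd s b) w = 0 := by
  rw [h.poisson_phiSub hw, h.fderiv_piAdd_lift hw, map_neg, fderiv_hamVec, h.bracket_cs _ hw]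
  simp [Pi.single_apply, eq_comm]

lemma poisson_phiSub_comp_z (h : IsDarbouxBox U c s z) (hw : base w ∈ U) (a : A)
    {f : Phase ι → ℝ} (hf : ContDiffOn ℝ ∞ f U) :
    poisson (phiSub c a) (fun w => f (z (base w))) w = 0 := by
  rw [h.poisson_phiSub hw, (hasFDerivAt_comp_base h.isOpen (h.contDiffOn_comp_z hf) hw).fderiv,
    ContinuousLinearMap.comp_apply, baseL_apply, base_lift, map_neg, fderiv_hamVec,
    h.poisson_c_comp_z hf hw, neg_zero]

lemma poisson_piAdd_comp_z (h : IsDarbouxBox U c s z) (hw : base w ∈ U) (a : A)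
    {f : Phase ι → ℝ} (hf : ContDiffOn ℝ ∞ f U) :
    poisson (piAdd s a) (fun w => f (z (base w))) w = 0 := by
  rw [h.poisson_piAdd hw, (hasFDerivAt_comp_base h.isOpen (h.contDiffOn_comp_z hf) hw).fderiv,
    ContinuousLinearMap.comp_apply, baseL_apply, base_lift, fderiv_hamVec,
    h.poisson_s_comp_z hf hw]

end IsDarbouxBox

namespace IsAdaptedBox

variable {w : Phase (ι ⊕ A)}

lemma linkChi_eq (h : IsAdaptedBox U χ σ η c s P Q z) (hw : base w ∈ U) (a : A) :
    linkChi (fun x => (P x)⁻¹) χ a w = ∑ b, P (base w) a b * phiSub c b w := by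
  rw [linkChi, Matrix.nonsing_inv_nonsing_inv _ ((Matrix.isUnit_iff_isUnit_det _).1
    (h.unit_P _ hw)), h.chi_eq _ hw]
  simp [phiSub, mul_sub]

lemma linkSigma_eq (h : IsAdaptedBox U χ σ η c s P Q z) (hw : base w ∈ U) (a : A) :
    linkSigma (fun x => (Q x)⁻¹) σ a w = ∑ b, Q (base w) a b * piAdd s b w := by
  rw [linkSigma, Matrix.nonsing_inv_nonsing_inv _ ((Matrix.isUnit_iff_isUnit_det _).1
    (h.unit_Q _ hw)), h.sigma_eq _ hw]
  simp [piAdd, mul_add, Finset.sum_add_distrib]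

lemma linkChi_eq_zero_iff (h : IsAdaptedBox U χ σ η c s P Q z) (hw : base w ∈ U) :
    (∀ a, linkChi (fun x => (P x)⁻¹) χ a w = 0) ↔ ∀ a, phiSub c a w = 0 := by
  simp only [h.linkChi_eq hw]
  exact forall_sum_mul_eq_zero_iff (h.unit_P _ hw)

lemma linkSigma_eq_zero_iff (h : IsAdaptedBox U χ σ η c s P Q z) (hw : base w ∈ U) :
    (∀ a, linkSigma (fun x => (Q x)⁻¹) σ a w = 0) ↔ ∀ a, piAdd s a w = 0 := by
  simp only [h.linkSigma_eq hw]
  exact forall_sum_mul_eq_zero_iff (h.unit_Q _ hw)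

lemma smooth_linkChi (h : IsAdaptedBox U χ σ η c s P Q z) (a : A) :
    ContDiffOn ℝ ∞ (linkChi (fun x => (P x)⁻¹) χ a) (base ⁻¹' U) :=
  (ContDiffOn.sum fun b _ => (contDiffOn_comp_base (h.smooth_P a b)).mul
    (contDiffOn_phiSub h.box.smooth_c b)).congr fun _ hw => h.linkChi_eq hw a

lemma smooth_linkSigma (h : IsAdaptedBox U χ σ η c s P Q z) (a : A) :
    ContDiffOn ℝ ∞ (linkSigma (fun x => (Q x)⁻¹) σ a) (base ⁻¹' U) :=
  (ContDiffOn.sum fun b _ => (contDiffOn_comp_base (h.smooth_Q a b)).mul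
    (contDiffOn_piAdd h.box.smooth_s b)).congr fun _ hw => h.linkSigma_eq hw a

lemma fderiv_linkChi (h : IsAdaptedBox U χ σ η c s P Q z) (hw : base w ∈ U)
    (h0 : ∀ a, phiSub c a w = 0) (a : A) : fderiv ℝ (linkChi (fun x => (P x)⁻¹) χ a) w =
      ∑ b, P (base w) a b • fderiv ℝ (phiSub c b) w :=
  fderiv_recombination (isOpen_preimage_base h.box.isOpen) (contDiffOn_phiSub h.box.smooth_c)
    (fun b => contDiffOn_comp_base (h.smooth_P a b)) (fun _ hw => h.linkChi_eq hw a) hw h0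

lemma fderiv_linkSigma (h : IsAdaptedBox U χ σ η c s P Q z) (hw : base w ∈ U)
    (h0 : ∀ a, piAdd s a w = 0) (a : A) : fderiv ℝ (linkSigma (fun x => (Q x)⁻¹) σ a) w =
      ∑ b, Q (base w) a b • fderiv ℝ (piAdd s b) w :=
  fderiv_recombination (isOpen_preimage_base h.box.isOpen) (contDiffOn_piAdd h.box.smooth_s)
    (fun b => contDiffOn_comp_base (h.smooth_Q a b)) (fun _ hw => h.linkSigma_eq hw a) hw h0

/-- `c` and `s` are the Abelian sets `M χ` and `N σ` for `M = P⁻¹` and `N = Q⁻¹`. -/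
theorem isConjugateAbelianization (h : IsAdaptedBox U χ σ η c s P Q z) :
    IsConjugateAbelianization U χ σ (fun x => (P x)⁻¹) (fun x => (Q x)⁻¹) := by
  have hc : ∀ x ∈ U, ∀ a, recombine (fun x => (P x)⁻¹) χ a =ᶠ[𝓝 x] c a := fun x hx a => by
    filter_upwards [h.box.isOpen.mem_nhds hx] with y hy using (h.c_eq hy a).symm
  have hs : ∀ x ∈ U, ∀ a, recombine (fun x => (Q x)⁻¹) σ a =ᶠ[𝓝 x] s a := fun x hx a => by
    filter_upwards [h.box.isOpen.mem_nhds hx] with y hy using (h.symm.c_eq hy a).symm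
  exact
    { smoothM := contDiffOn_matrix_inv h.smooth_P h.unit_P
      smoothN := contDiffOn_matrix_inv h.smooth_Q h.unit_Q
      unitM := fun x hx => (Matrix.isUnit_nonsing_inv_iff).2 (h.unit_P x hx)
      unitN := fun x hx => (Matrix.isUnit_nonsing_inv_iff).2 (h.unit_Q x hx)
      abelianChi := fun x hx a b => by
        rw [poisson_congr (hc x hx a) (hc x hx b), h.box.bracket_cc x hx]
      abelianSigma := fun x hx a b => by
        rw [poisson_congr (hs x hx a) (hs x hx b), h.box.bracket_ss x hx]
      conjugate := fun x hx a b => by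
        rw [poisson_congr (hc x hx a) (hs x hx b), h.box.bracket_cs x hx] }

/-- The linking constraints are regular: `φ` and `π` occur in `φ - c` and `π + s` only, and the
remaining differentials `dη'` are independent. -/
theorem isGaugeTheory_linking [Finite I] (h : IsAdaptedBox U χ σ η c s P Q z) :
    IsGaugeTheory (base ⁻¹' U : Set (Phase (ι ⊕ A)))
      (Sum.elim (Sum.elim (linkChi (fun x => (P x)⁻¹) χ) (linkSigma (fun x => (Q x)⁻¹) σ))
        (fun i => (fun x => η i (z x)) ∘ base)) := by
  have := Fintype.ofFinite I
  have hk := fun i => h.box.contDiffOn_comp_z (h.smooth_eta i)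
  have hdη : ∀ w : Phase (ι ⊕ A), base w ∈ U → ∀ i,
      fderiv ℝ ((fun x => η i (z x)) ∘ base : Phase (ι ⊕ A) → ℝ) w =
        (fderiv ℝ (fun x => η i (z x)) (base w)).comp (baseL ι A) := fun w hw i =>
    (hasFDerivAt_comp_base h.box.isOpen (hk i) hw).fderiv
  refine ⟨isOpen_preimage_base h.box.isOpen, ?_, fun w hw => ?_, fun w hw => ?_⟩
  · rintro ((a | a) | i)
    exacts [h.smooth_linkChi a, h.smooth_linkSigma a, contDiffOn_comp_base (hk i)]
  · have hwU : base w ∈ U := hw.1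
    have h1 := (h.linkChi_eq_zero_iff hwU).1 fun a => hw.2 (Sum.inl (Sum.inl a))
    have h2 := (h.linkSigma_eq_zero_iff hwU).1 fun a => hw.2 (Sum.inl (Sum.inr a))
    have h3 : ∀ i, η i (z (base w)) = 0 := fun i => hw.2 (Sum.inr i)
    refine Fintype.linearIndependent_iff.2 fun g hg => ?_
    -- The relation is evaluated on the directions `φ`, `π` and `(q, p)` separately.
    have hg' : ∀ (v : Phase ι) (φ π : A → ℝ), ∑ a, g (Sum.inl (Sum.inl a)) *
          ∑ b, P (base w) a b * (φ b - fderiv ℝ (c b) (base w) v) +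
        ∑ a, g (Sum.inl (Sum.inr a)) *
          ∑ b, Q (base w) a b * (π b + fderiv ℝ (s b) (base w) v) +
        ∑ i, g (Sum.inr i) * fderiv ℝ (fun x => η i (z x)) (base w) v = 0 := fun v φ π => by
      have h4 := congrArg (fun F => F (lift v φ π)) hg
      simpa only [Fintype.sum_sum_type, Sum.elim_inl, Sum.elim_inr, h.fderiv_linkChi hwU h1,
        h.fderiv_linkSigma hwU h2, hdη w hwU, add_apply, sum_apply, smul_apply, smul_eq_mul,
        h.box.fderiv_phiSub_lift hwU, h.box.fderiv_piAdd_lift hwU, zero_apply,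
        ContinuousLinearMap.comp_apply, baseL_apply, base_lift] using h4
    have hA : ∀ (M : Matrix A A ℝ) (l : A → ℝ), IsUnit M →
        (∀ d, ∑ a, l a * ∑ b, M a b * (Pi.single d (1 : ℝ) : A → ℝ) b = 0) → ∀ a, l a = 0 := by
      intro M l hM hl
      refine (forall_sum_mul_eq_zero_iff ((Matrix.isUnit_transpose M).2 hM)).1 fun d => ?_
      rw [← hl d]
      refine Finset.sum_congr rfl fun a _ => ?_
      simp [Pi.single_apply, mul_comm]
    have e1 := hA (P (base w)) (fun a => g (Sum.inl (Sum.inl a))) (h.unit_P _ hwU) fun d => by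
      simpa using hg' 0 (Pi.single d 1) 0
    have e2 := hA (Q (base w)) (fun a => g (Sum.inl (Sum.inr a))) (h.unit_Q _ hwU) fun d => by
      simpa using hg' 0 0 (Pi.single d 1)
    have e3 := Fintype.linearIndependent_iff.1 (h.linearIndependent_fderiv_eta_z hwU h3)
      (fun i => g (Sum.inr i)) (ContinuousLinearMap.ext fun v => by
        simpa [e1, e2, sum_apply, smul_apply] using hg' v 0 0)
    rintro ((a | a) | i)
    exacts [e1 a, e2 a, e3 i]
  · have hwU : base w ∈ U := hw.1
    have h1 := (h.linkChi_eq_zero_iff hwU).1 fun a => hw.2 (Sum.inl (Sum.inl a))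
    have h2 := (h.linkSigma_eq_zero_iff hwU).1 fun a => hw.2 (Sum.inl (Sum.inr a))
    have h3 : ∀ i, η i (z (base w)) = 0 := fun i => hw.2 (Sum.inr i)
    have hchi : ∀ f, (∀ b, poisson (phiSub c b) f w = 0) →
        ∀ a, poisson (linkChi (fun x => (P x)⁻¹) χ a) f w = 0 := fun f hf a => by
      rw [← fderiv_hamVec, hamVec_of_fderiv_eq (h.fderiv_linkChi hwU h1 a)]
      simp [fderiv_hamVec, hf]
    have hsig : ∀ f, (∀ b, poisson (piAdd s b) f w = 0) →
        ∀ a, poisson (linkSigma (fun x => (Q x)⁻¹) σ a) f w = 0 := fun f hf a => by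
      rw [← fderiv_hamVec, hamVec_of_fderiv_eq (h.fderiv_linkSigma hwU h2 a)]
      simp [fderiv_hamVec, hf]
    have hcomm : ∀ {f g : Phase (ι ⊕ A) → ℝ}, poisson f g w = 0 → poisson g f w = 0 :=
      fun hfg => by rw [poisson_comm, hfg, neg_zero]
    have e1 : ∀ a b, poisson (linkChi (fun x => (P x)⁻¹) χ a) (linkSigma (fun x => (Q x)⁻¹) σ b) w
        = 0 := fun a b => hchi _ (fun b' => hcomm (hsig _ (fun a' =>
          hcomm (h.box.poisson_phiSub_piAdd hwU b' a')) b)) a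
    have e2 : ∀ a i, poisson (linkChi (fun x => (P x)⁻¹) χ a) ((fun x => η i (z x)) ∘ base) w = 0 :=
      fun a i => hchi _ (fun b => h.box.poisson_phiSub_comp_z hwU b (h.smooth_eta i)) a
    have e3 : ∀ a i, poisson (linkSigma (fun x => (Q x)⁻¹) σ a) ((fun x => η i (z x)) ∘ base) w
        = 0 :=
      fun a i => hsig _ (fun b => h.box.poisson_piAdd_comp_z hwU b (h.smooth_eta i)) a
    rintro ((a | a) | i) ((b | b) | j)
    · exact hchi _ (fun b' => hcomm (hchi _ (fun a' => h.box.poisson_phiSub_phiSub hwU a' b') b)) a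
    · exact e1 a b
    · exact e2 a j
    · exact hcomm (e1 b a)
    · exact hsig _ (fun b' => hcomm (hsig _ (fun a' => h.box.poisson_piAdd_piAdd hwU a' b') b)) a
    · exact e3 a j
    · exact hcomm (e2 b i)
    · exact hcomm (e3 b i)
    · simp only [Sum.elim_inr]
      rw [← fderiv_hamVec, hdη w hwU]
      change (fderiv ℝ (fun x => η j (z x)) (base w)) (base (hamVec (fun w => η i (z (base w))) w))
        = 0
      rw [hamVec_comp_base h.box.isOpen (hk i) hwU, base_lift, fderiv_hamVec]
      exact h.poisson_eta_z hwU h3 i j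

end IsAdaptedBox

end Linking

section LinkingReduction

variable {ι A I : Type*} [Fintype ι] [DecidableEq ι] [Fintype A] [DecidableEq A]
  {U : Set (Phase ι)} {c s : A → Phase ι → ℝ} {z : Phase ι → Phase ι} {χ σ : A → Phase ι → ℝ}
  {η : I → Phase ι → ℝ} {P Q : Phase ι → Matrix A A ℝ}

/-! ### Restriction of covectors to a reduced phase space -/

/-- The restriction of a covector on the extended phase space to the directions `(q, p)`. -/
noncomputable def restrictBase (F : Phase (ι ⊕ A) →L[ℝ] ℝ) : Phase ι →L[ℝ] ℝ :=
  F.comp ((liftL ι A).comp (ContinuousLinearMap.inl ℝ _ _))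

omit [DecidableEq ι] [DecidableEq A] in
lemma restrictBase_apply (F : Phase (ι ⊕ A) →L[ℝ] ℝ) (v : Phase ι) :
    restrictBase F v = F (lift v 0 0) := rfl

/-- The Poisson bracket of the extended phase space splits into that of `(q, p)` and that of
`(φ, π)`. -/
lemma apply_sharp_extended (F H : Phase (ι ⊕ A) →L[ℝ] ℝ) :
    H (sharp F) = restrictBase H (sharp (restrictBase F)) -
      ∑ a, F (lift 0 0 (Pi.single a 1)) * H (lift 0 (Pi.single a 1) 0) +
      ∑ a, F (lift 0 (Pi.single a 1) 0) * H (lift 0 0 (Pi.single a 1)) := by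
  rw [sharp_extended, covector_lift]
  simp only [neg_mul, Finset.sum_neg_distrib, ← sub_eq_add_neg]
  rfl

omit [DecidableEq ι] in
/-- The differential of the restriction of `f` to the graph of `(Φ, Ψ)`. -/
lemma hasFDerivAt_comp_lift {f : Phase (ι ⊕ A) → ℝ} {F : Phase (ι ⊕ A) →L[ℝ] ℝ}
    {Φ Ψ : Phase ι → A → ℝ} {x : Phase ι} (hf : HasFDerivAt f F (lift x (Φ x) (Ψ x)))
    {Φ' Ψ' : A → Phase ι →L[ℝ] ℝ} (hΦ : ∀ a, HasFDerivAt (fun x => Φ x a) (Φ' a) x)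
    (hΨ : ∀ a, HasFDerivAt (fun x => Ψ x a) (Ψ' a) x) :
    HasFDerivAt (f ∘ fun x => lift x (Φ x) (Ψ x))
      (restrictBase F + ∑ a, F (lift 0 (Pi.single a 1) 0) • Φ' a +
        ∑ a, F (lift 0 0 (Pi.single a 1)) • Ψ' a) x := by
  have h1 : HasFDerivAt (fun x => lift x (Φ x) (Ψ x)) ((liftL ι A).comp
      ((ContinuousLinearMap.id ℝ (Phase ι)).prod
        ((ContinuousLinearMap.pi Φ').prod (ContinuousLinearMap.pi Ψ')))) x :=
    (liftL ι A).hasFDerivAt.comp x ((hasFDerivAt_id x).prodMk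
      ((hasFDerivAt_pi.2 hΦ).prodMk (hasFDerivAt_pi.2 hΨ)))
  refine (HasFDerivAt.comp x hf h1).congr_fderiv (ContinuousLinearMap.ext fun v => ?_)
  have h2 := covector_lift F v (fun a => Φ' a v) (fun a => Ψ' a v)
  simp only [add_apply, sum_apply, smul_apply, smul_eq_mul, restrictBase_apply]
  refine h2.trans ?_
  simp only [mul_comm]

namespace IsAdaptedBox

variable {w : Phase (ι ⊕ A)}

/-! ### Fixing `φ = 0` in the linking theory -/

/-- The Dirac bracket of the linking theory for the conditions `φ = 0`. -/
lemma diracBracket_phiCoord (h : IsAdaptedBox U χ σ η c s P Q z) (hw : base w ∈ U)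
    (h0 : ∀ a, piAdd s a w = 0) (f k : Phase (ι ⊕ A) → ℝ) :
    IsUnit (bracketMatrix (linkSigma (fun x => (Q x)⁻¹) σ) phiCoord w) ∧
    IsUnit (bracketMatrix (Sum.elim (linkSigma (fun x => (Q x)⁻¹) σ) phiCoord)
      (Sum.elim (linkSigma (fun x => (Q x)⁻¹) σ) phiCoord) w) ∧
    diracBracket (Sum.elim (linkSigma (fun x => (Q x)⁻¹) σ) phiCoord) f k w =
      poisson f k w + -1 * ∑ a, poisson f (piAdd s a) w * poisson (phiCoord a) k w -
        -1 * ∑ a, poisson f (phiCoord a) w * poisson (piAdd s a) k w := by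
  refine diracBracket_elim_recombination (h.unit_Q _ hw) (by norm_num) (h.fderiv_linkSigma hw h0)
    ?_ ?_ ?_ f k
  · ext a b
    exact h.box.poisson_piAdd_piAdd hw a b
  · ext a b
    change poisson (phiCoord a) (phiCoord b) w = 0
    rw [← fderiv_hamVec, fderiv_phiCoord, hamVec_phiCoord]
    rfl
  · ext a b
    change poisson (piAdd s a) (phiCoord b) w = _
    rw [h.box.poisson_piAdd hw, fderiv_phiCoord, phiL_apply, phiCoord_lift]
    by_cases hab : a = b <;> simp [hab, eq_comm]

/-- The Dirac bracket for the conditions `φ = 0` is the Poisson bracket of `U`. -/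
lemma diracBracket_phiCoord_lift (h : IsAdaptedBox U χ σ η c s P Q z) {x : Phase ι} (hx : x ∈ U)
    {f k : Phase (ι ⊕ A) → ℝ} (hf : ContDiffOn ℝ ∞ f (base ⁻¹' U))
    (hk : ContDiffOn ℝ ∞ k (base ⁻¹' U)) :
    diracBracket (Sum.elim (linkSigma (fun x => (Q x)⁻¹) σ) phiCoord) f k
      (lift x 0 (fun a => -s a x)) =
      poisson (f ∘ fun x => lift x 0 (fun a => -s a x)) (k ∘ fun x => lift x 0 (fun a => -s a x))
        x := by
  have hU := h.box.isOpen
  have hV := isOpen_preimage_base (A := A) hU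
  set w : Phase (ι ⊕ A) := lift x 0 (fun a => -s a x) with hwdef
  have hw : base w ∈ U := hx
  have hj : ∀ {f : Phase (ι ⊕ A) → ℝ}, ContDiffOn ℝ ∞ f (base ⁻¹' U) →
      HasFDerivAt (f ∘ fun x => lift x 0 (fun a => -s a x)) (restrictBase (fderiv ℝ f w) +
        ∑ a, fderiv ℝ f w (lift 0 (Pi.single a 1) 0) • (0 : Phase ι →L[ℝ] ℝ) +
        ∑ a, fderiv ℝ f w (lift 0 0 (Pi.single a 1)) • -fderiv ℝ (s a) x) x := fun hf =>
    hasFDerivAt_comp_lift (Φ := fun _ => 0) (hasFDerivAt_of_contDiffOn hV hf hw)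
      (fun a => hasFDerivAt_const (0 : ℝ) x)
      (fun a => (hasFDerivAt_of_contDiffOn hU (h.box.smooth_s a) hx).neg)
  rw [(h.diracBracket_phiCoord hw (fun a => by simp [piAdd, hwdef]) f k).2.2]
  rw [poisson_eq_sharp (f ∘ _), (hj hf).fderiv, (hj hk).fderiv]
  have e1 : ∀ a, poisson f (piAdd s a) w = fderiv ℝ f w (lift 0 (Pi.single a 1) 0) +
      fderiv ℝ (s a) x (sharp (restrictBase (fderiv ℝ f w))) := fun a => by
    rw [poisson_eq_sharp, sharp_extended, h.box.fderiv_piAdd_lift hw]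
    rfl
  have e2 : ∀ a, poisson (phiCoord a) k w = fderiv ℝ k w (lift 0 0 (Pi.single a 1)) := fun a => by
    rw [← fderiv_hamVec, hamVec_phiCoord]
  have e3 : ∀ a, poisson f (phiCoord a) w = -fderiv ℝ f w (lift 0 0 (Pi.single a 1)) := fun a => by
    rw [poisson_eq_sharp, sharp_extended, fderiv_phiCoord, phiL_apply, phiCoord_lift]
  have e4 : ∀ a, poisson (piAdd s a) k w = restrictBase (fderiv ℝ k w) (hamVec (s a) x) -
      fderiv ℝ k w (lift 0 (Pi.single a 1) 0) := fun a => by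
    rw [h.box.poisson_piAdd hw, covector_lift]
    simp [Pi.single_apply, restrictBase_apply, ← sub_eq_add_neg, hwdef]
  have e5 : ∀ a b, fderiv ℝ (s a) x (hamVec (s b) x) = 0 := fun a b => by
    rw [fderiv_hamVec, h.box.bracket_ss x hx b a]
  rw [poisson_eq_sharp f, apply_sharp_extended]
  simp only [e1, e2, e3, e4, map_add, map_sum, map_smul, map_neg, smul_zero, smul_neg,
    Finset.sum_const_zero, add_zero, add_apply, sum_apply, smul_apply, neg_apply,
    ← hamVec_eq_sharp (s _), e5, smul_eq_mul, mul_zero, neg_zero, Finset.sum_neg_distrib]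
  simp only [add_mul, mul_sub, neg_mul, Finset.sum_add_distrib, Finset.sum_sub_distrib,
    Finset.sum_neg_distrib, mul_comm (fderiv ℝ (s _) x _)]
  ring

/-- The flow of `π + s` moves a point over `x` along a flow line of `s` to `φ = c = 0`, with
`π = -s` unchanged; the invariants `z` and `π` determine the point of the orbit with `φ = 0`. -/
theorem isPartialGaugeFixing_phiCoord (h : IsAdaptedBox U χ σ η c s P Q z) :
    IsPartialGaugeFixing (base ⁻¹' U : Set (Phase (ι ⊕ A))) (linkSigma (fun x => (Q x)⁻¹) σ)
      (Sum.elim (linkChi (fun x => (P x)⁻¹) χ) (fun i => (fun x => η i (z x)) ∘ base))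
      phiCoord := by
  have hU := h.box.isOpen
  have hS : ∀ {w}, w ∈ surface (base ⁻¹' U : Set (Phase (ι ⊕ A)))
      (Sum.elim (linkSigma (fun x => (Q x)⁻¹) σ)
        (Sum.elim (linkChi (fun x => (P x)⁻¹) χ) (fun i => (fun x => η i (z x)) ∘ base))) ↔
      base w ∈ U ∧ (∀ a, piAdd s a w = 0) ∧ (∀ a, phiSub c a w = 0) ∧
        ∀ i, η i (z (base w)) = 0 := fun {w} => by
    simp only [surface, mem_ofPred_eq, Sum.forall, Sum.elim_inl, Sum.elim_inr, mem_preimage]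
    refine and_congr_right fun hw => ?_
    rw [h.linkChi_eq_zero_iff hw, h.linkSigma_eq_zero_iff hw]
    rfl
  have hz : ∀ w : Phase (ι ⊕ A), base w ∈ U →
      HasFDerivAt (fun w => (z (base w), fun a => piCoord a w))
        (((fderiv ℝ z (base w)).comp (baseL ι A)).prod (ContinuousLinearMap.pi (piL ι))) w :=
    fun w hw => (hasFDerivAt_comp_base hU h.box.smooth_z hw).prodMk
      (ContinuousLinearMap.pi (piL ι)).hasFDerivAt
  refine ⟨fun w hw => ?_, fun w hw hg => ?_⟩
  · refine existsUnique_mem_gaugeOrbit (k := piAdd s) (P := fun w => Q (base w))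
      (Q := fun w => (Q (base w))⁻¹) (z := fun w => (z (base w), fun a => piCoord a w))
      (fun w hw a => ?_) (fun w hw => ?_) (fun a b => ?_)
      (fun w hw => (hz w (hS.1 hw).1).differentiableAt) (fun w hw a => ?_)
      (fun y hy y' hy' hg hg' hyz => ?_) (fun w hw => ?_) hw
    · exact hamVec_of_fderiv_eq (h.fderiv_linkSigma (hS.1 hw).1 (hS.1 hw).2.1 a)
    · exact h.symm.inv_mul_P (hS.1 hw).1
    · exact (contDiffOn_comp_base (contDiffOn_matrix_inv h.smooth_Q h.unit_Q a b)).continuousOn.mono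
        fun w hw => hw.1
    · have hwU := (hS.1 hw).1
      rw [(hz w hwU).fderiv, hamVec_piAdd hU h.box.smooth_s hwU]
      simp only [ContinuousLinearMap.prod_apply, ContinuousLinearMap.comp_apply, baseL_apply,
        base_lift, h.box.fderiv_z_hamVec_s _ hwU]
      rfl
    · obtain ⟨hyU, h1, h2, -⟩ := hS.1 hy
      obtain ⟨hyU', h1', h2', -⟩ := hS.1 hy'
      have hπ : ∀ a, piCoord a y = piCoord a y' := congrFun (congrArg Prod.snd hyz)
      refine ext_extended (h.box.injOn _ hyU _ hyU' (fun a => ?_) (fun a => ?_)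
        (congrArg Prod.fst hyz)) (fun a => (hg a).trans (hg' a).symm) hπ
      · have e1 := h2 a
        have e2 := h2' a
        rw [phiSub, hg] at e1
        rw [phiSub, hg'] at e2
        linarith
      · have e1 := h1 a
        have e2 := h1' a
        have e3 := hπ a
        rw [piAdd] at e1 e2
        linarith
    · obtain ⟨hwU, h1, h2, h3⟩ := hS.1 hw
      obtain ⟨γ, h0, hγ⟩ := h.box.line_s _ hwU
      have hφ : ∀ a, phiCoord a w = c a (base w) := fun a => sub_eq_zero.1 (h2 a)
      have hΓ := isFlowLine_piAdd hU h.box.smooth_s hγ (fun a => phiCoord a w)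
        (fun a => piCoord a w)
      refine ⟨_, _, ?_, fun t ht => ⟨?_, (hΓ t ht).2⟩, fun a => ?_⟩
      · simp only [h0, zero_smul, add_zero]
        exact lift_base w
      · have hγU := (hγ t ht).1
        have ec := fun a => hγ.apply_eq (differentiableAt_of_contDiffOn hU (h.box.smooth_c a))
          (c := fun b => -if a = b then 1 else 0) (fun x hx b => by
            rw [fderiv_hamVec, poisson_comm, h.box.bracket_cs x hx a b]) ht
        have es := fun a => hγ.apply_eq (differentiableAt_of_contDiffOn hU (h.box.smooth_s a))
          (c := 0) (fun x hx b => by rw [fderiv_hamVec]; exact h.box.bracket_ss x hx b a) ht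
        have ez := hγ.apply_eq (differentiableAt_of_contDiffOn hU h.box.smooth_z)
          (c := 0) h.box.fderiv_z_hamVec_s ht
        refine hS.2 ⟨hγU, fun a => ?_, fun a => ?_, fun i => ?_⟩
        · rw [← h1 a, piAdd, piAdd, piCoord_lift, base_lift, es a, h0]
          simp
        · rw [phiSub, phiCoord_lift, base_lift, ec a, h0]
          simp [hφ]
        · rw [base_lift, ez, h0]
          simpa using h3 i
      · rw [phiCoord_lift]
        simp [hφ]
  · obtain ⟨hwU, h1, h2, -⟩ := hS.1 hw
    exact (h.diracBracket_phiCoord hwU h1 0 0).1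

/-- Fixing `φ = 0` in the linking theory yields `(U, χ, η)`. -/
theorem reducesTo_chi [Finite I] (h : IsAdaptedBox U χ σ η c s P Q z) :
    ReducesTo (base ⁻¹' U) (linkSigma (fun x => (Q x)⁻¹) σ)
      (Sum.elim (linkChi (fun x => (P x)⁻¹) χ) (fun i => (fun x => η i (z x)) ∘ base)) phiCoord
      U (Sum.elim χ η) (fun x => lift x 0 (fun a => -recombine (fun x => (Q x)⁻¹) σ a x)) := by
  have hU := h.box.isOpen
  have hj : ∀ x ∈ U, lift x 0 (fun a => -recombine (fun x => (Q x)⁻¹) σ a x) =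
      lift x (0 : A → ℝ) (fun a => -s a x) := fun x hx => by
    congr 1
    exact funext fun a => congrArg Neg.neg (h.symm.c_eq hx a).symm
  have hpi : ∀ x ∈ U, ∀ a, piAdd s a (lift x (0 : A → ℝ) (fun a => -s a x)) = 0 := fun x _ a => by
    simp [piAdd]
  refine ⟨h.isPartialGaugeFixing_phiCoord, h.theory_chi_eta, ?_, ⟨fun x hx => ?_, ?_, ?_⟩,
    fun x hx => ?_, fun f k hf hk x hx => ?_, ?_⟩
  · refine ContDiffOn.congr (f := fun x => liftL ι A (x, 0, fun a => -s a x)) ?_ hj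
    exact (liftL ι A).contDiff.comp_contDiffOn (contDiffOn_id.prodMk
      (contDiffOn_const.prodMk (contDiffOn_pi.2 fun a => (h.box.smooth_s a).neg)))
  · simp only [hj x hx]
    exact mem_surface_elim.2 ⟨hx, (h.linkSigma_eq_zero_iff
      (w := lift x 0 fun a => -s a x) hx).2 (hpi x hx), fun _ => rfl⟩
  · intro x _ y _ hxy
    exact congrArg base hxy
  · intro w hw
    obtain ⟨hwU, h1, h2⟩ := mem_surface_elim.1 hw
    have h3 := (h.linkSigma_eq_zero_iff hwU).1 h1
    refine ⟨base w, hwU, ?_⟩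
    simp only [hj _ hwU]
    exact ext_extended rfl (fun a => (h2 a).symm) fun a => (eq_neg_of_add_eq_zero_left (h3 a)).symm
  · rw [hj x hx]
    exact (h.diracBracket_phiCoord (w := lift x 0 fun a => -s a x) hx (hpi x hx) 0 0).2.1
  · have hev : (fun x => lift x 0 (fun a => -recombine (fun x => (Q x)⁻¹) σ a x)) =ᶠ[𝓝 x]
        fun x => lift x (0 : A → ℝ) (fun a => -s a x) := by
      filter_upwards [hU.mem_nhds hx] with y hy using hj y hy
    rw [hj x hx, h.diracBracket_phiCoord_lift hx hf hk]
    exact poisson_congr (hev.symm.fun_comp f) (hev.symm.fun_comp k)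
  · ext x
    simp only [surface, mem_ofPred_eq, Sum.forall, Sum.elim_inl, Sum.elim_inr, Function.comp_apply,
      base_lift]
    refine and_congr_right fun hx => ?_
    have h1 := h.linkChi_eq_zero_iff (w := lift x 0
      (fun a => -recombine (fun x => (Q x)⁻¹) σ a x)) hx
    have h2 : (∀ a, phiSub c a (lift x 0 (fun a => -recombine (fun x => (Q x)⁻¹) σ a x)) = 0) ↔
        ∀ a, c a x = 0 := by simp [phiSub]
    rw [h1, h2, h.c_eq_zero_iff hx]
    exact and_congr_right fun hc => h.eta_z_eq_zero_iff hx ((h.c_eq_zero_iff hx).2 hc)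

end IsAdaptedBox

end LinkingReduction

section LinkingReduction

variable {ι A I : Type*} [Fintype ι] [DecidableEq ι] [Fintype A] [DecidableEq A]
  {U : Set (Phase ι)} {c s : A → Phase ι → ℝ} {z : Phase ι → Phase ι} {χ σ : A → Phase ι → ℝ}
  {η : I → Phase ι → ℝ} {P Q : Phase ι → Matrix A A ℝ}

namespace IsAdaptedBox

variable {w : Phase (ι ⊕ A)}

/-! ### Fixing `π = 0` in the linking theory -/

/-- The Dirac bracket of the linking theory for the conditions `π = 0`. -/
lemma diracBracket_piCoord (h : IsAdaptedBox U χ σ η c s P Q z) (hw : base w ∈ U)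
    (h0 : ∀ a, phiSub c a w = 0) (f k : Phase (ι ⊕ A) → ℝ) :
    IsUnit (bracketMatrix (linkChi (fun x => (P x)⁻¹) χ) piCoord w) ∧
    IsUnit (bracketMatrix (Sum.elim (linkChi (fun x => (P x)⁻¹) χ) piCoord)
      (Sum.elim (linkChi (fun x => (P x)⁻¹) χ) piCoord) w) ∧
    diracBracket (Sum.elim (linkChi (fun x => (P x)⁻¹) χ) piCoord) f k w =
      poisson f k w + 1 * ∑ a, poisson f (phiSub c a) w * poisson (piCoord a) k w -
        1 * ∑ a, poisson f (piCoord a) w * poisson (phiSub c a) k w := by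
  refine diracBracket_elim_recombination (h.unit_P _ hw) (by norm_num) (h.fderiv_linkChi hw h0)
    ?_ ?_ ?_ f k
  · ext a b
    exact h.box.poisson_phiSub_phiSub hw a b
  · ext a b
    change poisson (piCoord a) (piCoord b) w = 0
    rw [← fderiv_hamVec, fderiv_piCoord, hamVec_piCoord]
    rfl
  · ext a b
    change poisson (phiSub c a) (piCoord b) w = _
    rw [h.box.poisson_phiSub hw, fderiv_piCoord, piL_apply, piCoord_lift]
    by_cases hab : a = b <;> simp [hab, eq_comm]

/-- The Dirac bracket for the conditions `π = 0` is the Poisson bracket of `U`. -/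
lemma diracBracket_piCoord_lift (h : IsAdaptedBox U χ σ η c s P Q z) {x : Phase ι} (hx : x ∈ U)
    {f k : Phase (ι ⊕ A) → ℝ} (hf : ContDiffOn ℝ ∞ f (base ⁻¹' U))
    (hk : ContDiffOn ℝ ∞ k (base ⁻¹' U)) :
    diracBracket (Sum.elim (linkChi (fun x => (P x)⁻¹) χ) piCoord) f k
      (lift x (fun a => c a x) 0) =
      poisson (f ∘ fun x => lift x (fun a => c a x) 0) (k ∘ fun x => lift x (fun a => c a x) 0)
        x := by
  have hU := h.box.isOpen
  have hV := isOpen_preimage_base (A := A) hU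
  set w : Phase (ι ⊕ A) := lift x (fun a => c a x) 0 with hwdef
  have hw : base w ∈ U := hx
  have hj : ∀ {f : Phase (ι ⊕ A) → ℝ}, ContDiffOn ℝ ∞ f (base ⁻¹' U) →
      HasFDerivAt (f ∘ fun x => lift x (fun a => c a x) 0) (restrictBase (fderiv ℝ f w) +
        ∑ a, fderiv ℝ f w (lift 0 (Pi.single a 1) 0) • fderiv ℝ (c a) x +
        ∑ a, fderiv ℝ f w (lift 0 0 (Pi.single a 1)) • (0 : Phase ι →L[ℝ] ℝ)) x := fun hf =>
    hasFDerivAt_comp_lift (Ψ := fun _ => 0) (hasFDerivAt_of_contDiffOn hV hf hw)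
      (fun a => hasFDerivAt_of_contDiffOn hU (h.box.smooth_c a) hx)
      (fun a => hasFDerivAt_const (0 : ℝ) x)
  rw [(h.diracBracket_piCoord hw (fun a => by simp [phiSub, hwdef]) f k).2.2]
  rw [poisson_eq_sharp (f ∘ _), (hj hf).fderiv, (hj hk).fderiv]
  have e1 : ∀ a, poisson f (phiSub c a) w = -fderiv ℝ f w (lift 0 0 (Pi.single a 1)) -
      fderiv ℝ (c a) x (sharp (restrictBase (fderiv ℝ f w))) := fun a => by
    rw [poisson_eq_sharp, sharp_extended, h.box.fderiv_phiSub_lift hw]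
    rfl
  have e2 : ∀ a, poisson (piCoord a) k w = -fderiv ℝ k w (lift 0 (Pi.single a 1) 0) := fun a => by
    rw [← fderiv_hamVec, hamVec_piCoord, covector_lift]
    have h1 : fderiv ℝ k w (lift 0 0 0) = 0 := map_zero (restrictBase (fderiv ℝ k w))
    simp [Pi.single_apply, h1]
  have e3 : ∀ a, poisson f (piCoord a) w = fderiv ℝ f w (lift 0 (Pi.single a 1) 0) := fun a => by
    rw [poisson_eq_sharp, sharp_extended, fderiv_piCoord, piL_apply, piCoord_lift]
  have e4 : ∀ a, poisson (phiSub c a) k w = -restrictBase (fderiv ℝ k w) (hamVec (c a) x) +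
      fderiv ℝ k w (lift 0 0 (Pi.single a 1)) := fun a => by
    rw [h.box.poisson_phiSub hw, covector_lift, ← restrictBase_apply, map_neg]
    simp [Pi.single_apply, hwdef]
  have e5 : ∀ a b, fderiv ℝ (c a) x (hamVec (c b) x) = 0 := fun a b => by
    rw [fderiv_hamVec, h.box.bracket_cc x hx b a]
  rw [poisson_eq_sharp f, apply_sharp_extended]
  simp only [e1, e2, e3, e4, map_add, map_sum, map_smul, smul_zero,
    Finset.sum_const_zero, add_zero, add_apply, sum_apply, smul_apply,
    ← hamVec_eq_sharp (c _), e5, smul_eq_mul, mul_zero]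
  simp only [sub_mul, mul_add, neg_mul, mul_neg, Finset.sum_add_distrib, Finset.sum_sub_distrib,
    Finset.sum_neg_distrib, mul_comm (fderiv ℝ (c _) x _)]
  ring

/-- The flow of `φ - c` moves a point over `x` along a flow line of `c` to `π = -s = 0`, with
`φ = c` unchanged; the invariants `z` and `φ` determine the point of the orbit with `π = 0`. -/
theorem isPartialGaugeFixing_piCoord (h : IsAdaptedBox U χ σ η c s P Q z) :
    IsPartialGaugeFixing (base ⁻¹' U : Set (Phase (ι ⊕ A))) (linkChi (fun x => (P x)⁻¹) χ)
      (Sum.elim (linkSigma (fun x => (Q x)⁻¹) σ) (fun i => (fun x => η i (z x)) ∘ base))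
      piCoord := by
  have hU := h.box.isOpen
  have hS : ∀ {w}, w ∈ surface (base ⁻¹' U : Set (Phase (ι ⊕ A)))
      (Sum.elim (linkChi (fun x => (P x)⁻¹) χ)
        (Sum.elim (linkSigma (fun x => (Q x)⁻¹) σ) (fun i => (fun x => η i (z x)) ∘ base))) ↔
      base w ∈ U ∧ (∀ a, phiSub c a w = 0) ∧ (∀ a, piAdd s a w = 0) ∧
        ∀ i, η i (z (base w)) = 0 := fun {w} => by
    simp only [surface, mem_ofPred_eq, Sum.forall, Sum.elim_inl, Sum.elim_inr, mem_preimage]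
    refine and_congr_right fun hw => ?_
    rw [h.linkChi_eq_zero_iff hw, h.linkSigma_eq_zero_iff hw]
    rfl
  have hz : ∀ w : Phase (ι ⊕ A), base w ∈ U →
      HasFDerivAt (fun w => (z (base w), fun a => phiCoord a w))
        (((fderiv ℝ z (base w)).comp (baseL ι A)).prod (ContinuousLinearMap.pi (phiL ι))) w :=
    fun w hw => (hasFDerivAt_comp_base hU h.box.smooth_z hw).prodMk
      (ContinuousLinearMap.pi (phiL ι)).hasFDerivAt
  refine ⟨fun w hw => ?_, fun w hw hg => ?_⟩
  · refine existsUnique_mem_gaugeOrbit (k := phiSub c) (P := fun w => P (base w))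
      (Q := fun w => (P (base w))⁻¹) (z := fun w => (z (base w), fun a => phiCoord a w))
      (fun w hw a => ?_) (fun w hw => ?_) (fun a b => ?_)
      (fun w hw => (hz w (hS.1 hw).1).differentiableAt) (fun w hw a => ?_)
      (fun y hy y' hy' hg hg' hyz => ?_) (fun w hw => ?_) hw
    · exact hamVec_of_fderiv_eq (h.fderiv_linkChi (hS.1 hw).1 (hS.1 hw).2.1 a)
    · exact h.inv_mul_P (hS.1 hw).1
    · exact (contDiffOn_comp_base (contDiffOn_matrix_inv h.smooth_P h.unit_P a b)).continuousOn.mono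
        fun w hw => hw.1
    · have hwU := (hS.1 hw).1
      rw [(hz w hwU).fderiv, hamVec_phiSub hU h.box.smooth_c hwU]
      simp only [ContinuousLinearMap.prod_apply, ContinuousLinearMap.comp_apply, baseL_apply,
        base_lift, map_neg, h.box.fderiv_z_hamVec_c _ hwU, neg_zero]
      rfl
    · obtain ⟨hyU, h1, h2, -⟩ := hS.1 hy
      obtain ⟨hyU', h1', h2', -⟩ := hS.1 hy'
      have hφ : ∀ a, phiCoord a y = phiCoord a y' := congrFun (congrArg Prod.snd hyz)
      refine ext_extended (h.box.injOn _ hyU _ hyU' (fun a => ?_) (fun a => ?_)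
        (congrArg Prod.fst hyz)) hφ (fun a => (hg a).trans (hg' a).symm)
      · have e1 := h1 a
        have e2 := h1' a
        have e3 := hφ a
        rw [phiSub] at e1 e2
        linarith
      · have e1 := h2 a
        have e2 := h2' a
        rw [piAdd, hg] at e1
        rw [piAdd, hg'] at e2
        linarith
    · obtain ⟨hwU, h1, h2, h3⟩ := hS.1 hw
      obtain ⟨γ, h0, hγ⟩ := h.box.line_c _ hwU
      have hπ : ∀ a, piCoord a w = -s a (base w) := fun a => eq_neg_of_add_eq_zero_left (h2 a)
      have hΓ := isFlowLine_phiSub hU h.box.smooth_c hγ (fun a => phiCoord a w)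
        (fun a => piCoord a w)
      refine ⟨_, _, ?_, fun t ht => ⟨?_, (hΓ t ht).2⟩, fun a => ?_⟩
      · simp only [h0, zero_smul, add_zero]
        exact lift_base w
      · have hγU := (hγ t ht).1
        have es := fun a => hγ.apply_eq (differentiableAt_of_contDiffOn hU (h.box.smooth_s a))
          (c := fun b => if b = a then 1 else 0) (fun x hx b => by
            rw [fderiv_hamVec, h.box.bracket_cs x hx b a]) ht
        have ec := fun a => hγ.apply_eq (differentiableAt_of_contDiffOn hU (h.box.smooth_c a))
          (c := 0) (fun x hx b => by rw [fderiv_hamVec]; exact h.box.bracket_cc x hx b a) ht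
        have ez := hγ.apply_eq (differentiableAt_of_contDiffOn hU h.box.smooth_z)
          (c := 0) h.box.fderiv_z_hamVec_c ht
        refine hS.2 ⟨hγU, fun a => ?_, fun a => ?_, fun i => ?_⟩
        · rw [← h1 a, phiSub, phiSub, phiCoord_lift, base_lift, ec a, h0]
          simp
        · rw [piAdd, piCoord_lift, base_lift, es a, h0]
          simp [hπ]
          ring
        · rw [base_lift, ez, h0]
          simpa using h3 i
      · rw [piCoord_lift]
        simp [hπ]
  · obtain ⟨hwU, h1, h2, -⟩ := hS.1 hw
    exact (h.diracBracket_piCoord hwU h1 0 0).1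

/-- Fixing `π = 0` in the linking theory yields `(U, σ, η)`. -/
theorem reducesTo_sigma [Finite I] (h : IsAdaptedBox U χ σ η c s P Q z) :
    ReducesTo (base ⁻¹' U) (linkChi (fun x => (P x)⁻¹) χ)
      (Sum.elim (linkSigma (fun x => (Q x)⁻¹) σ) (fun i => (fun x => η i (z x)) ∘ base)) piCoord
      U (Sum.elim σ η) (fun x => lift x (fun a => recombine (fun x => (P x)⁻¹) χ a x) 0) := by
  have hU := h.box.isOpen
  have hj : ∀ x ∈ U, lift x (fun a => recombine (fun x => (P x)⁻¹) χ a x) 0 =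
      lift x (fun a => c a x) (0 : A → ℝ) := fun x hx => by
    congr 1
    exact funext fun a => (h.c_eq hx a).symm
  have hphi : ∀ x ∈ U, ∀ a, phiSub c a (lift x (fun a => c a x) (0 : A → ℝ)) = 0 := fun x _ a => by
    simp [phiSub]
  refine ⟨h.isPartialGaugeFixing_piCoord, h.theory_sigma_eta, ?_, ⟨fun x hx => ?_, ?_, ?_⟩,
    fun x hx => ?_, fun f k hf hk x hx => ?_, ?_⟩
  · refine ContDiffOn.congr (f := fun x => liftL ι A (x, fun a => c a x, 0)) ?_ hj
    exact (liftL ι A).contDiff.comp_contDiffOn (contDiffOn_id.prodMk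
      ((contDiffOn_pi.2 h.box.smooth_c).prodMk contDiffOn_const))
  · simp only [hj x hx]
    exact mem_surface_elim.2 ⟨hx, (h.linkChi_eq_zero_iff
      (w := lift x (fun a => c a x) 0) hx).2 (hphi x hx), fun _ => rfl⟩
  · intro x _ y _ hxy
    exact congrArg base hxy
  · intro w hw
    obtain ⟨hwU, h1, h2⟩ := mem_surface_elim.1 hw
    have h3 := (h.linkChi_eq_zero_iff hwU).1 h1
    refine ⟨base w, hwU, ?_⟩
    simp only [hj _ hwU]
    exact ext_extended rfl (fun a => (sub_eq_zero.1 (h3 a)).symm) fun a => (h2 a).symm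
  · rw [hj x hx]
    exact (h.diracBracket_piCoord (w := lift x (fun a => c a x) 0) hx (hphi x hx) 0 0).2.1
  · have hev : (fun x => lift x (fun a => recombine (fun x => (P x)⁻¹) χ a x) 0) =ᶠ[𝓝 x]
        fun x => lift x (fun a => c a x) (0 : A → ℝ) := by
      filter_upwards [hU.mem_nhds hx] with y hy using hj y hy
    rw [hj x hx, h.diracBracket_piCoord_lift hx hf hk]
    exact poisson_congr (hev.symm.fun_comp f) (hev.symm.fun_comp k)
  · ext x
    simp only [surface, mem_ofPred_eq, Sum.forall, Sum.elim_inl, Sum.elim_inr, Function.comp_apply,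
      base_lift]
    refine and_congr_right fun hx => ?_
    have h1 := h.linkSigma_eq_zero_iff (w := lift x
      (fun a => recombine (fun x => (P x)⁻¹) χ a x) 0) hx
    have h2 : (∀ a, piAdd s a (lift x (fun a => recombine (fun x => (P x)⁻¹) χ a x) 0) = 0) ↔
        ∀ a, s a x = 0 := by simp [piAdd]
    rw [h1, h2, h.s_eq_zero_iff hx]
    exact and_congr_right fun hs => h.symm.eta_z_eq_zero_iff hx ((h.s_eq_zero_iff hx).2 hs)

end IsAdaptedBox

end LinkingReduction

end SymTrading

theorem mainTheorem3 {ι A I : Type*} [Fintype ι] [DecidableEq ι] [Fintype A] [DecidableEq A]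
    [Fintype I]
    (Γ : Set (SymTrading.Phase ι)) (χ σ : A → SymTrading.Phase ι → ℝ)
    (η : I → SymTrading.Phase ι → ℝ)
    (hχ : SymTrading.IsGaugeTheory Γ χ) (hσ : SymTrading.IsGaugeTheory Γ σ)
    (hχη : SymTrading.IsGaugeTheory Γ (Sum.elim χ η))
    (hση : SymTrading.IsGaugeTheory Γ (Sum.elim σ η))
    (hχσ : ∀ x ∈ SymTrading.surface Γ (Sum.elim χ σ),
      IsUnit (SymTrading.bracketMatrix χ σ x)) :
    SymTrading.HaveCommonReduction Γ χ η σ σ η χ ∧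
    ∀ x₀ ∈ SymTrading.surface Γ (Sum.elim χ σ), ∀ W ∈ 𝓝 x₀,
      ∃ U : Set (SymTrading.Phase ι), IsOpen U ∧ x₀ ∈ U ∧ U ⊆ Γ ∩ W ∧
        SymTrading.EquivalentVia U χ η σ σ η χ ∧
        ∃ (M N : SymTrading.Phase ι → Matrix A A ℝ) (η' : I → SymTrading.Phase ι → ℝ),
          SymTrading.IsConjugateAbelianization U χ σ M N ∧
          SymTrading.IsLinkingTheory U χ σ η η' M N := by
  refine ⟨SymTrading.haveCommonReduction hχ hσ hχη hση hχσ, fun x₀ hx₀ W hW => ?_⟩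
  obtain ⟨U, c, s, P, Q, z, hxU, hUW, h⟩ :=
    SymTrading.exists_adaptedBox hχ hσ hχη hση hx₀ (hχσ x₀ hx₀) hW
  refine ⟨U, h.box.isOpen, hxU, hUW, h.equivalentVia, fun x => (P x)⁻¹, fun x => (Q x)⁻¹,
    fun i x => η i (z x), h.isConjugateAbelianization, ?_⟩
  exact
    { extends_eta := fun x hx i => congrArg (η i) (h.box.z_eq_self x hx.1
        ((h.c_eq_zero_iff hx.1).2 (SymTrading.mem_surface_elim.1 hx).2.1)
        ((h.s_eq_zero_iff hx.1).2 (SymTrading.mem_surface_elim.1 hx).2.2))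
      theory := h.isGaugeTheory_linking
      reducesToChi := h.reducesTo_chi
      reducesToSigma := h.reducesTo_sigma }
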